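/- A multi-agent influence diagram (MAID) $\mathcal M$ consists of a finite set of agents, a finite DAG whose nodes are random variables with finite domains of at least two elements, each of them a chance variable, a decision variable of one agent, or a utility variable of one agent, together with a conditional probability distribution (CPD) given its parents for each chance variable and a deterministic dependence on its parents for each utility variable (whose values are numbers). All probabilities and utilities are rational, given by fractions of binary integers, and all tables are listed explicitly. A decision rule $\pi_D$ for a decision variable $D$ is a CPD of $D$ given its parents; a (behavioural) policy of agent $i$ is a choice of a decision rule for each of her decision variables (set $\mathbf D^i$), and a policy profile $\pi$ is a policy for each agent. It is pure if all probabilities in its decision rules are $0$ or $1$. A profile induces a joint distribution (the product of all CPDs), and $EU^i(\pi)$ is the expected sum of agent $i$'s utility variables. A profile $\pi$ is a Nash equilibrium if $EU^i(\varpi^i,\pi^{-i})\le EU^i(\pi)$ for every agent $i$ and every behavioural policy $\varpi^i$ of $i$. Add to each variable $V$ of the DAG a new parent $\mathsf M_V$ (its mechanism). For a decision variable $D$ of agent $i$ and a decision variable $D'\neq D$, the mechanism of $D'$ is $s$-reachable from the decision rule of $D$ if in this enlarged graph $\mathsf M_{D'}$ is not d-separated, given $D$ and the parents of $D$, from the set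 of those utility variables of agent $i$ that are descendants of $D$. $\mathcal M$ has sufficient information if the directed graph on the decision variables with an edge $D'\to D$ whenever the mechanism of $D'$ is $s$-reachable from the decision rule of $D$ is acyclic. Is-Best-Response is the decision problem: given a MAID $\mathcal M$, an agent $i$, a partial profile $\pi^{-i}$ of rational behavioural policies of the other agents, and $q\in\mathbb Q$, is there a behavioural policy $\hat\pi^i$ with $EU^i(\hat\pi^i,\pi^{-i})>q$? Let $\mathcal C$ be a class of MAIDs (for example all MAIDs, or those in which the treewidth and every $|\mathbf D^i|$ are bounded by fixed constants) that is closed under replacing a decision variable $D$ by a chance variable whose CPD is a rational decision rule $\pi_D$. Let $k\in\mathbb N$, and let $\mathcal C_k$ be the class of those MAIDs in $\mathcal C$ that have sufficient information and in which every decision variable has in-degree at most $k$. If Is-Best-Response restricted to MAIDs in $\mathcal C_k$ can be solved in polynomial time, then there is a polynomial-time algorithm that, given any MAID in $\mathcal C_k$, returns a Nash equilibrium of it in pure policies. -/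

import Mathlib

open scoped BigOperators

/-! ## A machine model with a step count

Programs work on finite binary trees (every finite object is encoded as such a tree).  The cost of
a run counts every elementary operation together with the size of the tree it reads, so within cost
`t` only trees of size at most `t` are produced and each elementary operation can be carried out by
a Turing machine in time polynomial in its cost; conversely a program simulates a Turing machine
with polynomial overhead.  Hence polynomial time in this model is ordinary polynomial time. -/

/-- Finite binary trees: the data on which programs operate. -/
inductive TreeData : Type
  | nil : TreeData
  | cons : TreeData → TreeData → TreeData

namespace TreeData

/-- The number of nodes and leaves of a tree. -/
def size : TreeData → ℕ
  | nil => 1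
  | cons a b => size a + size b + 1

/-- Left component (and `nil` for `nil`). -/
def left : TreeData → TreeData
  | nil => nil
  | cons a _ => a

/-- Right component (and `nil` for `nil`). -/
def right : TreeData → TreeData
  | nil => nil
  | cons _ b => b

/-- A list of trees as a tree. -/
def ofList : List TreeData → TreeData
  | [] => nil
  | a :: l => cons a (ofList l)

/-- Truth values. -/
def ofBool : Bool → TreeData
  | false => nil
  | true => cons nil nil

/-- Names of finitely many items (agents, variables, values) and tags, in unary. -/
def ofIndex (n : ℕ) : TreeData := ofList (List.replicate n nil)

/-- Natural numbers in binary, least significant bit first. -/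
def ofNat (n : ℕ) : TreeData := ofList (n.bits.map ofBool)

/-- Integers: a sign bit and the absolute value in binary. -/
def ofInt (z : ℤ) : TreeData := cons (ofBool (decide (z < 0))) (ofNat z.natAbs)

/-- Rational numbers: numerator and denominator, both in binary. -/
def ofRat (q : ℚ) : TreeData := cons (ofInt q.num) (ofNat q.den)

end TreeData

/-- Programs: a WHILE language on binary trees, with one current value. -/
inductive TreeProg : Type
  /-- return the empty tree -/
  | nil : TreeProg
  /-- return the input -/
  | id : TreeProg
  /-- return the left component of the input -/
  | left : TreeProg
  /-- return the right component of the input -/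
  | right : TreeProg
  /-- run both programs on the input and return the pair of the results -/
  | pair (f g : TreeProg) : TreeProg
  /-- run `f` on the input, then `g` on the result -/
  | seq (f g : TreeProg) : TreeProg
  /-- if the test program `c` returns a nonempty tree, then run `f`, otherwise run `g` -/
  | ite (c f g : TreeProg) : TreeProg
  /-- as long as the test program `c` returns a nonempty tree, replace the value by what `f`
  returns on it -/
  | loop (c f : TreeProg) : TreeProg

/-- `Runs P x y t`: on input `x` the program `P` halts with output `y` after a run of cost `t`. -/
inductive TreeProg.Runs : TreeProg → TreeData → TreeData → ℕ → Prop
  | nil (x : TreeData) : Runs .nil x .nil (x.size + 1)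
  | id (x : TreeData) : Runs .id x x (x.size + 1)
  | left (x : TreeData) : Runs .left x x.left (x.size + 1)
  | right (x : TreeData) : Runs .right x x.right (x.size + 1)
  | pair {f g : TreeProg} {x y z : TreeData} {s t : ℕ} :
      Runs f x y s → Runs g x z t → Runs (.pair f g) x (.cons y z) (s + t + 1)
  | seq {f g : TreeProg} {x y z : TreeData} {s t : ℕ} :
      Runs f x y s → Runs g y z t → Runs (.seq f g) x z (s + t + 1)
  | ite_true {c f g : TreeProg} {x a b y : TreeData} {s t : ℕ} :
      Runs c x (.cons a b) s → Runs f x y t → Runs (.ite c f g) x y (s + t + 1)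
  | ite_false {c f g : TreeProg} {x y : TreeData} {s t : ℕ} :
      Runs c x .nil s → Runs g x y t → Runs (.ite c f g) x y (s + t + 1)
  | loop_stop {c f : TreeProg} {x : TreeData} {s : ℕ} :
      Runs c x .nil s → Runs (.loop c f) x x (s + 1)
  | loop_step {c f : TreeProg} {x a b y z : TreeData} {r s t : ℕ} :
      Runs c x (.cons a b) r → Runs f x y s → Runs (.loop c f) y z t →
      Runs (.loop c f) x z (r + s + t + 1)

/-- The model is deterministic: output and cost are determined by program and input. -/
theorem TreeProg.Runs.deterministic {P : TreeProg} {x y y' : TreeData} {t t' : ℕ}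
    (h : TreeProg.Runs P x y t) (h' : TreeProg.Runs P x y' t') : y = y' ∧ t = t' := by
  induction h generalizing y' t' with
  | nil | id | left | right => cases h'; exact ⟨rfl, rfl⟩
  | pair _ _ ih₁ ih₂ =>
    cases h' with
    | pair h₁ h₂ =>
      obtain ⟨rfl, rfl⟩ := ih₁ h₁
      obtain ⟨rfl, rfl⟩ := ih₂ h₂
      exact ⟨rfl, rfl⟩
  | seq _ _ ih₁ ih₂ =>
    cases h' with
    | seq h₁ h₂ =>
      obtain ⟨rfl, rfl⟩ := ih₁ h₁
      obtain ⟨rfl, rfl⟩ := ih₂ h₂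
      exact ⟨rfl, rfl⟩
  | ite_true _ _ ih₁ ih₂ =>
    cases h' with
    | ite_true h₁ h₂ =>
      obtain ⟨_, rfl⟩ := ih₁ h₁
      obtain ⟨rfl, rfl⟩ := ih₂ h₂
      exact ⟨rfl, rfl⟩
    | ite_false h₁ h₂ => exact absurd (ih₁ h₁).1 (by simp)
  | ite_false _ _ ih₁ ih₂ =>
    cases h' with
    | ite_true h₁ h₂ => exact absurd (ih₁ h₁).1 (by simp)
    | ite_false h₁ h₂ =>
      obtain ⟨_, rfl⟩ := ih₁ h₁
      obtain ⟨rfl, rfl⟩ := ih₂ h₂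
      exact ⟨rfl, rfl⟩
  | loop_stop _ ih₁ =>
    cases h' with
    | loop_stop h₁ =>
      obtain ⟨_, rfl⟩ := ih₁ h₁
      exact ⟨rfl, rfl⟩
    | loop_step h₁ h₂ h₃ => exact absurd (ih₁ h₁).1 (by simp)
  | loop_step _ _ _ ih₁ ih₂ ih₃ =>
    cases h' with
    | loop_stop h₁ => exact absurd (ih₁ h₁).1 (by simp)
    | loop_step h₁ h₂ h₃ =>
      obtain ⟨_, rfl⟩ := ih₁ h₁
      obtain ⟨rfl, rfl⟩ := ih₂ h₂
      obtain ⟨rfl, rfl⟩ := ih₃ h₃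
      exact ⟨rfl, rfl⟩

/-- The (search or decision) problem "given an instance `x ∈ I`, find some `y` with `R x y`" is
solvable in polynomial time: one program, on the code of every instance `x ∈ I`, halts with the
code of a correct answer, at a cost that is polynomial in the size of the code of `x`. -/
def SolvableInPolyTime {α : Type} {β : α → Type} (codeIn : α → TreeData)
    (codeOut : (x : α) → β x → TreeData) (I : Set α) (R : (x : α) → β x → Prop) : Prop :=
  ∃ (P : TreeProg) (p : Polynomial ℕ), ∀ x ∈ I, ∃ (y : β x) (t : ℕ),
    R x y ∧ TreeProg.Runs P (codeIn x) (codeOut x y) t ∧ t ≤ p.eval (codeIn x).size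

/-! ## d-separation in a directed graph -/

/-- A trail of the directed graph `E` (a sequence of nodes in which neighbours are joined by an edge
in one of the two directions) that is active given `Z`: each collider has a descendant in `Z`
(possibly itself), and no other node of the trail is in `Z`. -/
structure IsActiveTrail {α : Type} (E : α → α → Prop) (Z : Set α) (l : List α) : Prop where
  chain : l.IsChain (fun a b => E a b ∨ E b a)
  collider : ∀ x y z, [x, y, z] <:+: l → E x y → E z y → ∃ d ∈ Z, Relation.ReflTransGen E y d
  nonCollider : ∀ x y z, [x, y, z] <:+: l → ¬ (E x y ∧ E z y) → y ∉ Z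
  head : ∀ a ∈ l.head?, a ∉ Z
  last : ∀ a ∈ l.getLast?, a ∉ Z

/-- `X` and `Y` are not d-separated by `Z`. -/
def DConnected {α : Type} (E : α → α → Prop) (X Y Z : Set α) : Prop :=
  ∃ l : List α, IsActiveTrail E Z l ∧ (∃ a ∈ l.head?, a ∈ X) ∧ (∃ b ∈ l.getLast?, b ∈ Y)

/-! ## Multi-agent influence diagrams -/

/-- What a MAID specifies at a variable with `c` values and set of parent instantiations `Ctx`:
a rational CPD at a chance variable; only the owner at a decision variable; at a utility variable
the owner, the (deterministic) dependence on the parents, and the rational number that each value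
stands for. -/
inductive Mechanism (numAgents : ℕ) (Ctx : Type) (c : ℕ) : Type
  | chance (cpd : Ctx → stdSimplex ℚ (Fin c)) : Mechanism numAgents Ctx c
  | decision (i : Fin numAgents) : Mechanism numAgents Ctx c
  | utility (i : Fin numAgents) (f : Ctx → Fin c) (val : Fin c → ℚ) : Mechanism numAgents Ctx c

/-- A multi-agent influence diagram with rational parameters.  The variables are
`0, …, numVars - 1`; the domain of `v` is `Fin (card v)`, and its parents are listed by `pa v`. -/
structure MAID : Type where
  numAgents : ℕ
  numVars : ℕ
  card : Fin numVars → ℕ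
  two_le_card : ∀ v, 2 ≤ card v
  /-- in-degree -/
  indeg : Fin numVars → ℕ
  /-- parents -/
  pa : (v : Fin numVars) → Fin (indeg v) → Fin numVars
  pa_injective : ∀ v, Function.Injective (pa v)
  acyclic : ∀ v, ¬ Relation.TransGen (fun u w => ∃ j, pa w j = u) v v
  mech : (v : Fin numVars) → Mechanism numAgents ((j : Fin (indeg v)) → Fin (card (pa v j))) (card v)

namespace MAID

/-- The variables. -/
abbrev Var (M : MAID) : Type := Fin M.numVars

/-- The edge `u → v` of the DAG. -/
def Edge (M : MAID) (u v : M.Var) : Prop := ∃ j, M.pa v j = u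

/-- Instantiations of the parents of `v` (the decision contexts, if `v` is a decision). -/
abbrev Ctx (M : MAID) (v : M.Var) : Type := (j : Fin (M.indeg v)) → Fin (M.card (M.pa v j))

/-- Instantiations of all variables. -/
abbrev Outcome (M : MAID) : Type := (v : M.Var) → Fin (M.card v)

/-- The agent to whom `v` belongs as a decision variable, if there is one. -/
def owner (M : MAID) (v : M.Var) : Option (Fin M.numAgents) :=
  match M.mech v with
  | .decision i => some i
  | _ => none

/-- The agent to whom `v` belongs as a utility variable, if there is one. -/
def utilityOwner (M : MAID) (v : M.Var) : Option (Fin M.numAgents) :=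
  match M.mech v with
  | .utility i _ _ => some i
  | _ => none

/-- The decision variables. -/
abbrev Decision (M : MAID) : Type := {v : M.Var // (M.owner v).isSome}

/-- Decision rules for `D` with probabilities in `𝕜` (which is `ℝ` or `ℚ`). -/
abbrev Rule (M : MAID) (𝕜 : Type) [Semiring 𝕜] [PartialOrder 𝕜] (D : M.Decision) : Type :=
  M.Ctx D.1 → stdSimplex 𝕜 (Fin (M.card D.1))

/-- Behavioural policies of agent `i`. -/
abbrev Policy (M : MAID) (𝕜 : Type) [Semiring 𝕜] [PartialOrder 𝕜] (i : Fin M.numAgents) : Type :=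
  (D : {D : M.Decision // M.owner D.1 = some i}) → M.Rule 𝕜 D.1

/-- Behavioural partial policy profiles of all agents but `i`. -/
abbrev OpponentProfile (M : MAID) (𝕜 : Type) [Semiring 𝕜] [PartialOrder 𝕜]
    (i : Fin M.numAgents) : Type :=
  (D : {D : M.Decision // M.owner D.1 ≠ some i}) → M.Rule 𝕜 D.1

/-- Behavioural policy profiles. -/
abbrev Profile (M : MAID) (𝕜 : Type) [Semiring 𝕜] [PartialOrder 𝕜] : Type :=
  (D : M.Decision) → M.Rule 𝕜 D

/-- Pure policy profiles, as functions from decision contexts to decisions. -/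
abbrev PureProfile (M : MAID) : Type := (D : M.Decision) → M.Ctx D.1 → Fin (M.card D.1)

/-- The profile in which agent `i` follows `p` and the others follow `o`. -/
def join (M : MAID) {𝕜 : Type} [Semiring 𝕜] [PartialOrder 𝕜] {i : Fin M.numAgents}
    (p : M.Policy 𝕜 i) (o : M.OpponentProfile 𝕜 i) : M.Profile 𝕜 :=
  fun D => if h : M.owner D.1 = some i then p ⟨D, h⟩ else o ⟨D, h⟩

/-- The part of a profile that belongs to all agents but `i`. -/
def others (M : MAID) {𝕜 : Type} [Semiring 𝕜] [PartialOrder 𝕜] (π : M.Profile 𝕜)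
    (i : Fin M.numAgents) : M.OpponentProfile 𝕜 i :=
  fun D => π D.1

/-- A rational distribution as a real one. -/
def realDist {n : ℕ} (p : stdSimplex ℚ (Fin n)) : stdSimplex ℝ (Fin n) :=
  ⟨fun x => ((p.1 x : ℚ) : ℝ), fun x => Rat.cast_nonneg.mpr (p.2.1 x), by
    have h := p.2.2
    beta_reduce
    exact_mod_cast h⟩

/-- A rational partial profile as a real one. -/
def realOpponents (M : MAID) {i : Fin M.numAgents} (o : M.OpponentProfile ℚ i) :
    M.OpponentProfile ℝ i :=
  fun D c => realDist (o D c)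

/-- A pure policy profile as a behavioural one (all probabilities are `0` or `1`). -/
def PureProfile.toProfile {M : MAID} (s : M.PureProfile) : M.Profile ℝ :=
  fun D c => ⟨Pi.single (s D c) 1, single_mem_stdSimplex ℝ (s D c)⟩

/-- The conditional probability of the value `x` of `v` given the instantiation `c` of its parents,
when decisions are taken according to `π`. -/
def condProb (M : MAID) (π : M.Profile ℝ) (v : M.Var) (c : M.Ctx v) (x : Fin (M.card v)) : ℝ :=
  match h : M.mech v with
  | .chance cpd => (((cpd c).1 x : ℚ) : ℝ)
  | .decision _ => (π ⟨v, by simp [owner, h]⟩ c).1 x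
  | .utility _ f _ => if f c = x then 1 else 0

/-- The joint distribution that a profile induces. -/
def jointProb (M : MAID) (π : M.Profile ℝ) (a : M.Outcome) : ℝ :=
  ∏ v, M.condProb π v (fun j => a (M.pa v j)) (a v)

/-- The probability that `v` takes the value `x`. -/
def probEq (M : MAID) (π : M.Profile ℝ) (v : M.Var) (x : Fin (M.card v)) : ℝ :=
  ∑ a : M.Outcome, if a v = x then M.jointProb π a else 0

/-- The number that the value `x` of `v` stands for if `v` is a utility variable of agent `i`,
and `0` otherwise. -/
def utilityValue (M : MAID) (i : Fin M.numAgents) (v : M.Var) (x : Fin (M.card v)) : ℝ :=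
  match M.mech v with
  | .utility j _ val => if j = i then ((val x : ℚ) : ℝ) else 0
  | _ => 0

/-- Expected utility of agent `i`. -/
def EU (M : MAID) (i : Fin M.numAgents) (π : M.Profile ℝ) : ℝ :=
  ∑ v, ∑ x, M.probEq π v x * M.utilityValue i v x

/-- Nash equilibria in behavioural policies. -/
def IsNash (M : MAID) (π : M.Profile ℝ) : Prop :=
  ∀ (i : Fin M.numAgents) (p : M.Policy ℝ i), M.EU i (M.join p (M.others π i)) ≤ M.EU i π

/-! ### Sufficient information -/

/-- The independent mechanised graph: the variables (`Sum.inl`), a mechanism node (`Sum.inr`) for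
each of them, the edges of the DAG, and an edge from every mechanism to its variable. -/
def IndepMechEdge (M : MAID) : M.Var ⊕ M.Var → M.Var ⊕ M.Var → Prop
  | .inl u, .inl v => M.Edge u v
  | .inr u, .inl v => u = v
  | _, .inr _ => False

/-- The mechanism of `V` is s-reachable from the decision rule of `D`: given `D` and its parents, it
is not d-separated from the utility variables of the agent of `D` that are descendants of `D`. -/
def SReachable (M : MAID) (V : M.Var) (D : M.Decision) : Prop :=
  DConnected M.IndepMechEdge {Sum.inr V}
    {w | ∃ u, w = Sum.inl u ∧ M.utilityOwner u = M.owner D.1 ∧ Relation.TransGen M.Edge D.1 u}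
    {w | ∃ u, w = Sum.inl u ∧ (u = D.1 ∨ M.Edge u D.1)}

/-- Sufficient information: the mechanised graph restricted to the decision rule nodes, with an edge
from the rule of `D'` to the rule of `D` if the former is s-reachable from the latter, is acyclic. -/
def SufficientInformation (M : MAID) : Prop :=
  ∀ D : M.Decision,
    ¬ Relation.TransGen (fun D' D : M.Decision => D' ≠ D ∧ M.SReachable D'.1 D) D D

/-- All decision variables have in-degree at most `k`. -/
def DecisionIndegLE (M : MAID) (k : ℕ) : Prop := ∀ D : M.Decision, M.indeg D.1 ≤ k

/-- The MAID in which the decision variable `D` is replaced by a chance variable whose CPD is the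
decision rule `r`. -/
def fix (M : MAID) (D : M.Decision) (r : M.Rule ℚ D) : MAID :=
  { M with mech := Function.update M.mech D.1 (.chance r) }

/-! ### Codes -/

/-- The table of the values `g c`, in the mixed-radix order of the parent
instantiations `c`. -/
def codeTable (M : MAID) (v : M.Var) (g : M.Ctx v → TreeData) : TreeData :=
  .ofList ((List.finRange _).map fun m => g (finPiFinEquiv.symm m))

/-- The list of the probabilities of a rational distribution. -/
def codeDist {n : ℕ} (p : stdSimplex ℚ (Fin n)) : TreeData :=
  .ofList ((List.finRange n).map fun x => .ofRat (p.1 x))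

/-- The code of what is specified at `v`. -/
def codeMech (M : MAID) (v : M.Var) : TreeData :=
  match M.mech v with
  | .chance cpd => .cons (.ofIndex 0) (M.codeTable v fun c => codeDist (cpd c))
  | .decision i => .cons (.ofIndex 1) (.ofIndex i)
  | .utility i f val => .cons (.ofIndex 2) (.ofList
      [.ofIndex i, M.codeTable v fun c => .ofIndex (f c),
        .ofList ((List.finRange _).map fun x => .ofRat (val x))])

/-- The code of a MAID: the number of agents and, for each variable, the size of its domain, its
parents and its mechanism. -/
def code (M : MAID) : TreeData :=
  .cons (.ofIndex M.numAgents) (.ofList ((List.finRange M.numVars).map fun v =>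
    .ofList [.ofIndex (M.card v),
      .ofList ((List.finRange (M.indeg v)).map fun j => .ofIndex (M.pa v j)),
      M.codeMech v]))

/-- The code of a rational partial profile: the tables of its decision rules, with `nil` at each
variable that is not in its domain. -/
def codeOpponents (M : MAID) {i : Fin M.numAgents} (o : M.OpponentProfile ℚ i) : TreeData :=
  .ofList ((List.finRange M.numVars).map fun v =>
    if h : (M.owner v).isSome ∧ M.owner v ≠ some i then
      M.codeTable v fun c => codeDist (o ⟨⟨v, h.1⟩, h.2⟩ c)
    else .nil)

/-- The code of a pure policy profile: the tables of its decision rules, with `nil` at each variable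
that is not a decision variable. -/
def codePure (M : MAID) (s : M.PureProfile) : TreeData :=
  .ofList ((List.finRange M.numVars).map fun v =>
    if h : (M.owner v).isSome then M.codeTable v fun c => .ofIndex (s ⟨v, h⟩ c) else .nil)

/-! ### The two problems -/

/-- Instances of Is-Best-Response. -/
structure BRInstance : Type where
  M : MAID
  i : Fin M.numAgents
  o : M.OpponentProfile ℚ i
  q : ℚ

/-- The code of an instance of Is-Best-Response. -/
def BRInstance.code (x : BRInstance) : TreeData :=
  .ofList [x.M.code, .ofIndex x.i, x.M.codeOpponents x.o, .ofRat x.q]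

/-- The question of Is-Best-Response: does agent `i` have a policy against the given partial profile
with expected utility greater than `q`? -/
def BRInstance.IsYes (x : BRInstance) : Prop :=
  ∃ p : x.M.Policy ℝ x.i, (x.q : ℝ) < x.M.EU x.i (x.M.join p (x.M.realOpponents x.o))

/-- Is-Best-Response, restricted to the MAIDs in `C`, can be solved in polynomial time. -/
def IsBestResponseInPolyTime (C : Set MAID) : Prop :=
  SolvableInPolyTime (β := fun _ => Bool) BRInstance.code (fun _ b => .ofBool b)
    {x | x.M ∈ C} (fun x b => b = true ↔ x.IsYes)

/-- For the MAIDs in `C`, a Nash equilibrium in pure policies can be found in polynomial time. -/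
def PureNashInPolyTime (C : Set MAID) : Prop :=
  SolvableInPolyTime (β := fun M : MAID => M.PureProfile) MAID.code (fun M s => M.codePure s)
    C (fun M s => M.IsNash s.toProfile)

end MAID

set_option linter.unusedVariables false

open TreeData Filter Topology

/-! ### Sizes of coded data -/

namespace TreeData

/-! The algorithm is a synchronous response dynamics on pure profiles. The expected utility of the
owner of a decision `D` is, up to a term that does not involve the rule at `D`, the sum over
contexts and choices of the probability of the choice times its `gain` (`EU_update_sub`). In one
round every decision, in every context, moves to the first choice of maximal gain against a
trembling version of the current profile, in which each rule is mixed, with weight `2⁻ᴷ`, with a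
distribution of full support.

The core is a consequence of d-separation, `partialMean_mul_partialMean` and its corollary
`exists_gain_eq_mul`: if rules are changed only at decisions whose mechanism is not s-reachable from
`D`, and supports are kept, then all gains at `D` in a fixed context are multiplied by one positive
number. Trembling profiles all have full support, so the response at `D` depends only on the current
choices at the relevant decisions. Relevance is acyclic, so the dynamics is stationary after as many
rounds as there are variables (`respond_iterate_numVars`).

At a stationary profile each choice maximises the gain whatever is done at the decisions that are
not relevant (`dominates_of_respond_eq`). The relevant decisions may be made pure because gains have
a common denominator of polynomial bit length, and `K` is so large that removing the trembles cannot
reverse a comparison. Arbitrary rules at the other decisions are reached by rescaling and a limit. A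
deviation of one agent can then be undone decision by decision, relevant ones first, without loss
for that agent (`isNash_of_dominates`).

As to complexity, if all decisions are frozen to rational chance variables, the MAID stays in `C`
and satisfies the conditions on decisions vacuously; Is-Best-Response then says whether one expected
utility exceeds a threshold. Two gains are compared through the expected utilities of two trembling
profiles that differ in one choice (`choiceEU_sub`). A binary search run simultaneously for all
choices leaves exactly the maximisers (`bisect_choiceEU`). The in-degree bound makes the number of
contexts polynomial.

Programs are not written by hand: `PolyTime c f` relates two codings of one family, and its closure
properties play the role of a programming language. Tremble probabilities and thresholds have odd
numerators and powers of two as denominators, so their reduced fractions are written down without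
any division. -/

theorem size_pos (a : TreeData) : 0 < a.size := by cases a <;> simp [size]

@[simp] theorem left_cons (a b : TreeData) : (cons a b).left = a := rfl
@[simp] theorem right_cons (a b : TreeData) : (cons a b).right = b := rfl

theorem size_right_le (a : TreeData) : a.right.size ≤ a.size := by
  cases a <;> simp [right, size]; omega

theorem size_ofList (l : List TreeData) :
    (ofList l).size = (l.map fun a => a.size + 1).sum + 1 := by
  induction l with
  | nil => rfl
  | cons a l ih => simp [ofList, size, ih]; omega

theorem ofList_eq_nil {l : List TreeData} : ofList l = nil ↔ l = [] := by
  cases l <;> simp [ofList]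

theorem size_ofIndex (n : ℕ) : (ofIndex n).size = 2 * n + 1 := by
  simp [ofIndex, size_ofList, size]; ring

theorem ofIndex_eq_nil {n : ℕ} : ofIndex n = nil ↔ n = 0 := by
  cases n <;> simp [ofIndex, ofList, List.replicate_succ]

theorem length_le_size_ofList (l : List TreeData) : l.length ≤ (ofList l).size := by
  induction l with
  | nil => simp
  | cons a l ih => simp [ofList, size]; omega

end TreeData

/-! ### Polynomial bounds and polynomial-time computability of families of codes -/

theorem Polynomial.eval_mono_nat (p : Polynomial ℕ) : Monotone fun n : ℕ => p.eval n := by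
  intro a b h
  simp only [Polynomial.eval_eq_sum, Polynomial.sum]
  exact Finset.sum_le_sum fun i _ => Nat.mul_le_mul_left _ (Nat.pow_le_pow_left h i)

/-- `f` is bounded by a polynomial in the size of `c`. -/
def PolyBounded {ι : Type} (c : ι → TreeData) (f : ι → ℕ) : Prop :=
  ∃ p : Polynomial ℕ, ∀ x, f x ≤ p.eval (c x).size

/-- One program computes `f x` from `c x`, for all `x`, at a cost polynomial in the size of
`c x`. -/
def PolyTime {ι : Type} (c f : ι → TreeData) : Prop :=
  ∃ (P : TreeProg) (t : ι → ℕ), (∀ x, TreeProg.Runs P (c x) (f x) (t x)) ∧ PolyBounded c t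

namespace PolyBounded

variable {ι κ : Type} {c : ι → TreeData} {f g : ι → ℕ}

theorem mono (hg : PolyBounded c g) (h : ∀ x, f x ≤ g x) : PolyBounded c f :=
  let ⟨p, hp⟩ := hg
  ⟨p, fun x => (h x).trans (hp x)⟩

theorem const (n : ℕ) : PolyBounded c fun _ => n := ⟨.C n, fun x => by simp⟩

theorem size : PolyBounded c fun x => (c x).size := ⟨.X, fun x => by simp⟩

theorem add (hf : PolyBounded c f) (hg : PolyBounded c g) : PolyBounded c fun x => f x + g x :=
  let ⟨p, hp⟩ := hf
  let ⟨q, hq⟩ := hg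
  ⟨p + q, fun x => by simpa using Nat.add_le_add (hp x) (hq x)⟩

theorem mul (hf : PolyBounded c f) (hg : PolyBounded c g) : PolyBounded c fun x => f x * g x :=
  let ⟨p, hp⟩ := hf
  let ⟨q, hq⟩ := hg
  ⟨p * q, fun x => by simpa using Nat.mul_le_mul (hp x) (hq x)⟩

theorem pow (hf : PolyBounded c f) (k : ℕ) : PolyBounded c fun x => f x ^ k := by
  induction k with
  | zero => simpa using const 1
  | succ k ih => simpa [pow_succ] using ih.mul hf

theorem reindex (hf : PolyBounded c f) (g : κ → ι) :
    PolyBounded (fun y => c (g y)) fun y => f (g y) :=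
  let ⟨p, hp⟩ := hf
  ⟨p, fun y => hp (g y)⟩

theorem comp {d : κ → TreeData} {f : κ → ℕ} {g : ι → κ} (hf : PolyBounded d f)
    (hd : PolyBounded c fun x => (d (g x)).size) : PolyBounded c fun x => f (g x) :=
  let ⟨p, hp⟩ := hf
  let ⟨q, hq⟩ := hd
  ⟨p.comp q, fun x => (hp _).trans <| by
    simpa [Polynomial.eval_comp] using Polynomial.eval_mono_nat p (hq x)⟩

/-- A bound in terms of a state is turned into one monotone function of its size, so that it can be
evaluated at an upper bound `B` for the sizes of all states that occur in a run. -/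
theorem exists_mono {f : κ → ℕ} {d : κ → TreeData} (hf : PolyBounded d f) :
    ∃ p : ℕ → ℕ, Monotone p ∧ (∀ y, f y ≤ p (d y).size) ∧
      ∀ {ι : Type} {c : ι → TreeData} {B : ι → ℕ}, PolyBounded c B →
        PolyBounded c fun x => p (B x) := by
  obtain ⟨p, hp⟩ := hf
  refine ⟨fun n => p.eval n, Polynomial.eval_mono_nat p, hp, ?_⟩
  rintro ι c B ⟨q, hq⟩
  exact ⟨p.comp q, fun x => by
    simpa [Polynomial.eval_comp] using Polynomial.eval_mono_nat p (hq x)⟩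

end PolyBounded

/-- A loop that stops at once returns its input, so the induction for the output needs the bound for
the input as well. -/
theorem TreeProg.Runs.size_le_and {P : TreeProg} {x y : TreeData} {t : ℕ}
    (h : TreeProg.Runs P x y t) : x.size ≤ t ∧ y.size ≤ t := by
  induction h with
  | nil x => simp only [TreeData.size]; omega
  | left x => cases x <;> simp [TreeData.left, TreeData.size]; omega
  | right x => cases x <;> simp [TreeData.right, TreeData.size]; omega
  | pair _ _ h₁ h₂ => simp only [TreeData.size]; omega
  | _ => omega

theorem TreeProg.Runs.size_le {P : TreeProg} {x y : TreeData} {t : ℕ}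
    (h : TreeProg.Runs P x y t) : y.size ≤ t := h.size_le_and.2

theorem TreeProg.Runs.loop_of_seq {P F : TreeProg} (st : ℕ → TreeData) (tc tf : ℕ → ℕ) (n : ℕ)
    (hc : ∀ j < n, ∃ a b, TreeProg.Runs P (st j) (.cons a b) (tc j))
    (hf : ∀ j < n, TreeProg.Runs F (st j) (st (j + 1)) (tf j))
    (hn : TreeProg.Runs P (st n) .nil (tc n)) :
    TreeProg.Runs (.loop P F) (st 0) (st n)
      (∑ j ∈ Finset.range n, (tc j + tf j + 1) + tc n + 1) := by
  induction n generalizing st tc tf with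
  | zero => simpa using TreeProg.Runs.loop_stop hn
  | succ n ih =>
    obtain ⟨a, b, h0⟩ := hc 0 (by omega)
    have := ih (fun j => st (j + 1)) (fun j => tc (j + 1)) (fun j => tf (j + 1))
      (fun j hj => hc (j + 1) (by omega)) (fun j hj => hf (j + 1) (by omega)) hn
    have h := TreeProg.Runs.loop_step h0 (hf 0 (by omega)) this
    rw [Finset.sum_range_succ']
    convert h using 1
    omega

namespace PolyTime

variable {ι κ : Type} {c f g : ι → TreeData}

theorem congr (hf : PolyTime c f) (h : ∀ x, f x = g x) : PolyTime c g :=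
  funext h ▸ hf

theorem bounded (hf : PolyTime c f) : PolyBounded c fun x => (f x).size :=
  let ⟨_, _, h, ht⟩ := hf
  ht.mono fun x => (h x).size_le

theorem reindex (hf : PolyTime c f) (g : κ → ι) :
    PolyTime (fun y => c (g y)) fun y => f (g y) :=
  let ⟨P, t, h, ht⟩ := hf
  ⟨P, fun y => t (g y), fun y => h (g y), ht.reindex g⟩

theorem id : PolyTime c c := ⟨.id, _, fun x => .id _, PolyBounded.size.add (.const 1)⟩

theorem nil : PolyTime c fun _ => .nil := ⟨.nil, _, fun x => .nil _, PolyBounded.size.add (.const 1)⟩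

theorem cons (hf : PolyTime c f) (hg : PolyTime c g) : PolyTime c fun x => .cons (f x) (g x) :=
  let ⟨P, s, h, hs⟩ := hf
  let ⟨Q, t, h', ht⟩ := hg
  ⟨.pair P Q, _, fun x => .pair (h x) (h' x), (hs.add ht).add (.const 1)⟩

/-- Composition: from `d (g x)`, which is computed from `c x`, compute `f (g x)`. -/
theorem comp {d f : κ → TreeData} {g : ι → κ} (hf : PolyTime d f)
    (hd : PolyTime c fun x => d (g x)) : PolyTime c fun x => f (g x) :=
  let ⟨P, s, h, hs⟩ := hf
  let ⟨Q, t, h', ht⟩ := hd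
  ⟨.seq Q P, _, fun x => .seq (h' x) (h (g x)), (ht.add (hs.comp hd.bounded)).add (.const 1)⟩

theorem left (hf : PolyTime c f) : PolyTime c fun x => (f x).left :=
  comp (κ := TreeData) (d := fun x => x) (g := f)
    ⟨.left, _, fun x => .left _, PolyBounded.size.add (.const 1)⟩ hf

theorem right (hf : PolyTime c f) : PolyTime c fun x => (f x).right :=
  comp (κ := TreeData) (d := fun x => x) (g := f)
    ⟨.right, _, fun x => .right _, PolyBounded.size.add (.const 1)⟩ hf

theorem const (a : TreeData) : PolyTime c fun _ => a := by
  induction a with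
  | nil => exact nil
  | cons a b ha hb => exact ha.cons hb

theorem restrict (hf : PolyTime c f) (p : ι → Prop) :
    PolyTime (fun x : {x // p x} => c x) fun x => f x := hf.reindex _

/-- Case distinction by a test: a nonempty tree stands for "yes". -/
theorem of_cases {b : ι → TreeData} (hb : PolyTime c b)
    (h₁ : PolyTime (fun x : {x // b x ≠ .nil} => c x) fun x => f x)
    (h₂ : PolyTime (fun x : {x // b x = .nil} => c x) fun x => f x) : PolyTime c f := by
  classical
  obtain ⟨P, s, H, hs⟩ := hb
  obtain ⟨Q, t, H', p, hp⟩ := h₁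
  obtain ⟨R, u, H'', q, hq⟩ := h₂
  refine ⟨.ite P Q R, fun x => s x + (if H : b x = .nil then u ⟨x, H⟩ else t ⟨x, H⟩) + 1,
    fun x => ?_, (hs.add (?_ : PolyBounded c _)).add (.const 1)⟩
  · have h1 := H x
    by_cases hx : b x = .nil
    · simp only [dif_pos hx]
      rw [hx] at h1
      exact .ite_false h1 (H'' ⟨x, hx⟩)
    · simp only [dif_neg hx]
      obtain ⟨a, a', e⟩ : ∃ a a', b x = .cons a a' := by
        cases e : b x with
        | nil => exact absurd e hx
        | cons a a' => exact ⟨a, a', rfl⟩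
      rw [e] at h1
      exact .ite_true h1 (H' ⟨x, hx⟩)
  · refine ⟨p + q, fun x => ?_⟩
    rw [Polynomial.eval_add]
    by_cases hx : b x = .nil
    · simpa only [dif_pos hx] using (hq ⟨x, hx⟩).trans (Nat.le_add_left _ _)
    · simpa only [dif_neg hx] using (hp ⟨x, hx⟩).trans (Nat.le_add_right _ _)

theorem of_bool {b : ι → Bool} (hb : PolyTime c fun x => ofBool (b x))
    (h₁ : PolyTime (fun x : {x // b x = true} => c x) fun x => f x)
    (h₂ : PolyTime (fun x : {x // b x = false} => c x) fun x => f x) : PolyTime c f := by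
  have e : ∀ x, (ofBool (b x) ≠ .nil) → b x = true := fun x => by
    cases b x <;> simp [ofBool]
  have e' : ∀ x, (ofBool (b x) = .nil) → b x = false := fun x => by
    cases b x <;> simp [ofBool]
  exact of_cases hb
    (h₁.reindex fun x : {x // ofBool (b x) ≠ .nil} => ⟨x.1, e _ x.2⟩)
    (h₂.reindex fun x : {x // ofBool (b x) = .nil} => ⟨x.1, e' _ x.2⟩)

theorem of_prop {p : ι → Prop} [DecidablePred p]
    (hb : PolyTime c fun x => ofBool (decide (p x)))
    (h₁ : PolyTime (fun x : {x // p x} => c x) fun x => f x)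
    (h₂ : PolyTime (fun x : {x // ¬ p x} => c x) fun x => f x) : PolyTime c f :=
  of_bool hb
    (h₁.reindex fun x : {x // decide (p x) = true} => ⟨x.1, of_decide_eq_true x.2⟩)
    (h₂.reindex fun x : {x // decide (p x) = false} => ⟨x.1, of_decide_eq_false x.2⟩)

theorem ite {p : ι → Prop} [DecidablePred p] {g h : ι → TreeData}
    (hb : PolyTime c fun x => ofBool (decide (p x))) (hg : PolyTime c g) (hh : PolyTime c h) :
    PolyTime c fun x => if p x then g x else h x :=
  of_prop hb ((hg.restrict p).congr fun x => (if_pos x.2).symm)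
    ((hh.restrict fun x => ¬ p x).congr fun x => (if_neg x.2).symm)

/-- The general form of a loop: `d` codes the states, the loop runs as long as `b` is nonempty. -/
theorem loop {d b : κ → TreeData} {step : κ → κ} {init : ι → κ} {n B : ι → ℕ}
    (hb : PolyTime d b) (hstep : PolyTime (fun y : {y // b y ≠ .nil} => d y) fun y => d (step y))
    (hinit : PolyTime c fun x => d (init x))
    (hrun : ∀ x, ∀ j < n x, b (step^[j] (init x)) ≠ .nil)
    (hend : ∀ x, b (step^[n x] (init x)) = .nil)
    (hn : PolyBounded c n) (hB : PolyBounded c B)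
    (hsize : ∀ x, ∀ j ≤ n x, (d (step^[j] (init x))).size ≤ B x) :
    PolyTime c fun x => d (step^[n x] (init x)) := by
  classical
  obtain ⟨P, s, H, hs⟩ := hb
  obtain ⟨Q, t, H', ht⟩ := hstep
  obtain ⟨R, u, H'', hu⟩ := hinit
  obtain ⟨p, pm, hp, pB⟩ := hs.exists_mono
  obtain ⟨q, qm, hq, qB⟩ := ht.exists_mono
  -- The body has a running time only where the test succeeds; the value 0 elsewhere belongs to no
  -- step of a run.
  let T : κ → ℕ := fun y => if h : b y ≠ .nil then t ⟨y, h⟩ else 0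
  have hT : ∀ y, T y ≤ q (d y).size := fun y => by
    by_cases h : b y ≠ .nil
    · simp only [T, dif_pos h]; exact hq ⟨y, h⟩
    · simp only [T, dif_neg h]; exact Nat.zero_le _
  refine ⟨.seq R (.loop P Q), fun x => u x +
    (∑ j ∈ Finset.range (n x), (s (step^[j] (init x)) + T (step^[j] (init x)) + 1)
      + s (step^[n x] (init x)) + 1) + 1, fun x => .seq (H'' x) ?_, ?_⟩
  · refine TreeProg.Runs.loop_of_seq (fun j => d (step^[j] (init x))) _ _ (n x) ?_ ?_ ?_
    · intro j hj
      have h1 := H (step^[j] (init x))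
      cases e : b (step^[j] (init x)) with
      | nil => exact absurd e (hrun x j hj)
      | cons a a' => rw [e] at h1; exact ⟨a, a', h1⟩
    · intro j hj
      have h2 := H' ⟨_, hrun x j hj⟩
      simp only [← Function.iterate_succ_apply' step] at h2
      simp only [T, dif_pos (hrun x j hj)]
      exact h2
    · have h1 := H (step^[n x] (init x))
      rwa [hend x] at h1
  · refine (hu.add ((PolyBounded.add (f := fun x => ∑ j ∈ Finset.range (n x),
      (s (step^[j] (init x)) + T (step^[j] (init x)) + 1))
      (((hn.mul (((pB hB).add (qB hB)).add (.const 1)))).mono fun x => ?_)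
      ((pB hB).mono fun x => (hp _).trans (pm (hsize x _ le_rfl)))).add (.const 1))).add (.const 1)
    calc _ ≤ ∑ j ∈ Finset.range (n x), (p (B x) + q (B x) + 1) := Finset.sum_le_sum fun j hj => by
          have hj := (Finset.mem_range.1 hj).le
          have h1 := (hp (step^[j] (init x))).trans (pm (hsize x j hj))
          have h2 := (hT (step^[j] (init x))).trans (qm (hsize x j hj))
          omega
      _ = _ := by simp

end PolyTime

/-! ### Polynomial-time list processing -/

theorem TreeData.size_ofList_take_le (l : List TreeData) (j : ℕ) :
    (ofList (l.drop j)).size ≤ (ofList l).size := by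
  induction l generalizing j with
  | nil => simp
  | cons a l ih =>
    cases j with
    | zero => simp
    | succ j => simpa [ofList, size] using (ih j).trans (by omega)

theorem List.foldl_cons_map {α β : Type} (F : α → β) (l : List α) (s : List β) :
    l.foldl (fun s a => F a :: s) s = (l.map F).reverse ++ s := by
  induction l generalizing s with
  | nil => simp
  | cons a l ih => simp [ih]

namespace PolyTime

variable {ι κ : Type} {c f g : ι → TreeData}

/-- A loop whose state holds the instance, the accumulator and the rest of the list. The bound on
the intermediate accumulators cannot be dropped: iterating a polynomial-time step may make sizes
grow exponentially. All types depend on the instance, since the variables and contexts of a MAID do.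
-/
theorem foldl {α σ : ι → Type} {ca : (x : ι) → α x → TreeData} {cs : (x : ι) → σ x → TreeData}
    {l : (x : ι) → List (α x)} {s₀ : (x : ι) → σ x} {step : (x : ι) → σ x → α x → σ x} {B : ι → ℕ}
    (hl : PolyTime c fun x => ofList ((l x).map (ca x)))
    (hs : PolyTime c fun x => cs x (s₀ x))
    (hstep : PolyTime
      (fun p : Σ x, σ x × α x => .cons (c p.1) (.cons (cs p.1 p.2.1) (ca p.1 p.2.2)))
      fun p => cs p.1 (step p.1 p.2.1 p.2.2))
    (hB : PolyBounded c B)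
    (hsize : ∀ x j, (cs x (((l x).take j).foldl (step x) (s₀ x))).size ≤ B x) :
    PolyTime c fun x => cs x ((l x).foldl (step x) (s₀ x)) := by
  let K : Type := Σ x, σ x × List (α x)
  let d : K → TreeData := fun y =>
    .cons (.cons (c y.1) (cs y.1 y.2.1)) (ofList (y.2.2.map (ca y.1)))
  let b : K → TreeData := fun y => ofList (y.2.2.map (ca y.1))
  let st : K → K := fun y => match y with
    | ⟨x, s, []⟩ => ⟨x, s, []⟩
    | ⟨x, s, a :: l⟩ => ⟨x, step x s a, l⟩
  let init : ι → K := fun x => ⟨x, s₀ x, l x⟩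
  have iter : ∀ x j, st^[j] (init x) =
      ⟨x, ((l x).take j).foldl (step x) (s₀ x), (l x).drop j⟩ := by
    intro x j
    suffices H : ∀ (l : List (α x)) s, st^[j] ⟨x, s, l⟩ = ⟨x, (l.take j).foldl (step x) s, l.drop j⟩
      from H _ _
    induction j with
    | zero => intro l s; simp
    | succ j ih =>
      intro l s
      rw [Function.iterate_succ_apply]
      cases l with
      | nil => simpa [st] using ih [] s
      | cons a l => simpa [st] using ih l (step x s a)
  have hd : PolyTime d d := id
  have key := loop (c := c) (d := d) (b := b) (step := st) (init := init)
    (n := fun x => (l x).length)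
    (B := fun x => ((c x).size + B x + 1) + (ofList ((l x).map (ca x))).size + 1)
    (id (c := d)).right ?_ ((id.cons hs).cons hl) ?_ ?_
    (hl.bounded.mono fun x => by simpa using length_le_size_ofList ((l x).map (ca x)))
    ((((PolyBounded.size.add hB).add (.const 1)).add hl.bounded).add (.const 1)) ?_
  · refine key.left.right.congr fun x => ?_
    rw [iter]; simp [d]
  · have hd : PolyTime (fun y : {y // b y ≠ .nil} => d y) fun y => d y := id
    refine ((hd.left.left.cons (comp (g := fun y : {y // b y ≠ .nil} =>
      match y with
      | ⟨⟨x, s, []⟩, h⟩ => absurd rfl h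
      | ⟨⟨x, s, a :: l⟩, h⟩ => ⟨x, s, a⟩) hstep
        (hd.left.left.cons (hd.left.right.cons hd.right.left) |>.congr ?_))).cons
        hd.right.right).congr ?_
    · rintro ⟨⟨x, s, _ | ⟨a, l⟩⟩, h⟩
      · exact absurd rfl h
      · rfl
    · rintro ⟨⟨x, s, _ | ⟨a, l⟩⟩, h⟩
      · exact absurd rfl h
      · rfl
  · intro x j hj
    rw [iter]
    simpa [b, ofList_eq_nil] using hj
  · intro x
    rw [iter]
    simp [b, ofList]
  · intro x j hj
    rw [iter]
    have h1 := hsize x j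
    have h2 := size_ofList_take_le ((l x).map (ca x)) j
    simp only [d, size, ← List.map_drop] at h2 ⊢
    omega

theorem reverse {l : ι → List TreeData} (hl : PolyTime c fun x => ofList (l x)) :
    PolyTime c fun x => ofList (l x).reverse := by
  refine (foldl (α := fun _ => TreeData) (σ := fun _ => List TreeData) (ca := fun _ a => a)
    (cs := fun _ s => ofList s) (l := l) (s₀ := fun _ => []) (step := fun _ s a => a :: s)
    (B := fun x => (ofList (l x)).size) (by simpa using hl) nil ?_ hl.bounded ?_).congr ?_
  · exact id.right.right.cons id.right.left
  · intro x j
    rw [List.foldl_cons_map (fun a => a)]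
    have h : (((l x).take j).map fun a => a.size + 1).sum ≤ ((l x).map fun a => a.size + 1).sum :=
      List.Sublist.sum_le_sum ((List.take_sublist _ _).map _) (by simp)
    simp only [size_ofList, List.append_nil, List.map_reverse, List.sum_reverse, List.map_id']
    omega
  · intro x
    simp [List.foldl_cons_map (fun a => a)]

/-- No size bound has to be supplied: each entry is computed from the instance and one element only,
so its size is polynomial and there are at most as many entries as the size of the list. Folding
produces the reversed list. -/
theorem map {α : ι → Type} {ca F : (x : ι) → α x → TreeData} {l : (x : ι) → List (α x)}
    (hl : PolyTime c fun x => ofList ((l x).map (ca x)))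
    (hF : PolyTime (fun p : Σ x, α x => .cons (c p.1) (ca p.1 p.2)) fun p => F p.1 p.2) :
    PolyTime c fun x => ofList ((l x).map (F x)) := by
  obtain ⟨p, pm, hp, pB⟩ := hF.bounded.exists_mono
  have key : ∀ x (l : List (α x)), (l.map fun a => (F x a).size + 1).sum ≤
      l.length * (p ((c x).size + (ofList (l.map (ca x))).size + 1) + 1) := by
    intro x l
    have := List.sum_le_card_nsmul (l.map fun a => (F x a).size + 1)
      (p ((c x).size + (ofList (l.map (ca x))).size + 1) + 1) ?_
    · simpa using this
    · intro n hn
      obtain ⟨a, ha, rfl⟩ := List.mem_map.1 hn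
      refine Nat.succ_le_succ ((hp ⟨x, a⟩).trans (pm ?_))
      have h1 : (ca x a).size + 1 ≤ ((l.map (ca x)).map fun a => a.size + 1).sum :=
        List.single_le_sum (by simp) _ (by simpa using ⟨a, ha, rfl⟩)
      rw [size_ofList]
      simp only [size]
      omega
  refine (foldl (cs := fun _ s => ofList s) (σ := fun _ => List TreeData)
    (s₀ := fun _ => []) (step := fun x s a => F x a :: s)
    (B := fun x => (ofList ((l x).map (ca x))).size *
      (p ((c x).size + (ofList ((l x).map (ca x))).size + 1) + 1) + 1) hl nil ?_ ?_ ?_).reverse.congr ?_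
  · refine (comp (g := fun q : Σ x, List TreeData × α x => (⟨q.1, q.2.2⟩ : Σ x, α x)) hF ?_).cons
      id.right.left
    exact id.left.cons id.right.right
  · exact (hl.bounded.mul ((pB ((PolyBounded.size.add hl.bounded).add (.const 1))).add (.const 1))).add
      (.const 1)
  · intro x j
    rw [List.foldl_cons_map, List.append_nil, size_ofList, List.map_reverse, List.sum_reverse, List.map_map]
    have h : (((l x).take j).map fun a => (F x a).size + 1).sum ≤
        ((l x).map fun a => (F x a).size + 1).sum :=
      List.Sublist.sum_le_sum ((List.take_sublist _ _).map _) (by simp)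
    have h1 := length_le_size_ofList ((l x).map (ca x))
    rw [List.length_map] at h1
    exact Nat.succ_le_succ (h.trans ((key x (l x)).trans (Nat.mul_le_mul_right _ h1)))
  · intro x
    simp

theorem append {l m : ι → List TreeData} (hl : PolyTime c fun x => ofList (l x))
    (hm : PolyTime c fun x => ofList (m x)) : PolyTime c fun x => ofList (l x ++ m x) := by
  have e : ∀ (l s : List TreeData), l.foldl (fun s a => a :: s) s = l.reverse ++ s := by
    intro l s; simp
  refine (foldl (α := fun _ => TreeData) (σ := fun _ => List TreeData) (ca := fun _ a => a)
    (cs := fun _ s => ofList s) (l := fun x => (l x).reverse) (s₀ := m) (step := fun _ s a => a :: s)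
    (B := fun x => (ofList (l x)).size + (ofList (m x)).size) (by simpa using hl.reverse) hm ?_
      (hl.bounded.add hm.bounded) ?_).congr ?_
  · exact id.right.right.cons id.right.left
  · intro x j
    rw [e]
    have h : (((l x).reverse.take j).map fun a => a.size + 1).sum ≤
        ((l x).reverse.map fun a => a.size + 1).sum :=
      List.Sublist.sum_le_sum ((List.take_sublist _ _).map _) (by simp)
    simp only [size_ofList, List.map_append, List.sum_append, List.map_reverse, List.sum_reverse] at h ⊢
    omega
  · intro x
    simp [e]

theorem length {l : ι → List TreeData} (hl : PolyTime c fun x => ofList (l x)) :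
    PolyTime c fun x => ofIndex (l x).length :=
  (map (α := fun _ => TreeData) (ca := fun _ a => a) (F := fun _ _ => .nil) (l := l) (by simpa using hl)
    nil).congr fun x => by simp [ofIndex, List.map_const']

theorem filter {α : ι → Type} {ca : (x : ι) → α x → TreeData} {l : (x : ι) → List (α x)}
    {p : (x : ι) → α x → Bool}
    (hl : PolyTime c fun x => ofList ((l x).map (ca x)))
    (hp : PolyTime (fun q : Σ x, α x => .cons (c q.1) (ca q.1 q.2)) fun q => ofBool (p q.1 q.2)) :
    PolyTime c fun x => ofList (((l x).filter (p x)).map (ca x)) := by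
  have e : ∀ x (l s : List (α x)),
      l.foldl (fun s a => if p x a = true then a :: s else s) s = (l.filter (p x)).reverse ++ s := by
    intro x l
    induction l with
    | nil => simp
    | cons a l ih =>
      intro s
      by_cases h : p x a = true <;> simp [ih, h]
  refine (foldl (σ := fun x => List (α x)) (cs := fun x s => ofList (s.map (ca x))) (l := l)
    (s₀ := fun _ => []) (step := fun x s a => if p x a = true then a :: s else s)
    (B := fun x => (ofList ((l x).map (ca x))).size) hl nil ?_ hl.bounded ?_).reverse.congr ?_
  rotate_right 1
  · intro x; simp [e, List.map_reverse]
  · have h1 := comp (g := fun q : Σ x, List (α x) × α x => (⟨q.1, q.2.2⟩ : Σ x, α x)) hp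
      (c := fun p => .cons (c p.1) (.cons (ofList (p.2.1.map (ca p.1))) (ca p.1 p.2.2)))
      (id.left.cons id.right.right)
    refine of_bool h1 ((((id.right.right).cons id.right.left)).congr ?_) (id.right.left.congr ?_)
    · rintro ⟨q, hq⟩
      simp only at hq
      simp [hq, ofList]
    · rintro ⟨q, hq⟩
      simp only at hq
      simp [hq]
  · intro x j
    have h : ((((l x).take j).filter (p x)).map fun a => (ca x a).size + 1).sum ≤
        ((l x).map fun a => (ca x a).size + 1).sum :=
      List.Sublist.sum_le_sum ((List.filter_sublist.trans (List.take_sublist _ _)).map _) (by simp)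
    rw [e]
    simp only [size_ofList, List.append_nil, List.map_reverse, List.sum_reverse, List.map_map]
    exact Nat.succ_le_succ h

/-- Iteration of a step function a given number of times. -/
theorem iterate {σ : ι → Type} {cs : (x : ι) → σ x → TreeData} {n B : ι → ℕ}
    {s₀ : (x : ι) → σ x} {step : (x : ι) → σ x → σ x}
    (hn : PolyTime c fun x => ofIndex (n x)) (hs : PolyTime c fun x => cs x (s₀ x))
    (hstep : PolyTime (fun p : Σ x, σ x => .cons (c p.1) (cs p.1 p.2)) fun p => cs p.1 (step p.1 p.2))
    (hB : PolyBounded c B) (hsize : ∀ x, ∀ j ≤ n x, (cs x ((step x)^[j] (s₀ x))).size ≤ B x) :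
    PolyTime c fun x => cs x ((step x)^[n x] (s₀ x)) := by
  have e : ∀ x (j : ℕ) s, (List.replicate j TreeData.nil).foldl (fun s _ => step x s) s =
      (step x)^[j] s := by
    intro x j
    induction j with
    | zero => simp
    | succ j ih => intro s; simp [List.replicate_succ, ih]
  refine (foldl (α := fun _ => TreeData) (ca := fun _ a => a) (l := fun x => List.replicate (n x) .nil)
    (step := fun x s _ => step x s) (B := B) (by simpa [ofIndex] using hn) hs
    (comp (g := fun q : Σ x, σ x × TreeData => (⟨q.1, q.2.1⟩ : Σ x, σ x)) hstep
      (id.left.cons id.right.left)) hB ?_).congr fun x => by rw [e]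
  intro x j
  rw [List.take_replicate, e]
  exact hsize x _ (min_le_right _ _)

theorem range {n : ι → ℕ} (hn : PolyTime c fun x => ofIndex (n x)) :
    PolyTime c fun x => ofList ((List.finRange (n x)).map fun i : Fin (n x) => ofIndex (i : ℕ)) := by
  have e : ∀ n j : ℕ, (fun s : ℕ × List ℕ => (s.1 + 1, s.1 :: s.2))^[j] (0, []) =
      (j, (List.range j).reverse) := by
    intro n j
    induction j with
    | zero => simp
    | succ j ih => rw [Function.iterate_succ_apply', ih]; simp [List.range_succ]
  refine (iterate (σ := fun _ => ℕ × List ℕ)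
    (cs := fun _ s => .cons (ofIndex s.1) (ofList (s.2.map ofIndex)))
    (s₀ := fun _ => (0, [])) (step := fun _ s => (s.1 + 1, s.1 :: s.2))
    (B := fun x => (2 * n x + 1) + (n x * (2 * n x + 2) + 1) + 1)
    hn (const _)
    ((nil.cons id.right.left).cons (id.right.left.cons id.right.right)) ?_ ?_).right.reverse.congr ?_
  · have h : PolyBounded c n := hn.bounded.mono fun x => by rw [size_ofIndex]; omega
    exact (((((PolyBounded.const 2).mul h).add (.const 1)).add
      ((h.mul (((PolyBounded.const 2).mul h).add (.const 2))).add (.const 1)))).add (.const 1)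
  · intro x j hj
    rw [e (n x) j]
    have h : ((List.range j).map fun i => (ofIndex i).size + 1).sum ≤ n x * (2 * n x + 2) := by
      refine (List.sum_le_card_nsmul _ (2 * n x + 2) ?_).trans ?_
      · intro m hm
        obtain ⟨i, hi, rfl⟩ := List.mem_map.1 hm
        rw [size_ofIndex]
        have := List.mem_range.1 hi
        omega
      · rw [List.length_map, List.length_range]; exact Nat.mul_le_mul_right _ hj
    simp only [size, size_ofIndex, size_ofList, List.map_reverse, List.sum_reverse, List.map_map]
    simp only [Function.comp_def, size_ofIndex] at h ⊢
    omega
  · intro x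
    rw [e (n x)]
    simp only [List.map_reverse, List.reverse_reverse]
    rw [show List.range (n x) = (List.finRange (n x)).map Fin.val from
      List.map_coe_finRange_eq_range.symm, List.map_map]
    rfl

end PolyTime

/-! ### Unary and binary numbers -/

namespace TreeData

theorem right_ofList (l : List TreeData) : (ofList l).right = ofList l.tail := by
  cases l <;> rfl

theorem iterate_right_ofList (l : List TreeData) (j : ℕ) :
    right^[j] (ofList l) = ofList (l.drop j) := by
  induction j generalizing l with
  | zero => simp
  | succ j ih => rw [Function.iterate_succ_apply, right_ofList, ih, ← List.drop_one, List.drop_drop,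
      Nat.add_comm]

theorem size_iterate_right_le (a : TreeData) (j : ℕ) : (right^[j] a).size ≤ a.size := by
  induction j with
  | zero => simp
  | succ j ih => rw [Function.iterate_succ_apply']; exact (size_right_le _).trans ih

theorem iterate_right_ofIndex (n j : ℕ) : right^[j] (ofIndex n) = ofIndex (n - j) := by
  simp [ofIndex, iterate_right_ofList]

/-- The number with the given binary digits, least significant first. -/
def ofBits (l : List Bool) : ℕ := l.foldr Nat.bit 0

@[simp] theorem ofBits_nil : ofBits [] = 0 := rfl

@[simp] theorem ofBits_cons (b : Bool) (l : List Bool) :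
    ofBits (b :: l) = 2 * ofBits l + b.toNat := by
  simp [ofBits, Nat.bit_val]

theorem ofBits_append (l m : List Bool) :
    ofBits (l ++ m) = ofBits l + 2 ^ l.length * ofBits m := by
  induction l with
  | nil => simp
  | cons b l ih => simp [ih, pow_succ]; ring

theorem ofBits_replicate_false (n : ℕ) : ofBits (List.replicate n false) = 0 := by
  induction n with
  | zero => rfl
  | succ n ih => simp [List.replicate_succ, ih]

theorem ofBits_replicate_true (n : ℕ) : ofBits (List.replicate n true) + 1 = 2 ^ n := by
  induction n with
  | zero => rfl
  | succ n ih => simp [List.replicate_succ, pow_succ]; omega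

theorem ofBits_map_not (l : List Bool) :
    ofBits (l.map not) + ofBits l + 1 = 2 ^ l.length := by
  induction l with
  | nil => rfl
  | cons b l ih => cases b <;> simp [pow_succ] <;> omega

theorem ofBits_lt (l : List Bool) : ofBits l < 2 ^ l.length := by
  have := ofBits_map_not l; omega

/-- The hypothesis excludes a zero digit in front of the number 0, which `Nat.bits` omits. -/
theorem ofNat_bit (b : Bool) (n : ℕ) (h : n = 0 → b = true) :
    ofNat (Nat.bit b n) = cons (ofBool b) (ofNat n) := by
  rw [ofNat, Nat.bits_append_bit n b h]; rfl

theorem ofNat_eq_nil {n : ℕ} : ofNat n = nil ↔ n = 0 := by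
  rw [ofNat, ofList_eq_nil, List.map_eq_nil_iff]
  constructor
  · intro h
    have := Nat.size_eq_bits_len n
    rwa [h, List.length_nil, eq_comm, Nat.size_eq_zero] at this
  · rintro rfl; simp

theorem size_ofNat_le (n : ℕ) : (ofNat n).size ≤ 4 * Nat.size n + 1 := by
  rw [ofNat, size_ofList]
  have : ∀ l : List Bool, ((l.map ofBool).map fun a => a.size + 1).sum ≤ 4 * l.length := by
    intro l
    induction l with
    | nil => simp
    | cons b l ih => cases b <;> simp [ofBool, size] at ih ⊢ <;> omega
  simpa [Nat.size_eq_bits_len] using this n.bits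

/-- Codes of rationals are normalised. Since no program for the greatest common divisor is built,
rationals are chosen below such that coprimality is evident. -/
theorem ofRat_div {z : ℤ} {d : ℕ} (hd : d ≠ 0) (h : z.natAbs.Coprime d) :
    ofRat ((z : ℚ) / d) = cons (ofInt z) (ofNat d) := by
  have hd' : (0 : ℤ) < d := by positivity
  have h1 : ((z : ℚ) / d).num = z := Rat.num_div_eq_of_coprime (b := (d : ℤ)) hd' (by simpa using h)
  have h2 : (((z : ℚ) / d).den : ℤ) = d := Rat.den_div_eq_of_coprime (b := (d : ℤ)) hd' (by simpa using h)
  rw [ofRat, h1, Nat.cast_injective h2]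

end TreeData

namespace PolyTime

variable {ι κ : Type} {c f g : ι → TreeData}

theorem iterate_right {n : ι → ℕ} (hf : PolyTime c f) (hn : PolyTime c fun x => ofIndex (n x)) :
    PolyTime c fun x => TreeData.right^[n x] (f x) :=
  iterate (σ := fun _ => TreeData) (cs := fun _ s => s) (step := fun _ s => s.right) hn hf
    id.right.right hf.bounded fun x j _ => size_iterate_right_le _ _

theorem getElem {n : ι → ℕ} {F : (x : ι) → Fin (n x) → TreeData} {i : (x : ι) → Fin (n x)}
    (hl : PolyTime c fun x => ofList ((List.finRange (n x)).map (F x)))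
    (hi : PolyTime c fun x => ofIndex (i x)) : PolyTime c fun x => F x (i x) := by
  refine (hl.iterate_right hi).left.congr fun x => ?_
  rw [iterate_right_ofList, List.drop_eq_getElem_cons (by simp)]
  simp [ofList]

theorem sub {m n : ι → ℕ} (hm : PolyTime c fun x => ofIndex (m x))
    (hn : PolyTime c fun x => ofIndex (n x)) : PolyTime c fun x => ofIndex (m x - n x) :=
  (hm.iterate_right hn).congr fun x => iterate_right_ofIndex _ _

theorem not {b : ι → Bool} (hb : PolyTime c fun x => ofBool (b x)) :
    PolyTime c fun x => ofBool (!b x) :=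
  of_bool hb ((const (ofBool false)).congr fun x => by rw [x.2]; rfl)
    ((const (ofBool true)).congr fun x => by rw [x.2]; rfl)

theorem isNil [∀ x, Decidable (f x = .nil)] (hf : PolyTime c f) :
    PolyTime c fun x => ofBool (decide (f x = .nil)) :=
  of_cases hf ((const (ofBool false)).congr fun x => by rw [decide_eq_false x.2])
    ((const (ofBool true)).congr fun x => by rw [decide_eq_true x.2])

theorem and {a b : ι → Bool} (ha : PolyTime c fun x => ofBool (a x))
    (hb : PolyTime c fun x => ofBool (b x)) : PolyTime c fun x => ofBool (a x && b x) :=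
  of_bool ha ((hb.restrict _).congr fun x => by rw [x.2]; simp)
    ((const (ofBool false)).congr fun x => by rw [x.2]; simp)

theorem indexEq {m n : ι → ℕ} (hm : PolyTime c fun x => ofIndex (m x))
    (hn : PolyTime c fun x => ofIndex (n x)) :
    PolyTime c fun x => ofBool (decide (m x = n x)) := by
  classical
  refine ((hm.sub hn).isNil.and (hn.sub hm).isNil).congr fun x => ?_
  congr 1
  rw [← Bool.decide_and]
  refine decide_eq_decide.2 ?_
  rw [ofIndex_eq_nil, ofIndex_eq_nil]
  omega

theorem add {m n : ι → ℕ} (hm : PolyTime c fun x => ofIndex (m x))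
    (hn : PolyTime c fun x => ofIndex (n x)) : PolyTime c fun x => ofIndex (m x + n x) :=
  (append hm hn).congr fun x => by simp [ofIndex]

theorem mul {m n : ι → ℕ} (hm : PolyTime c fun x => ofIndex (m x))
    (hn : PolyTime c fun x => ofIndex (n x)) : PolyTime c fun x => ofIndex (m x * n x) := by
  have e : ∀ x j, (fun s => s + n x)^[j] 0 = j * n x := by
    intro x j
    induction j with
    | zero => simp
    | succ j ih => rw [Function.iterate_succ_apply', ih]; ring
  refine (iterate (σ := fun _ => ℕ) (cs := fun _ s => ofIndex s) (s₀ := fun _ => 0)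
    (step := fun x s => s + n x) (B := fun x => (ofIndex (m x)).size * (ofIndex (n x)).size + 1)
    hm nil ?_ ((hm.bounded.mul hn.bounded).add (.const 1)) ?_).congr fun x => by rw [e]
  · exact add id.right (hn.comp (g := Sigma.fst) id.left)
  · intro x j hj
    rw [e]
    have := Nat.mul_le_mul_right (n x) hj
    simp only [size_ofIndex]
    nlinarith

/-- The size of a tree, in unary. -/
theorem sizeIndex (hf : PolyTime c f) : PolyTime c fun x => ofIndex (f x).size := by
  -- The tree is traversed with a stack of pending subtrees. Each step takes one node or leaf off
  -- the stack and counts it, so total size on the stack plus counter is constant.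
  let st : List TreeData × ℕ → List TreeData × ℕ := fun s => match s with
    | ([], n) => ([], n)
    | (.nil :: l, n) => (l, n + 1)
    | (.cons a b :: l, n) => (a :: b :: l, n + 1)
  let d : List TreeData × ℕ → TreeData := fun s => .cons (ofList s.1) (ofIndex s.2)
  let w : List TreeData → ℕ := fun l => (l.map TreeData.size).sum
  have inv : ∀ j l n, w l = n → j ≤ n →
      w (st^[j] (l, 0)).1 + j = n ∧ (st^[j] (l, 0)).2 = j := by
    intro j l n h
    induction j with
    | zero => simpa using h
    | succ j ih =>
      intro hj
      obtain ⟨h1, h2⟩ := ih (by omega)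
      rw [Function.iterate_succ_apply']
      rcases hs : st^[j] (l, 0) with ⟨l', m⟩
      rw [hs] at h1 h2
      rcases l' with _ | ⟨_ | ⟨a, b⟩, l'⟩
      · simp [w] at h1; omega
      · simp [st, w, size] at h1 h2 ⊢; omega
      · simp [st, w, size] at h1 h2 ⊢; omega
  have hlen : ∀ l : List TreeData, l.length ≤ w l := by
    intro l
    induction l with
    | nil => simp
    | cons a l ih => have := a.size_pos; simp [w] at ih ⊢; omega
  have hw : ∀ l : List TreeData, (ofList l).size ≤ 2 * w l + 1 := by
    intro l
    have := hlen l
    rw [size_ofList, List.sum_map_add]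
    simp [w] at this ⊢; omega
  refine (loop (c := c) (d := d) (b := fun s => ofList s.1) (step := st)
    (init := fun x => ([f x], 0)) (n := fun x => (f x).size)
    (B := fun x => 4 * (f x).size + 3) id.left ?_
    ((hf.cons nil).cons nil) ?_ ?_ hf.bounded
    (((PolyBounded.const 4).mul hf.bounded).add (.const 3)) ?_).right.congr fun x => ?_
  · have hd : PolyTime (fun s : {s : List TreeData × ℕ // ofList s.1 ≠ .nil} => d s) fun s => d s := id
    refine of_cases hd.left.left ?_ ?_
    · have hd := hd.restrict fun s => (d s).left.left ≠ .nil
      refine ((hd.left.left.left.cons (hd.left.left.right.cons hd.left.right)).cons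
        (nil.cons hd.right)).congr ?_
      rintro ⟨⟨⟨_ | ⟨_ | ⟨a, b⟩, l'⟩, n⟩, h⟩, h'⟩
      · exact absurd rfl h
      · exact absurd rfl h'
      · rfl
    · have hd := hd.restrict fun s => (d s).left.left = .nil
      refine (hd.left.right.cons (nil.cons hd.right)).congr ?_
      rintro ⟨⟨⟨_ | ⟨_ | ⟨a, b⟩, l'⟩, n⟩, h⟩, h'⟩
      · exact absurd rfl h
      · rfl
      · simp [d, ofList] at h'
  · intro x j hj h
    have := (inv j [f x] _ rfl (by simp [w]; omega)).1
    rw [ofList_eq_nil.1 h] at this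
    simp [w] at this
    omega
  · intro x
    have := (inv (f x).size [f x] _ rfl (by simp [w])).1
    have h2 := hlen (st^[(f x).size] ([f x], 0)).1
    simp only [w, List.map_cons, List.map_nil, List.sum_singleton] at this h2
    rw [ofList_eq_nil, ← List.length_eq_zero_iff]
    omega
  · intro x j hj
    obtain ⟨h1, h2⟩ := inv j [f x] _ rfl (by simpa [w] using hj)
    have h3 := hw (st^[j] ([f x], 0)).1
    simp only [d, size, size_ofIndex, h2]
    simp only [w, List.map_cons, List.map_nil, List.sum_singleton] at h1 h3
    omega
  · rw [right_cons, (inv _ [f x] _ rfl (by simp [w])).2]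

/-- The given digits may contain leading zeros, which the code of a number must not have. The digits
are therefore consumed from the most significant end, and a zero digit that meets the number 0 is
discarded. -/
theorem ofBits {l : ι → List Bool} (hl : PolyTime c fun x => ofList ((l x).map ofBool)) :
    PolyTime c fun x => ofNat (ofBits (l x)) := by
  classical
  have e : ∀ l : List Bool, l.reverse.foldl (fun s a => Nat.bit a s) 0 = TreeData.ofBits l :=
    fun l => by rw [List.foldl_reverse]; rfl
  refine (foldl (α := fun _ => Bool) (σ := fun _ => ℕ) (ca := fun _ a => ofBool a)
    (cs := fun _ s => ofNat s) (l := fun x => (l x).reverse) (s₀ := fun _ => 0)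
    (step := fun _ s a => Nat.bit a s) (B := fun x => 4 * (ofList ((l x).map ofBool)).size + 1)
    (by simpa [List.map_reverse] using hl.reverse) ((const (ofNat 0))) ?_
    (((PolyBounded.const 4).mul hl.bounded).add (.const 1)) ?_).congr fun x => by rw [e]
  · have hd := id (c := fun p : Σ x, ℕ × Bool => .cons (c p.1) (.cons (ofNat p.2.1) (ofBool p.2.2)))
    refine of_cases hd.right.right ?_ ?_
    · refine ((hd.right.right.cons hd.right.left).restrict _).congr ?_
      rintro ⟨⟨x, n, b⟩, h⟩
      cases b with
      | false => exact absurd rfl h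
      | true => exact (ofNat_bit _ _ fun _ => rfl).symm
    · refine of_cases (hd.right.left.restrict _) ?_ ?_
      · refine (((hd.right.right.cons hd.right.left).restrict _).restrict _).congr ?_
        rintro ⟨⟨⟨x, n, b⟩, h⟩, h'⟩
        refine (ofNat_bit _ _ fun hn => absurd (ofNat_eq_nil.2 hn) h').symm
      · refine (const (ofNat 0)).congr ?_
        rintro ⟨⟨⟨x, n, b⟩, h⟩, h'⟩
        cases b with
        | true => cases h
        | false =>
          simp only [right_cons, left_cons, ofNat_eq_nil] at h'
          subst h'; rfl
  · intro x j
    rw [List.take_reverse, e]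
    refine (size_ofNat_le _).trans ?_
    have h1 := Nat.size_le.2 (ofBits_lt ((l x).drop ((l x).length - j)))
    have h2 := length_le_size_ofList ((l x).map ofBool)
    simp at h1 h2
    omega

theorem replicateFalse {n : ι → ℕ} (hn : PolyTime c fun x => ofIndex (n x)) :
    PolyTime c fun x => ofList ((List.replicate (n x) false).map ofBool) :=
  hn.congr fun x => by simp [ofIndex, ofBool]

theorem replicateTrue {n : ι → ℕ} (hn : PolyTime c fun x => ofIndex (n x)) :
    PolyTime c fun x => ofList ((List.replicate (n x) true).map ofBool) :=
  (map (α := fun _ => TreeData) (ca := fun _ a => a) (l := fun x => List.replicate (n x) .nil)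
    (F := fun _ _ => ofBool true) (by simpa [ofIndex] using hn) (const _)).congr fun x => by simp

theorem appendBits {l m : ι → List Bool} (hl : PolyTime c fun x => ofList ((l x).map ofBool))
    (hm : PolyTime c fun x => ofList ((m x).map ofBool)) :
    PolyTime c fun x => ofList ((l x ++ m x).map ofBool) :=
  (append hl hm).congr fun x => by simp

theorem twoPow {n : ι → ℕ} (hn : PolyTime c fun x => ofIndex (n x)) :
    PolyTime c fun x => ofNat (2 ^ n x) :=
  (ofBits (l := fun x => List.replicate (n x) false ++ [true])
    (hn.replicateFalse.appendBits (const _))).congr fun x => by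
      simp [ofBits_append, ofBits_replicate_false]

end PolyTime

/-! ### Reading and writing codes of MAIDs and profiles -/

namespace MAID

/-- The position of a decision context in the table of a decision rule. -/
def ctxIndex (M : MAID) (v : M.Var) (a : M.Ctx v) : Fin (∏ j, M.card (M.pa v j)) :=
  finPiFinEquiv a

/-- What the code of a MAID contains about one variable. -/
def codeVar (M : MAID) (v : M.Var) : TreeData :=
  .ofList [.ofIndex (M.card v),
    .ofList ((List.finRange (M.indeg v)).map fun j => .ofIndex (M.pa v j)), M.codeMech v]

theorem code_eq (M : MAID) :
    M.code = .cons (.ofIndex M.numAgents) (.ofList ((List.finRange M.numVars).map M.codeVar)) := rfl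

theorem codeTable_eq (M : MAID) (v : M.Var) (g : M.Ctx v → TreeData) :
    M.codeTable v g = .ofList (((List.finRange _).map fun m => finPiFinEquiv.symm m).map g) := by
  rw [codeTable, List.map_map]; rfl

theorem size_codeVar_le (M : MAID) (v : M.Var) : (M.codeVar v).size ≤ M.code.size := by
  have h : (M.codeVar v).size + 1 ≤
      (((List.finRange M.numVars).map M.codeVar).map fun a => a.size + 1).sum :=
    List.single_le_sum (by simp) _ (by simp)
  rw [code_eq]
  simp only [size, size_ofList] at h ⊢
  omega

theorem card_le_size (M : MAID) (v : M.Var) : M.card v ≤ M.code.size := by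
  refine le_trans ?_ (M.size_codeVar_le v)
  simp [codeVar, ofList, size, size_ofIndex]
  omega

theorem owner_eq_some {M : MAID} {v : M.Var} (h : (M.owner v).isSome) :
    ∃ i, M.mech v = .decision i ∧ M.owner v = some i := by
  unfold owner at h ⊢
  split at h
  · rename_i i e; exact ⟨i, e, rfl⟩
  · simp at h

/-- The agent who takes a decision. -/
def agent (M : MAID) (D : M.Decision) : Fin M.numAgents := (M.owner D.1).get D.2

theorem owner_agent (M : MAID) (D : M.Decision) : M.owner D.1 = some (M.agent D) := by
  simp [agent]

theorem mech_agent (M : MAID) (D : M.Decision) : M.mech D.1 = .decision (M.agent D) := by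
  obtain ⟨i, h, h'⟩ := owner_eq_some D.2
  rw [h, Option.some.inj ((M.owner_agent D).symm.trans h')]

/-- The MAID in which all decision variables are replaced by chance variables, according to a
rational profile. -/
abbrev fixAll (M : MAID) (π : M.Profile ℚ) : MAID :=
  { M with mech := fun v =>
      if h : (M.owner v).isSome then .chance (π ⟨v, h⟩) else M.mech v }

theorem codeMech_of_chance {M : MAID} {v : M.Var} {cpd : M.Ctx v → stdSimplex ℚ (Fin (M.card v))}
    (h : M.mech v = .chance cpd) :
    M.codeMech v = .cons (.ofIndex 0) (M.codeTable v fun c => codeDist (cpd c)) := by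
  rw [codeMech, h]

theorem fixAll_mech_of_isSome {M : MAID} (π : M.Profile ℚ) {v : M.Var} (h : (M.owner v).isSome) :
    (M.fixAll π).mech v = .chance (π ⟨v, h⟩) := dif_pos h

theorem fixAll_mech_of_not_isSome {M : MAID} (π : M.Profile ℚ) {v : M.Var}
    (h : ¬ (M.owner v).isSome) : (M.fixAll π).mech v = M.mech v := dif_neg h

theorem codeMech_fixAll_of_not_isSome {M : MAID} (π : M.Profile ℚ) {v : M.Var}
    (h : ¬ (M.owner v).isSome) : (M.fixAll π).codeMech v = M.codeMech v := by
  unfold codeMech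
  rw [fixAll_mech_of_not_isSome π h]
  cases M.mech v <;> rfl

end MAID

namespace PolyTime

open MAID

variable {ι : Type} {c : ι → TreeData} {M : ι → MAID} (hM : PolyTime c fun x => (M x).code)

include hM

theorem numVars : PolyTime c fun x => ofIndex (M x).numVars :=
  (length hM.right).congr fun x => by simp

theorem vars : PolyTime c fun x =>
    ofList ((List.finRange (M x).numVars).map fun v : (M x).Var => ofIndex (v : ℕ)) :=
  range hM.numVars

variable {v : (x : ι) → (M x).Var} (hv : PolyTime c fun x => ofIndex (v x))

include hv

theorem codeVar : PolyTime c fun x => (M x).codeVar (v x) :=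
  getElem (F := fun x => (M x).codeVar) hM.right hv

theorem card : PolyTime c fun x => ofIndex ((M x).card (v x)) := (hM.codeVar hv).left

theorem parents : PolyTime c fun x => ofList ((List.finRange ((M x).indeg (v x))).map
    fun j => ofIndex ((M x).pa (v x) j)) := (hM.codeVar hv).right.left

theorem codeMech : PolyTime c fun x => (M x).codeMech (v x) := (hM.codeVar hv).right.right.left

theorem isDecision : PolyTime c fun x => ofBool ((M x).owner (v x)).isSome := by
  refine (indexEq (m := fun x => match (M x).mech (v x) with
    | .chance _ => 0
    | .decision _ => 1
    | .utility _ _ _ => 2) (n := fun _ => 1) ?_ (const _)).congr fun x => ?_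
  · refine (hM.codeMech hv).left.congr fun x => ?_
    rw [MAID.codeMech]
    cases (M x).mech (v x) <;> rfl
  · rw [owner]
    cases (M x).mech (v x) <;> rfl

/-- The bound on the in-degree enters here: at most `k` factors, each at most the code size, give a
product that can be written in unary. -/
theorem numContexts {k : ℕ} (hk : ∀ x, (M x).indeg (v x) ≤ k) :
    PolyTime c fun x => ofIndex (∏ j, (M x).card ((M x).pa (v x) j)) := by
  have e : ∀ x (l : List (M x).Var) s, l.foldl (fun s u => s * (M x).card u) s =
      s * (l.map (M x).card).prod := by
    intro x l
    induction l with
    | nil => simp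
    | cons a l ih => intro s; simp [ih, mul_assoc]
  refine (foldl (α := fun x => (M x).Var) (σ := fun _ => ℕ) (ca := fun x u => ofIndex u)
    (cs := fun _ s => ofIndex s) (l := fun x => (List.finRange _).map ((M x).pa (v x)))
    (s₀ := fun _ => 1) (step := fun x s u => s * (M x).card u)
    (B := fun x => 2 * (M x).code.size ^ k + 1) ?_ (const _) ?_
    (((PolyBounded.const 2).mul (hM.bounded.pow k)).add (.const 1)) ?_).congr ?_
  · exact (hM.parents hv).congr fun x => by rw [List.map_map]; rfl
  · have hd := id (c := fun p : Σ x, ℕ × (M x).Var =>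
      .cons (c p.1) (.cons (ofIndex p.2.1) (ofIndex p.2.2)))
    exact hd.right.left.mul ((hM.comp (g := Sigma.fst) hd.left).card hd.right.right)
  · intro x j
    rw [e, size_ofIndex, one_mul]
    have h := List.prod_le_pow_card
      ((((List.finRange _).map ((M x).pa (v x))).take j).map (M x).card) (M x).code.size ?_
    · refine Nat.succ_le_succ (Nat.mul_le_mul_left _ (h.trans (Nat.pow_le_pow_right (size_pos _) ?_)))
      simpa using Or.inr (hk x)
    · intro n hn
      obtain ⟨u, hu, rfl⟩ := List.mem_map.1 hn
      exact (M x).card_le_size u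
  · intro x
    rw [e, one_mul, List.map_map, Fin.prod_univ_def]; rfl

theorem contexts {k : ℕ} (hk : ∀ x, (M x).indeg (v x) ≤ k) :
    PolyTime c fun x => ofList (((List.finRange _).map fun m => finPiFinEquiv.symm m).map
      fun a : (M x).Ctx (v x) => ofIndex ((M x).ctxIndex (v x) a)) :=
  (range (hM.numContexts hv hk)).congr fun x => by simp [ctxIndex, Function.comp_def]

/-- Tables are computed entry by entry. -/
theorem codeTable {k : ℕ} (hk : ∀ x, (M x).indeg (v x) ≤ k)
    {g : (x : ι) → (M x).Ctx (v x) → TreeData}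
    (hg : PolyTime (fun p : Σ x, (M x).Ctx (v x) =>
      .cons (c p.1) (ofIndex ((M p.1).ctxIndex (v p.1) p.2))) fun p => g p.1 p.2) :
    PolyTime c fun x => (M x).codeTable (v x) (g x) :=
  (map (hM.contexts hv hk) hg).congr fun x => ((M x).codeTable_eq _ _).symm

omit hM hv in
theorem lookupTable {a : (x : ι) → (M x).Ctx (v x)} {g : (x : ι) → (M x).Ctx (v x) → TreeData}
    (hg : PolyTime c fun x => (M x).codeTable (v x) (g x))
    (ha : PolyTime c fun x => ofIndex ((M x).ctxIndex (v x) (a x))) :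
    PolyTime c fun x => g x (a x) :=
  (getElem (F := fun x m => g x (finPiFinEquiv.symm m)) hg ha).congr fun x => by
    simp [ctxIndex]

omit hv

theorem codeAgent {D : (x : ι) → (M x).Decision} (hD : PolyTime c fun x => ofIndex (D x).1) :
    PolyTime c fun x => ofIndex ((M x).agent (D x)) :=
  (hM.codeMech hD).right.congr fun x => by
    rw [MAID.codeMech, mech_agent]; rfl

/-- The code of a pure profile is computed from its values. -/
theorem codePure {k : ℕ} (hk : ∀ x, (M x).DecisionIndegLE k) {s : (x : ι) → (M x).PureProfile}
    (hs : PolyTime (fun p : Σ x, Σ D : (M x).Decision, (M x).Ctx D.1 =>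
      .cons (c p.1) (.cons (ofIndex p.2.1.1) (ofIndex ((M p.1).ctxIndex _ p.2.2))))
      fun p => ofIndex (s p.1 p.2.1 p.2.2)) :
    PolyTime c fun x => (M x).codePure (s x) := by
  refine map (α := fun x => (M x).Var) (ca := fun x v => ofIndex (v : ℕ)) hM.vars ?_
  have hd := id (c := fun p : Σ x, (M x).Var => .cons (c p.1) (ofIndex p.2))
  have hM' := hM.comp (g := Sigma.fst) hd.left
  refine of_bool (hM'.isDecision hd.right) ?_ ?_
  · have hM'' := hM'.restrict fun p => ((M p.1).owner p.2).isSome = true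
    have hd' := hd.restrict fun p => ((M p.1).owner p.2).isSome = true
    refine (codeTable (v := fun p => p.1.2) hM'' hd'.right (fun p => hk p.1.1 ⟨p.1.2, p.2⟩)
      (g := fun p a => ofIndex (s p.1.1 ⟨p.1.2, p.2⟩ a)) ?_).congr fun p => ?_
    · refine hs.comp (g := fun q : Σ p : {p : Σ x, (M x).Var // ((M p.1).owner p.2).isSome = true},
        (M p.1.1).Ctx p.1.2 => ⟨q.1.1.1, ⟨q.1.1.2, q.1.2⟩, q.2⟩) ?_
      exact id.left.left.cons (id.left.right.cons id.right)
    · rw [dif_pos p.2]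
  · exact nil.congr fun p => by rw [dif_neg (by rw [p.2]; exact Bool.false_ne_true)]

omit hM in
/-- The values of a pure profile are read off from its code. -/
theorem lookupPure {s : (x : ι) → (M x).PureProfile} {D : (x : ι) → (M x).Decision}
    {a : (x : ι) → (M x).Ctx (D x).1} (hs : PolyTime c fun x => (M x).codePure (s x))
    (hD : PolyTime c fun x => ofIndex (D x).1)
    (ha : PolyTime c fun x => ofIndex ((M x).ctxIndex _ (a x))) :
    PolyTime c fun x => ofIndex (s x (D x) (a x)) :=
  lookupTable (M := M) (v := fun x => (D x).1) (g := fun x a => ofIndex (s x (D x) a))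
    ((getElem hs hD).congr fun x => dif_pos (D x).2) ha

/-- The code of the MAID in which all decision variables are replaced by chance variables is
computed from the code of the MAID and the distributions. -/
theorem codeFixAll {k : ℕ} (hk : ∀ x, (M x).DecisionIndegLE k) {π : (x : ι) → (M x).Profile ℚ}
    (hπ : PolyTime (fun p : Σ x, Σ D : (M x).Decision, (M x).Ctx D.1 =>
      .cons (c p.1) (.cons (ofIndex p.2.1.1) (ofIndex ((M p.1).ctxIndex _ p.2.2))))
      fun p => codeDist (π p.1 p.2.1 p.2.2)) :
    PolyTime c fun x => ((M x).fixAll (π x)).code := by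
  refine hM.left.cons (map (α := fun x => (M x).Var) (ca := fun x v => ofIndex (v : ℕ)) hM.vars
    (F := fun x v => ((M x).fixAll (π x)).codeVar v) ?_)
  have hd := id (c := fun p : Σ x, (M x).Var => .cons (c p.1) (ofIndex p.2))
  have hM' := hM.comp (g := Sigma.fst) hd.left
  refine PolyTime.cons (hM'.card hd.right) (PolyTime.cons (hM'.parents hd.right)
    (PolyTime.cons ?_ nil))
  refine of_bool (hM'.isDecision hd.right) ?_ ?_
  · have hM'' := hM'.restrict fun p => ((M p.1).owner p.2).isSome = true
    have hd' := hd.restrict fun p => ((M p.1).owner p.2).isSome = true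
    refine (nil.cons (codeTable (v := fun p => p.1.2) hM'' hd'.right
      (fun p => hk p.1.1 ⟨p.1.2, p.2⟩)
      (g := fun p a => codeDist (π p.1.1 ⟨p.1.2, p.2⟩ a)) ?_)).congr fun p => ?_
    · refine hπ.comp (g := fun q : Σ p : {p : Σ x, (M x).Var // ((M p.1).owner p.2).isSome = true},
        (M p.1.1).Ctx p.1.2 => ⟨q.1.1.1, ⟨q.1.1.2, q.1.2⟩, q.2⟩) ?_
      exact id.left.left.cons (id.left.right.cons id.right)
    · exact (codeMech_of_chance (M := (M p.1.1).fixAll (π p.1.1))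
        (fixAll_mech_of_isSome (π p.1.1) p.2)).symm
  · exact ((hM'.codeMech hd.right).restrict _).congr fun p =>
      (codeMech_fixAll_of_not_isSome (π p.1.1) (by rw [p.2]; exact Bool.false_ne_true)).symm

end PolyTime

/-! ### Dyadic trembles, and expected utilities as instances of Is-Best-Response -/

namespace MAID

/-- Exponents `1, 2, …, n - 2, n - 1, n - 1`: the powers `2⁻ᵉ` add up to `1`. -/
def tailExp (n j : ℕ) : ℕ := if j + 1 = n then j else j + 1

theorem sum_tailExp {n : ℕ} (hn : 2 ≤ n) : ∑ j : Fin n, (1 / 2 : ℚ) ^ tailExp n j = 1 := by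
  obtain ⟨m, rfl⟩ : ∃ m, n = m + 1 := ⟨n - 1, by omega⟩
  have h : ∀ m : ℕ, ∑ j ∈ Finset.range m, (1 / 2 : ℚ) ^ (j + 1) + (1 / 2) ^ m = 1 := by
    intro m
    induction m with
    | zero => simp
    | succ m ih => rw [Finset.sum_range_succ]; linear_combination ih
  rw [Fin.sum_univ_castSucc]
  refine Eq.trans ?_ (h m)
  rw [Finset.sum_range]
  congr 1
  · refine Finset.sum_congr rfl fun j _ => ?_
    have := j.2
    rw [tailExp, if_neg (by simp; omega)]; simp
  · simp [tailExp]

/-- The distribution that takes the value `d`, mixed with weight `2⁻ᴷ` with a distribution of full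
support; all probabilities are dyadic. -/
def tremble (K : ℕ) {n : ℕ} (hn : 2 ≤ n) (d : Fin n) : stdSimplex ℚ (Fin n) :=
  ⟨fun j => (if j = d then 1 - (1 / 2) ^ K else 0) + (1 / 2) ^ (K + tailExp n j), fun j => by
    have : (1 / 2 : ℚ) ^ K ≤ 1 := pow_le_one₀ (by norm_num) (by norm_num)
    have h : (0 : ℚ) < (1 / 2) ^ (K + tailExp n j) := by positivity
    beta_reduce
    split <;> linarith, by
    simp only [Finset.sum_add_distrib, Finset.sum_ite_eq', Finset.mem_univ, if_true, pow_add,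
      ← Finset.mul_sum, sum_tailExp hn]
    ring⟩

theorem tremble_pos (K : ℕ) {n : ℕ} (hn : 2 ≤ n) (d j : Fin n) : 0 < (tremble K hn d).1 j := by
  have : (1 / 2 : ℚ) ^ K ≤ 1 := pow_le_one₀ (by norm_num) (by norm_num)
  have h : (0 : ℚ) < (1 / 2) ^ (K + tailExp n j) := by positivity
  simp only [tremble]
  split <;> linarith

theorem two_pow_mul_tremble (K : ℕ) {n : ℕ} (hn : 2 ≤ n) (d j : Fin n) {E : ℕ} (hE : K + n ≤ E) :
    ∃ z : ℤ, (tremble K hn d).1 j * 2 ^ E = z := by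
  have hj := j.2
  have he : tailExp n j ≤ n := by unfold tailExp; split <;> omega
  have key : ∀ a ≤ E, ∃ z : ℤ, (1 / 2 : ℚ) ^ a * 2 ^ E = z := by
    intro a ha
    refine ⟨2 ^ (E - a), ?_⟩
    have : (2 : ℚ) ^ E = 2 ^ a * 2 ^ (E - a) := by rw [← pow_add]; congr 1; omega
    rw [this, ← mul_assoc, ← mul_pow]; norm_num
  obtain ⟨y, hy⟩ := key (K + tailExp n j) (by omega)
  obtain ⟨z, hz⟩ := key K (by omega)
  simp only [tremble]
  split
  · refine ⟨2 ^ E - z + y, ?_⟩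
    push_cast
    rw [← hy, ← hz]; ring
  · exact ⟨y, by rw [zero_add, hy]⟩

theorem ofRat_tremble_of_ne (K : ℕ) {n : ℕ} (hn : 2 ≤ n) {d j : Fin n} (h : j ≠ d) :
    ofRat ((tremble K hn d).1 j) = cons (ofInt 1) (ofNat (2 ^ (K + tailExp n j))) := by
  rw [← ofRat_div (by positivity) (by simp)]
  simp [tremble, h]

/-- With `e = tailExp n d` the probability is `(2ᵉ (2ᴷ - 1) + 1) / 2ᴷ⁺ᵉ`. Because `n ≥ 2`, `e` is at
least 1, so the numerator is odd; its binary digits from below are a one, `e - 1` zeros and `K`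
ones. -/
theorem ofRat_tremble_self (K : ℕ) {n : ℕ} (hn : 2 ≤ n) (d : Fin n) :
    ofRat ((tremble K hn d).1 d) = cons (cons nil
      (ofNat (ofBits (true :: (List.replicate (tailExp n d - 1) false ++ List.replicate K true)))))
      (ofNat (2 ^ (K + tailExp n d))) := by
  obtain ⟨e, he⟩ : ∃ e, tailExp n d = e + 1 := by
    refine ⟨tailExp n d - 1, ?_⟩
    have := d.2
    unfold tailExp; split <;> omega
  have hK := ofBits_replicate_true K
  set m := ofBits (true :: (List.replicate (tailExp n d - 1) false ++ List.replicate K true)) with hm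
  have hm' : m = 2 * (2 ^ e * ofBits (List.replicate K true)) + 1 := by
    rw [hm, he]
    simp [ofBits_append, ofBits_replicate_false]
  have hodd : m.Coprime (2 ^ (K + tailExp n d)) := by
    refine Nat.Coprime.pow_right _ (Nat.coprime_two_right.2 ⟨_, hm'⟩)
  have h := ofRat_div (z := m) (d := 2 ^ (K + tailExp n d)) (by positivity) (by simpa using hodd)
  have h2 : ofInt (m : ℤ) = cons nil (ofNat m) := by
    rw [ofInt, decide_eq_false (by simp)]; rfl
  rw [← h2, ← h]
  congr 1
  have hK' : ((ofBits (List.replicate K true) : ℕ) : ℚ) = 2 ^ K - 1 := by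
    rw [eq_sub_iff_add_eq]; exact_mod_cast hK
  have h2K : (2 : ℚ) ^ K ≠ 0 := by positivity
  have h2e : (2 : ℚ) ^ e ≠ 0 := by positivity
  rw [hm', he]
  push_cast
  rw [hK']
  simp only [tremble, he, if_true, one_div, inv_pow, pow_add]
  field_simp

/-- A rational profile as a real one. -/
def realProfile (M : MAID) (π : M.Profile ℚ) : M.Profile ℝ := fun D c => realDist (π D c)

/-- The trembling version of a pure profile. -/
def trembling (M : MAID) (K : ℕ) (s : M.PureProfile) : M.Profile ℚ :=
  fun D c => tremble K (M.two_le_card D.1) (s D c)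

section fixAll

variable {M : MAID} (π : M.Profile ℚ)

theorem fixAll_owner (v : M.Var) : (M.fixAll π).owner v = none := by
  unfold owner
  by_cases h : (M.owner v).isSome
  · rw [fixAll_mech_of_isSome π h]
  · rw [fixAll_mech_of_not_isSome π h]
    have : M.owner v = none := by simpa using h
    unfold owner at this
    cases h' : M.mech v with
    | decision i => rw [h'] at this; cases this
    | _ => rfl

instance : IsEmpty (M.fixAll π).Decision :=
  ⟨fun D => absurd ((congrArg Option.isSome (fixAll_owner π D.1)).symm.trans D.2) (by simp)⟩

theorem condProb_of_chance {M : MAID} (π : M.Profile ℝ) {v : M.Var}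
    {cpd : M.Ctx v → stdSimplex ℚ (Fin (M.card v))} (h : M.mech v = .chance cpd) (a : M.Ctx v)
    (x : Fin (M.card v)) : M.condProb π v a x = (((cpd a).1 x : ℚ) : ℝ) := by
  unfold condProb
  split
  · rename_i h'; rw [h] at h'; cases h'; rfl
  all_goals (rename_i h'; rw [h] at h'; cases h')

theorem condProb_of_decision {M : MAID} (π : M.Profile ℝ) (D : M.Decision) (a : M.Ctx D.1)
    (x : Fin (M.card D.1)) : M.condProb π D.1 a x = (π D a).1 x := by
  have h := M.mech_agent D
  unfold condProb
  split
  · rename_i h'; rw [h] at h'; cases h'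
  · rfl
  · rename_i h'; rw [h] at h'; cases h'

theorem condProb_of_utility {M : MAID} (π : M.Profile ℝ) {v : M.Var} {i : Fin M.numAgents}
    {f : M.Ctx v → Fin (M.card v)} {val : Fin (M.card v) → ℚ} (h : M.mech v = .utility i f val)
    (a : M.Ctx v) (x : Fin (M.card v)) : M.condProb π v a x = if f a = x then 1 else 0 := by
  unfold condProb
  split
  · rename_i h'; rw [h] at h'; cases h'
  · rename_i h'; rw [h] at h'; cases h'
  · rename_i h'; rw [h] at h'; cases h'; rfl

theorem condProb_fixAll (σ : (M.fixAll π).Profile ℝ) (v : M.Var) (a : M.Ctx v)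
    (x : Fin (M.card v)) :
    (M.fixAll π).condProb σ v a x = M.condProb (M.realProfile π) v a x := by
  by_cases h : (M.owner v).isSome
  · exact (condProb_of_chance (M := M.fixAll π) σ (fixAll_mech_of_isSome π h) a x).trans
      (condProb_of_decision (M.realProfile π) ⟨v, h⟩ a x).symm
  · have e := fixAll_mech_of_not_isSome π h
    cases h' : M.mech v with
    | chance cpd =>
      exact (condProb_of_chance (M := M.fixAll π) σ (e.trans h') a x).trans
        (condProb_of_chance _ h' a x).symm
    | decision i => simp [owner, h'] at h
    | utility i f val =>
      exact (condProb_of_utility (M := M.fixAll π) σ (e.trans h') a x).trans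
        (condProb_of_utility _ h' a x).symm

theorem utilityValue_fixAll (i : Fin M.numAgents) (v : M.Var) (x : Fin (M.card v)) :
    (M.fixAll π).utilityValue i v x = M.utilityValue i v x := by
  unfold utilityValue
  by_cases h : (M.owner v).isSome
  · rw [fixAll_mech_of_isSome π h, M.mech_agent ⟨v, h⟩]
  · rw [fixAll_mech_of_not_isSome π h]
    cases M.mech v <;> rfl

theorem EU_fixAll (σ : (M.fixAll π).Profile ℝ) (i : Fin M.numAgents) :
    (M.fixAll π).EU i σ = M.EU i (M.realProfile π) := by
  have h : ∀ a, (M.fixAll π).jointProb σ a = M.jointProb (M.realProfile π) a := fun a =>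
    Finset.prod_congr rfl fun v _ => condProb_fixAll π σ v _ _
  have h' : ∀ v x, (M.fixAll π).probEq σ v x = M.probEq (M.realProfile π) v x := fun v x =>
    Finset.sum_congr rfl fun a _ => by rw [h a]
  exact Finset.sum_congr rfl fun v _ => Finset.sum_congr rfl fun x _ =>
    congrArg₂ (· * ·) (h' v x) (utilityValue_fixAll π i v x)

/-- The closure hypothesis replaces one decision at a time, and each replacement changes the type of
decisions. The induction therefore runs over sets `T` of variables of `M`; variables that are not
decisions change nothing. -/
theorem fixAll_mem {C : Set MAID} (hC : ∀ M ∈ C, ∀ (D : M.Decision) (r : M.Rule ℚ D), M.fix D r ∈ C)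
    (hM : M ∈ C) : M.fixAll π ∈ C := by
  classical
  let N : Finset M.Var → MAID := fun T => { M with mech := fun v =>
      if h : (M.owner v).isSome ∧ v ∈ T then .chance (π ⟨v, h.1⟩) else M.mech v }
  have key : ∀ T, N T ∈ C := by
    intro T
    induction T using Finset.induction_on with
    | empty =>
      have : N ∅ = M := by simp [N]
      rwa [this]
    | insert v T hv ih =>
      by_cases h : (M.owner v).isSome
      · have e : (N T).mech v = M.mech v := dif_neg fun h' => hv h'.2
        have h' : ((N T).owner v).isSome := by
          have : (N T).owner v = M.owner v := by
            unfold owner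
            rw [e]
            cases M.mech v <;> rfl
          rwa [this]
        have := hC _ ih ⟨v, h'⟩ (π ⟨v, h⟩)
        convert this using 1
        simp only [N, fix, MAID.mk.injEq, heq_eq_eq, true_and]
        funext w
        by_cases hw : w = v
        · subst hw
          simp [h]
        · rw [Function.update_of_ne hw]
          simp [hw]
      · have : N (insert v T) = N T := by
          simp only [N, MAID.mk.injEq, heq_eq_eq, true_and]
          funext w
          by_cases hw : w = v
          · subst hw; simp [h]
          · simp [hw]
        rwa [this]
  have : M.fixAll π = N Finset.univ := by simp [N, fixAll]
  rw [this]
  exact key _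

theorem fixAll_sufficientInformation : (M.fixAll π).SufficientInformation :=
  fun D => isEmptyElim D

theorem fixAll_decisionIndegLE (k : ℕ) : (M.fixAll π).DecisionIndegLE k :=
  fun D => isEmptyElim D

/-- The instance of Is-Best-Response that compares an expected utility with a threshold. -/
def thresholdInstance (i : Fin M.numAgents) (q : ℚ) : BRInstance where
  M := M.fixAll π
  i := i
  o := fun D => isEmptyElim (α := (M.fixAll π).Decision) D.1
  q := q

/-- Without decisions there is exactly one, empty, policy, so the question about its existence
compares a single expected utility with `q`. -/
theorem thresholdInstance_isYes (i : Fin M.numAgents) (q : ℚ) :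
    (thresholdInstance π i q).IsYes ↔ (q : ℝ) < M.EU i (M.realProfile π) :=
  ⟨fun ⟨p, hp⟩ => by
    have h := EU_fixAll π ((M.fixAll π).join (i := i) p
      ((M.fixAll π).realOpponents (thresholdInstance π i q).o)) i
    exact hp.trans_eq h, fun h =>
    ⟨fun D => isEmptyElim (α := (M.fixAll π).Decision) D.1, h.trans_eq (EU_fixAll π _ i).symm⟩⟩

/-- The opponents have no rules left, so their code is a list of empty trees, which is the same tree
as the number of variables in unary. -/
theorem thresholdInstance_code (i : Fin M.numAgents) (q : ℚ) :
    (thresholdInstance π i q).code =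
      .ofList [(M.fixAll π).code, .ofIndex i, .ofIndex M.numVars, .ofRat q] := by
  have : (M.fixAll π).codeOpponents (i := i) (thresholdInstance π i q).o = .ofIndex M.numVars := by
    unfold codeOpponents ofIndex
    congr 1
    refine List.eq_replicate_iff.2 ⟨by simp [fixAll], ?_⟩
    intro a ha
    obtain ⟨v, _, rfl⟩ := List.mem_map.1 ha
    exact dif_neg fun h => absurd ((congrArg Option.isSome (fixAll_owner π v)).symm.trans h.1) (by simp)
  rw [BRInstance.code, ← this]; rfl

end fixAll

end MAID

namespace PolyTime

open MAID

variable {ι : Type} {c : ι → TreeData}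

theorem codeDist_tremble {n K : ι → ℕ} {hn2 : ∀ x, 2 ≤ n x} {d : (x : ι) → Fin (n x)}
    (hn' : PolyTime c fun x => ofIndex (n x)) (hd : PolyTime c fun x => ofIndex (d x))
    (hK : PolyTime c fun x => ofIndex (K x)) :
    PolyTime c fun x => codeDist (tremble (K x) (hn2 x) (d x)) := by
  classical
  refine map (α := fun x => Fin (n x)) (ca := fun x j => ofIndex (j : ℕ)) (range hn') ?_
  have hc := id (c := fun p : Σ x, Fin (n x) => .cons (c p.1) (ofIndex (p.2 : ℕ)))
  have hn := hn'.comp (g := Sigma.fst) hc.left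
  have hd := hd.comp (g := Sigma.fst) hc.left
  have hK := hK.comp (g := Sigma.fst) hc.left
  have he : PolyTime (fun p : Σ x, Fin (n x) => .cons (c p.1) (ofIndex (p.2 : ℕ)))
      fun p => ofIndex (tailExp (n p.1) p.2) :=
    (ite ((hc.right.add (const (ofIndex 1))).indexEq hn) hc.right
      (hc.right.add (const (ofIndex 1)))).congr fun p => by
        unfold tailExp; split <;> rfl
  refine of_prop (hc.right.indexEq hd) ?_ ?_
  · have hbits := ofBits (l := fun p : Σ x, Fin (n x) =>
      true :: (List.replicate (tailExp (n p.1) p.2 - 1) false ++ List.replicate (K p.1) true))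
      ((const (ofBool true)).cons
        ((he.sub (const (ofIndex 1))).replicateFalse.appendBits hK.replicateTrue))
    refine (((nil.cons hbits).cons (hK.add he).twoPow).restrict _).congr fun p => ?_
    · have h : p.1.2 = d p.1.1 := Fin.ext p.2
      have := ofRat_tremble_self (K p.1.1) (hn2 p.1.1) (d p.1.1)
      rw [← h] at this ⊢
      exact this.symm
  · refine (((const (ofInt 1)).cons (hK.add he).twoPow).restrict _).congr fun p => ?_
    exact (ofRat_tremble_of_ne _ _ fun h => p.2 (congrArg Fin.val h)).symm

open Classical in
theorem isYes {C : Set MAID} (hBR : IsBestResponseInPolyTime C) {x : ι → BRInstance}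
    (hx : ∀ j, (x j).M ∈ C) (h : PolyTime c fun j => (x j).code) :
    PolyTime c fun j => ofBool (decide (x j).IsYes) := by
  obtain ⟨P, p, hP⟩ := hBR
  have : PolyTime (fun y : {y : BRInstance // y.M ∈ C} => y.1.code)
      fun y => ofBool (decide y.1.IsYes) := by
    have h' : ∀ y : {y : BRInstance // y.M ∈ C}, ∃ t,
        TreeProg.Runs P y.1.code (ofBool (decide y.1.IsYes)) t ∧ t ≤ p.eval y.1.code.size := by
      rintro ⟨y, hy⟩
      obtain ⟨b, t, hb, ht, htp⟩ := hP y hy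
      have : b = decide y.IsYes := Bool.eq_iff_iff.2 (by simpa using hb)
      exact ⟨t, this ▸ ht, htp⟩
    choose t ht htp using h'
    exact ⟨P, t, ht, p, htp⟩
  exact this.comp (g := fun j => ⟨x j, hx j⟩) h

open Classical in
/-- Expected utilities under rational profiles are compared with thresholds by means of
Is-Best-Response. -/
theorem ltEU {C : Set MAID} {k : ℕ}
    (hC : ∀ M ∈ C, ∀ (D : M.Decision) (r : M.Rule ℚ D), M.fix D r ∈ C)
    (hBR : IsBestResponseInPolyTime {M | M ∈ C ∧ M.SufficientInformation ∧ M.DecisionIndegLE k})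
    {M : ι → MAID} (hM : PolyTime c fun x => (M x).code)
    (hMC : ∀ x, M x ∈ C) {π : (x : ι) → (M x).Profile ℚ}
    (hπ : PolyTime c fun x => ((M x).fixAll (π x)).code) {i : (x : ι) → Fin (M x).numAgents}
    (hi : PolyTime c fun x => ofIndex (i x)) {q : ι → ℚ} (hq : PolyTime c fun x => ofRat (q x)) :
    PolyTime c fun x => ofBool (decide ((q x : ℝ) < (M x).EU (i x) ((M x).realProfile (π x)))) := by
  refine (isYes hBR (x := fun x => thresholdInstance (π x) (i x) (q x)) (fun x =>
    ⟨fixAll_mem _ hC (hMC x), fixAll_sufficientInformation _, fixAll_decisionIndegLE _ k⟩)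
    ((hπ.cons (hi.cons (hM.numVars.cons (hq.cons nil)))).congr fun x =>
      (thresholdInstance_code _ _ _).symm)).congr fun x => ?_
  rw [decide_eq_decide.2 (thresholdInstance_isYes _ _ _)]

end PolyTime

/-! ### Extending active trails -/

namespace IsActiveTrail

variable {α : Type} {E : α → α → Prop} {Z : Set α} {l : List α} {m n y u : α}

theorem reverse (h : IsActiveTrail E Z l) : IsActiveTrail E Z l.reverse where
  chain := by
    rw [List.isChain_reverse]
    exact h.chain.imp fun a b hab => hab.symm
  collider x y z hl hx hz := h.collider z y x (by simpa using List.reverse_infix.2 hl) hz hx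
  nonCollider x y z hl hc := h.nonCollider z y x (by simpa using List.reverse_infix.2 hl)
    fun h' => hc h'.symm
  head a ha := h.last a (by simpa using ha)
  last a ha := h.head a (by simpa using ha)

theorem singleton (h : n ∉ Z) : IsActiveTrail E Z [n] where
  chain := by simp
  collider x y z hl := by have := hl.length_le; simp at this
  nonCollider x y z hl := by have := hl.length_le; simp at this
  head a ha := by simp at ha; rwa [← ha]
  last a ha := by simp at ha; rwa [← ha]

theorem head_notMem (h : IsActiveTrail E Z (n :: l)) : n ∉ Z := h.head n (by simp)

/-- Trails grow at the head, where `n` becomes an inner node. It is outside `Z` as an old endpoint;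
only if the new edge points to it can it be a collider. -/
theorem cons (h : IsActiveTrail E Z (n :: l)) (hmn : E m n ∨ E n m) (hm : m ∉ Z)
    (hc : E m n → ∃ d ∈ Z, Relation.ReflTransGen E n d) : IsActiveTrail E Z (m :: n :: l) where
  chain := by
    rw [List.isChain_cons_cons]
    exact ⟨hmn, h.chain⟩
  collider x y z hl hx hz := by
    rw [List.infix_cons_iff] at hl
    rcases hl with hl | hl
    · rw [List.cons_prefix_cons, List.cons_prefix_cons] at hl
      obtain ⟨rfl, rfl, -⟩ := hl
      exact hc hx
    · exact h.collider x y z hl hx hz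
  nonCollider x y z hl hx := by
    rw [List.infix_cons_iff] at hl
    rcases hl with hl | hl
    · rw [List.cons_prefix_cons, List.cons_prefix_cons] at hl
      obtain ⟨rfl, rfl, -⟩ := hl
      exact h.head_notMem
    · exact h.nonCollider x y z hl hx
  head a ha := by simp at ha; rwa [← ha]
  last a ha := h.last a (by simpa using ha)

/-- Two applications of `cons` would not do: the common child `y` may lie in `Z`, so the trail must
not be required to be active while it ends there. -/
theorem cons_collider (hE : ∀ a b, E a b → ¬ E b a) (h : IsActiveTrail E Z (n :: l))
    (hny : E n y) (hmy : E m y) (hm : m ∉ Z) (hc : ∃ d ∈ Z, Relation.ReflTransGen E y d) :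
    IsActiveTrail E Z (m :: y :: n :: l) where
  chain := by
    rw [List.isChain_cons_cons, List.isChain_cons_cons]
    exact ⟨.inl hmy, .inr hny, h.chain⟩
  collider x y' z hl hx hz := by
    rw [List.infix_cons_iff, List.infix_cons_iff] at hl
    rcases hl with hl | hl | hl
    · rw [List.cons_prefix_cons, List.cons_prefix_cons] at hl
      obtain ⟨rfl, rfl, -⟩ := hl
      exact hc
    · rw [List.cons_prefix_cons, List.cons_prefix_cons] at hl
      obtain ⟨rfl, rfl, -⟩ := hl
      exact absurd hx (hE _ _ hny)
    · exact h.collider x y' z hl hx hz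
  nonCollider x y' z hl hx := by
    rw [List.infix_cons_iff, List.infix_cons_iff] at hl
    rcases hl with hl | hl | hl
    · rw [List.cons_prefix_cons, List.cons_prefix_cons, List.cons_prefix_cons] at hl
      obtain ⟨rfl, rfl, rfl, -⟩ := hl
      exact absurd ⟨hmy, hny⟩ hx
    · rw [List.cons_prefix_cons, List.cons_prefix_cons] at hl
      obtain ⟨rfl, rfl, -⟩ := hl
      exact h.head_notMem
    · exact h.nonCollider x y' z hl hx
  head a ha := by simp at ha; rwa [← ha]
  last a ha := h.last a (by simpa using ha)

end IsActiveTrail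

/-- There is an active trail from `m` to `n`. -/
def ActivelyLinked {α : Type} (E : α → α → Prop) (Z : Set α) (m n : α) : Prop :=
  ∃ l, IsActiveTrail E Z (n :: l) ∧ (n :: l).getLast? = some m

namespace ActivelyLinked

variable {α : Type} {E : α → α → Prop} {Z : Set α} {m n y u w : α}

theorem dConnected (h : ActivelyLinked E Z m n) {Y : Set α} (hn : n ∈ Y) :
    DConnected E {m} Y Z := by
  obtain ⟨l, hl, hm⟩ := h
  exact ⟨(n :: l).reverse, hl.reverse, ⟨m, by rw [List.head?_reverse]; exact hm, rfl⟩,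
    ⟨n, by rw [List.getLast?_reverse]; rfl, hn⟩⟩

theorem refl (h : n ∉ Z) : ActivelyLinked E Z n n := ⟨[], .singleton h, rfl⟩

theorem down (hE : ∀ a b, E a b → ¬ E b a) (h : ActivelyLinked E Z m n) (hny : E n y)
    (hy : y ∉ Z) : ActivelyLinked E Z m y := by
  obtain ⟨l, hl, hm⟩ := h
  exact ⟨n :: l, hl.cons (.inr hny) hy fun h => absurd h (hE _ _ hny), by
    rw [List.getLast?_cons_cons]; exact hm⟩

/-- A node without descendants in `Z` has only such nodes below it, so the directed path avoids `Z`
and no collider arises on it. -/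
theorem descend (hE : ∀ a b, E a b → ¬ E b a) (h : ActivelyLinked E Z m n)
    (hn : ¬ ∃ d ∈ Z, Relation.ReflTransGen E n d) (hnu : Relation.ReflTransGen E n u) :
    ActivelyLinked E Z m u := by
  induction hnu using Relation.ReflTransGen.head_induction_on with
  | refl => exact h
  | head hab _ ih =>
    exact ih (h.down hE hab fun hZ => hn ⟨_, hZ, .single hab⟩)
      fun ⟨d, hd, hbd⟩ => hn ⟨d, hd, .head hab hbd⟩

/-- If no node of `U` is reached, then a reached node gives access to all nodes outside `Z` that
are moral neighbours of it in the ancestral graph of `Z` and `U`. -/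
theorem spread (hE : ∀ a b, E a b → ¬ E b a) {U : Set α} (hU : ∀ u ∈ U, ¬ ActivelyLinked E Z m u)
    (h : ActivelyLinked E Z m n) (hny : n = y ∨ E n y) (hwy : w = y ∨ E w y) (hw : w ∉ Z)
    (hy : (∃ d ∈ Z, Relation.ReflTransGen E y d) ∨ ∃ u ∈ U, Relation.ReflTransGen E y u) :
    ActivelyLinked E Z m w := by
  -- The common node of the two families either has a descendant in `Z`, and then a collider there
  -- is open, or it has one in `U`. In the latter case, walking down from it would link `m` to `U`.
  rcases hny with rfl | hny
  · rcases hwy with rfl | hwy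
    · exact h
    · by_cases hn : ∃ d ∈ Z, Relation.ReflTransGen E n d
      · obtain ⟨l, hl, hm⟩ := h
        exact ⟨n :: l, hl.cons (.inl hwy) hw fun _ => hn, by rw [List.getLast?_cons_cons]; exact hm⟩
      · obtain ⟨u, hu, hnu⟩ := hy.resolve_left hn
        exact absurd (h.descend hE hn hnu) (hU u hu)
  · rcases hwy with rfl | hwy
    · exact h.down hE hny hw
    · by_cases hn : ∃ d ∈ Z, Relation.ReflTransGen E y d
      · obtain ⟨l, hl, hm⟩ := h
        exact ⟨y :: n :: l, hl.cons_collider hE hny hwy hw hn, by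
          rw [List.getLast?_cons_cons, List.getLast?_cons_cons]; exact hm⟩
      · obtain ⟨u, hu, hnu⟩ := hy.resolve_left hn
        exact absurd ((h.down hE hny fun hZ => hn ⟨y, hZ, .refl⟩).descend hE hn hnu) (hU u hu)

end ActivelyLinked

/-! ### Sums over outcomes, marginalisation and gains -/

/-- Exchange of the coordinates in `X` between the two factors of a product of sums. -/
theorem sum_mul_sum_exchange {ι : Type} {β : ι → Type} (X : Set ι) [DecidablePred (· ∈ X)]
    (S : Finset ((v : ι) → β v)) (A A' B B' : ((v : ι) → β v) → ℝ)
    (hS : ∀ a ∈ S, ∀ b ∈ S, (fun v => if v ∈ X then a v else b v) ∈ S)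
    (hA : ∀ a ∈ S, ∀ b ∈ S, A (fun v => if v ∈ X then a v else b v) = A a)
    (hA' : ∀ a ∈ S, ∀ b ∈ S, A' (fun v => if v ∈ X then a v else b v) = A' a)
    (hB : ∀ a ∈ S, ∀ b ∈ S, B (fun v => if v ∈ X then a v else b v) = B b)
    (hB' : ∀ a ∈ S, ∀ b ∈ S, B' (fun v => if v ∈ X then a v else b v) = B' b) :
    (∑ a ∈ S, A a * B a) * ∑ a ∈ S, A' a * B' a = (∑ a ∈ S, A' a * B a) * ∑ a ∈ S, A a * B' a := by
  rw [Finset.sum_mul_sum, Finset.sum_mul_sum, ← Finset.sum_product', ← Finset.sum_product']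
  let mix : ((v : ι) → β v) → ((v : ι) → β v) → (v : ι) → β v :=
    fun a b v => if v ∈ X then a v else b v
  have mm : ∀ a b, mix (mix a b) (mix b a) = a := by
    intro a b; funext v; simp only [mix]; split <;> rfl
  -- Swapping the `X`-coordinates of the two outcomes is an involution of `S × S`; it matches the
  -- terms of the two products.
  refine Finset.sum_nbij' (fun p => (mix p.2 p.1, mix p.1 p.2)) (fun p => (mix p.2 p.1, mix p.1 p.2))
    ?_ ?_ ?_ ?_ ?_
  · rintro ⟨a, b⟩ h
    simp only [Finset.mem_product] at h ⊢
    exact ⟨hS _ h.2 _ h.1, hS _ h.1 _ h.2⟩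
  · rintro ⟨a, b⟩ h
    simp only [Finset.mem_product] at h ⊢
    exact ⟨hS _ h.2 _ h.1, hS _ h.1 _ h.2⟩
  · rintro ⟨a, b⟩ h; simp [mm]
  · rintro ⟨a, b⟩ h; simp [mm]
  · rintro ⟨a, b⟩ h
    simp only [Finset.mem_product] at h
    simp only [mix]
    rw [hA' _ h.2 _ h.1, hB _ h.2 _ h.1, hA _ h.1 _ h.2, hB' _ h.1 _ h.2]
    ring

/-- Averaging over one coordinate does not change a sum. -/
theorem sum_eq_sum_average {ι : Type} [Fintype ι] [DecidableEq ι] {n : ι → ℕ} (v : ι) (hn : n v ≠ 0)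
    (F : ((v : ι) → Fin (n v)) → ℝ) :
    ∑ a, F a = ∑ a, ∑ x, F (Function.update a v x) * (n v : ℝ)⁻¹ := by
  have h : ∑ a, ∑ x : Fin (n v), F (Function.update a v x) = ∑ a, ∑ x : Fin (n v), F a := by
    rw [← Finset.sum_product', ← Finset.sum_product']
    refine Finset.sum_nbij' (fun p => (Function.update p.1 v p.2, p.1 v))
      (fun p => (Function.update p.1 v p.2, p.1 v)) ?_ ?_ ?_ ?_ ?_ <;> simp
  simp only [← Finset.sum_mul, h]
  simp only [Finset.sum_const, Finset.card_univ, Fintype.card_fin, nsmul_eq_mul, Finset.sum_mul]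
  refine Finset.sum_congr rfl fun a _ => ?_
  have : (n v : ℝ) ≠ 0 := Nat.cast_ne_zero.2 hn
  field_simp

namespace MAID

variable {M : MAID}

theorem condProb_nonneg (π : M.Profile ℝ) (v : M.Var) (c : M.Ctx v) (x : Fin (M.card v)) :
    0 ≤ M.condProb π v c x := by
  unfold condProb
  split
  · exact_mod_cast (Subtype.prop _ : _ ∈ stdSimplex ℚ _).1 x
  · rename_i h; exact (π ⟨v, by simp [owner, h]⟩ c).2.1 x
  · split <;> norm_num

theorem sum_condProb (π : M.Profile ℝ) (v : M.Var) (c : M.Ctx v) :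
    ∑ x, M.condProb π v c x = 1 := by
  cases h : M.mech v with
  | chance cpd =>
    simp only [condProb_of_chance π h]
    exact_mod_cast (cpd c).2.2
  | decision i =>
    have h' : (M.owner v).isSome := by simp [owner, h]
    simp only [condProb_of_decision π ⟨v, h'⟩]
    exact (π ⟨v, h'⟩ c).2.2
  | utility i f val =>
    simp only [condProb_of_utility π h]
    simp

theorem condProb_le_one (π : M.Profile ℝ) (v : M.Var) (c : M.Ctx v) (x : Fin (M.card v)) :
    M.condProb π v c x ≤ 1 := by
  rw [← sum_condProb π v c]
  exact Finset.single_le_sum (fun x _ => condProb_nonneg π v c x) (Finset.mem_univ x)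

theorem condProb_congr {π π' : M.Profile ℝ} (v : M.Var)
    (h : ∀ hv : (M.owner v).isSome, π ⟨v, hv⟩ = π' ⟨v, hv⟩) : M.condProb π v = M.condProb π' v := by
  funext c x
  cases h' : M.mech v with
  | chance cpd => rw [condProb_of_chance π h', condProb_of_chance π' h']
  | decision i =>
    have hv : (M.owner v).isSome := by simp [owner, h']
    rw [condProb_of_decision π ⟨v, hv⟩, condProb_of_decision π' ⟨v, hv⟩, h hv]
  | utility i f val => rw [condProb_of_utility π h', condProb_of_utility π' h']

theorem jointProb_nonneg (π : M.Profile ℝ) (a : M.Outcome) : 0 ≤ M.jointProb π a :=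
  Finset.prod_nonneg fun v _ => condProb_nonneg π v _ _

/-- The parents' values in an outcome. -/
abbrev ctx (v : M.Var) (a : M.Outcome) : M.Ctx v := fun j => a (M.pa v j)

theorem ctx_congr {v : M.Var} {a b : M.Outcome} (h : ∀ u, M.Edge u v → a u = b u) :
    M.ctx v a = M.ctx v b := funext fun j => h _ ⟨j, rfl⟩

theorem wellFounded_edge (M : MAID) : WellFounded M.Edge := by
  have : Std.Irrefl (Relation.TransGen M.Edge) := ⟨M.acyclic⟩
  exact Subrelation.wf (r := Relation.TransGen M.Edge) (fun h => .single h)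
    (Finite.wellFounded_of_trans_of_irrefl _)

theorem edge_asymm {u v : M.Var} (h : M.Edge u v) : ¬ M.Edge v u :=
  fun h' => M.acyclic u (.tail (.single h) h')

theorem indepMechEdge_asymm (a b : M.Var ⊕ M.Var) (h : M.IndepMechEdge a b) :
    ¬ M.IndepMechEdge b a := by
  rcases a with u | u <;> rcases b with v | v
  · exact fun h' => edge_asymm h h'
  · exact h.elim
  · exact fun h' => h'
  · exact h.elim

theorem reflTransGen_indepMechEdge {u v : M.Var} (h : Relation.ReflTransGen M.Edge u v) :
    Relation.ReflTransGen M.IndepMechEdge (.inl u) (.inl v) :=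
  Relation.ReflTransGen.lift (Sum.inl : M.Var → M.Var ⊕ M.Var) (fun _ _ h => h) _ _ h

/-- Variables outside an ancestral set `T` can be marginalised out; here their conditional
distributions are replaced by uniform ones. -/
theorem sum_mul_jointProb (π : M.Profile ℝ) (T : Set M.Var) [DecidablePred (· ∈ T)]
    (hT : ∀ u v, M.Edge u v → v ∈ T → u ∈ T) (f : M.Outcome → ℝ)
    (hf : ∀ a b, (∀ v ∈ T, a v = b v) → f a = f b) :
    ∑ a, f a * M.jointProb π a = ∑ a, f a * ∏ v,
      if v ∈ T then M.condProb π v (M.ctx v a) (a v) else (M.card v : ℝ)⁻¹ := by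
  classical
  -- `R` is a set of variables, closed under children, whose factors are already uniform. Passing
  -- from `R.erase v` to `R`, for a `v` without parents in `R`, is harmless: all children of `v`
  -- have uniform factors, so nothing but the factor of `v` depends on its value.
  suffices H : ∀ (n : ℕ) (R : Finset M.Var), R.card = n → (∀ v ∈ R, v ∉ T) →
      (∀ u v, M.Edge u v → u ∈ R → v ∈ R) →
      ∑ a, f a * ∏ v, (if v ∈ R then (M.card v : ℝ)⁻¹ else M.condProb π v (M.ctx v a) (a v)) =
        ∑ a, f a * M.jointProb π a by
    rw [← H _ (Finset.univ.filter fun v => v ∉ T) rfl (by simp)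
      (fun u v e h => by simpa using fun hv => (Finset.mem_filter.1 h).2 (hT u v e hv))]
    refine Finset.sum_congr rfl fun a _ => ?_
    congr 1
    refine Finset.prod_congr rfl fun v _ => ?_
    by_cases h : v ∈ T <;> simp [h]
  intro n
  induction n with
  | zero =>
    intro R hR _ _
    rw [Finset.card_eq_zero.1 hR]
    simp [jointProb]
  | succ n ih =>
    intro R hR hRT hch
    obtain ⟨v, hv, hmin⟩ := M.wellFounded_edge.has_min (R : Set M.Var)
      (Finset.card_pos.1 (by omega))
    have hvR : v ∈ R := hv
    rw [← ih (R.erase v) (by rw [Finset.card_erase_of_mem hvR]; omega)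
      (fun w hw => hRT w (Finset.mem_of_mem_erase hw))
      (fun u w e hu => Finset.mem_erase.2 ⟨fun h => hmin u (Finset.mem_of_mem_erase hu) (h ▸ e),
        hch u w e (Finset.mem_of_mem_erase hu)⟩)]
    let G : M.Outcome → ℝ := fun a => f a * ∏ w ∈ Finset.univ.erase v,
      if w ∈ R then (M.card w : ℝ)⁻¹ else M.condProb π w (M.ctx w a) (a w)
    have hG : ∀ a x, G (Function.update a v x) = G a := by
      intro a x
      simp only [G]
      congr 1
      · exact hf _ _ fun w hw => Function.update_of_ne (fun h : w = v => hRT v hvR (h ▸ hw)) _ _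
      · refine Finset.prod_congr rfl fun w hw => ?_
        have hwv := Finset.ne_of_mem_erase hw
        by_cases hwR : w ∈ R
        · simp [hwR]
        · rw [if_neg hwR, if_neg hwR, Function.update_of_ne hwv]
          congr 1
          exact ctx_congr fun u hu => Function.update_of_ne
            (fun h : u = v => hwR (hch v w (h ▸ hu) hvR)) _ _
    have e1 : ∀ a, f a * ∏ w, (if w ∈ R then (M.card w : ℝ)⁻¹ else
        M.condProb π w (M.ctx w a) (a w)) = G a * (M.card v : ℝ)⁻¹ := by
      intro a
      rw [← Finset.mul_prod_erase _ _ (Finset.mem_univ v), if_pos hvR]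
      simp only [G]; ring
    have e2 : ∀ a, f a * ∏ w, (if w ∈ R.erase v then (M.card w : ℝ)⁻¹ else
        M.condProb π w (M.ctx w a) (a w)) = G a * M.condProb π v (M.ctx v a) (a v) := by
      intro a
      rw [← Finset.mul_prod_erase _ _ (Finset.mem_univ v), if_neg (by simp)]
      have : ∏ w ∈ Finset.univ.erase v, (if w ∈ R.erase v then (M.card w : ℝ)⁻¹ else
          M.condProb π w (M.ctx w a) (a w)) = ∏ w ∈ Finset.univ.erase v,
          if w ∈ R then (M.card w : ℝ)⁻¹ else M.condProb π w (M.ctx w a) (a w) :=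
        Finset.prod_congr rfl fun w hw => by simp [Finset.ne_of_mem_erase hw]
      rw [this]
      simp only [G]; ring
    have hc : M.card v ≠ 0 := by have := M.two_le_card v; omega
    simp only [e1, e2]
    rw [sum_eq_sum_average v hc fun a => G a * M.condProb π v (M.ctx v a) (a v)]
    refine Finset.sum_congr rfl fun a _ => ?_
    have hctx : ∀ x, M.ctx v (Function.update a v x) = M.ctx v a := fun x =>
      ctx_congr fun u hu => Function.update_of_ne (fun h : u = v => M.acyclic v (.single (h ▸ hu))) _ _
    simp only [hG, hctx, Function.update_self]
    rw [← Finset.sum_mul, ← Finset.mul_sum, sum_condProb, mul_one]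

/-- The utility variables of the agent of `D` that are descendants of `D`. -/
def affected (D : M.Decision) : Set M.Var :=
  {u | M.utilityOwner u = M.owner D.1 ∧ Relation.TransGen M.Edge D.1 u}

open Classical in
/-- The sum of the utilities that depend on `D`. -/
noncomputable def affectedUtility (D : M.Decision) (a : M.Outcome) : ℝ :=
  ∑ u, if u ∈ affected D then M.utilityValue (M.agent D) u (a u) else 0

/-- A distribution that is concentrated in one point. -/
def pointDist {n : ℕ} (d : Fin n) : stdSimplex ℝ (Fin n) := ⟨Pi.single d 1, single_mem_stdSimplex ℝ d⟩

/-- The profile in which the decision `D` is always `d`. -/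
def always (π : M.Profile ℝ) (D : M.Decision) (d : Fin (M.card D.1)) : M.Profile ℝ :=
  Function.update π D fun _ => pointDist d

open Classical in
/-- The mean of `f` on the event that the parents of `D` have the values `c`, when the decision is
`d`. -/
noncomputable def partialMean (π : M.Profile ℝ) (D : M.Decision) (c : M.Ctx D.1)
    (d : Fin (M.card D.1)) (f : M.Outcome → ℝ) : ℝ :=
  ∑ a, (if M.ctx D.1 a = c then f a else 0) * M.jointProb (always π D d) a

/-- The contribution of the decision `d` in the context `c` to the expected utility. -/
noncomputable def gain (π : M.Profile ℝ) (D : M.Decision) (c : M.Ctx D.1)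
    (d : Fin (M.card D.1)) : ℝ := partialMean π D c d (affectedUtility D)

theorem condProb_always (π : M.Profile ℝ) (D : M.Decision) (d : Fin (M.card D.1)) (c : M.Ctx D.1)
    (x : Fin (M.card D.1)) : M.condProb (always π D d) D.1 c x = if x = d then 1 else 0 := by
  rw [condProb_of_decision, always, Function.update_self, pointDist]
  simp [Pi.single_apply]

theorem condProb_update_of_ne (π : M.Profile ℝ) (D : M.Decision)
    (r : M.Rule ℝ D) {v : M.Var} (h : v ≠ D.1) :
    M.condProb (Function.update π D r) v = M.condProb π v :=
  condProb_congr v fun hv => Function.update_of_ne (fun h' => h (congrArg Subtype.val h')) _ _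

theorem condProb_always_of_ne (π : M.Profile ℝ) (D : M.Decision) (d : Fin (M.card D.1)) {v : M.Var}
    (h : v ≠ D.1) : M.condProb (always π D d) v = M.condProb π v := condProb_update_of_ne _ _ _ h

theorem utilityValue_eq_zero {i : Fin M.numAgents} {v : M.Var} (h : M.utilityOwner v ≠ some i)
    (x : Fin (M.card v)) : M.utilityValue i v x = 0 := by
  unfold utilityOwner at h
  unfold utilityValue
  split
  · rename_i j f val e
    rw [e] at h
    exact if_neg fun h' => h (by rw [h'])
  · rfl

theorem EU_eq_sum (π : M.Profile ℝ) (i : Fin M.numAgents) :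
    M.EU i π = ∑ v, ∑ a, M.utilityValue i v (a v) * M.jointProb π a := by
  refine Finset.sum_congr rfl fun v _ => ?_
  simp only [probEq, Finset.sum_mul]
  rw [Finset.sum_comm]
  refine Finset.sum_congr rfl fun a _ => ?_
  simp only [ite_mul, zero_mul]
  rw [Finset.sum_ite_eq]
  simp [mul_comm]

/-- Expected utility as a function of one decision rule. -/
theorem EU_update_sub (π : M.Profile ℝ) (D : M.Decision)
    (r r' : M.Rule ℝ D) :
    M.EU (M.agent D) (Function.update π D r) - M.EU (M.agent D) (Function.update π D r') =
      ∑ c, ∑ d, ((r c).1 d - (r' c).1 d) * gain π D c d := by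
  classical
  let U : M.Var → M.Outcome → ℝ := fun v a => M.utilityValue (M.agent D) v (a v)
  let W : M.Rule ℝ D → M.Var → ℝ := fun r v => ∑ a, U v a * M.jointProb (Function.update π D r) a
  have h1 : ∀ v, v ∉ affected D → W r v = W r' v := by
    intro v hv
    by_cases ho : M.utilityOwner v = M.owner D.1
    · have hD : ¬ Relation.ReflTransGen M.Edge D.1 v := by
        intro h
        rcases Relation.reflTransGen_iff_eq_or_transGen.1 h with h | h
        · have hs := M.owner_agent D
          subst h
          rw [← ho, utilityOwner, M.mech_agent D] at hs
          cases hs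
        · exact hv ⟨ho, h⟩
      -- The ancestors of an unaffected utility variable do not include `D`. After all other
      -- variables are marginalised out, the rule at `D` has disappeared.
      have hT : ∀ u w, M.Edge u w → w ∈ {w | Relation.ReflTransGen M.Edge w v} →
          u ∈ {w | Relation.ReflTransGen M.Edge w v} := fun u w e h => .head e h
      have hf : ∀ a b : M.Outcome, (∀ w ∈ {w | Relation.ReflTransGen M.Edge w v}, a w = b w) →
          U v a = U v b := fun a b h => by
        simp only [U]; rw [h v (show Relation.ReflTransGen M.Edge v v from .refl)]
      simp only [W]
      rw [sum_mul_jointProb _ _ hT _ hf, sum_mul_jointProb _ _ hT _ hf]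
      refine Finset.sum_congr rfl fun a _ => ?_
      congr 1
      refine Finset.prod_congr rfl fun w _ => ?_
      split
      · rename_i hw
        have : w ≠ D.1 := fun h => hD (h ▸ hw)
        rw [condProb_update_of_ne _ _ _ this, condProb_update_of_ne _ _ _ this]
      · rfl
    · have : ∀ a, U v a = 0 := fun a =>
        utilityValue_eq_zero (fun h => ho (h.trans (M.owner_agent D).symm)) _
      simp [W, this]
  have h2 : ∀ r, ∑ v, (if v ∈ affected D then W r v else 0) = ∑ c, ∑ d, (r c).1 d * gain π D c d := by
    intro r
    have e1 : ∑ v, (if v ∈ affected D then W r v else 0) =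
        ∑ a, affectedUtility D a * M.jointProb (Function.update π D r) a := by
      simp only [affectedUtility, Finset.sum_mul]
      rw [Finset.sum_comm]
      refine Finset.sum_congr rfl fun v _ => ?_
      split
      · rfl
      · simp
    have e2 : ∀ a, M.jointProb (Function.update π D r) a =
        ∑ d, (r (M.ctx D.1 a)).1 d * M.jointProb (always π D d) a := by
      intro a
      have h3 : ∀ σ : M.Rule ℝ D, M.jointProb (Function.update π D σ) a =
          (σ (M.ctx D.1 a)).1 (a D.1) *
            ∏ w ∈ Finset.univ.erase D.1, M.condProb π w (M.ctx w a) (a w) := by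
        intro σ
        rw [jointProb, ← Finset.mul_prod_erase _ _ (Finset.mem_univ D.1), condProb_of_decision,
          Function.update_self]
        congr 1
        refine Finset.prod_congr rfl fun w hw => ?_
        rw [condProb_update_of_ne _ _ _ (Finset.ne_of_mem_erase hw)]
      have h4 : ∀ d, M.jointProb (always π D d) a = (if d = a D.1 then 1 else 0) *
            ∏ w ∈ Finset.univ.erase D.1, M.condProb π w (M.ctx w a) (a w) := by
        intro d
        rw [always, h3]
        congr 1
        simp [pointDist, Pi.single_apply, eq_comm]
      rw [h3]
      simp only [h4]
      simp
    rw [e1]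
    simp only [e2, gain, partialMean, Finset.mul_sum]
    rw [Finset.sum_comm]
    conv_rhs => rw [Finset.sum_comm]
    refine Finset.sum_congr rfl fun d _ => ?_
    rw [Finset.sum_comm]
    refine Finset.sum_congr rfl fun a _ => ?_
    simp only [ite_mul, zero_mul, mul_ite, mul_zero]
    rw [Finset.sum_ite_eq]
    simp; ring
  have h3 : ∀ r, M.EU (M.agent D) (Function.update π D r) =
      ∑ v, (if v ∈ affected D then W r v else 0) + ∑ v, (if v ∈ affected D then 0 else W r v) := by
    intro r
    rw [EU_eq_sum, ← Finset.sum_add_distrib]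
    refine Finset.sum_congr rfl fun v _ => ?_
    split <;> simp [W, U]
  rw [h3, h3, h2, h2]
  have : ∑ v, (if v ∈ affected D then 0 else W r v) = ∑ v, (if v ∈ affected D then 0 else W r' v) :=
    Finset.sum_congr rfl fun v _ => by
      split
      · rfl
      · rename_i h; exact h1 v h
  rw [this]
  simp only [sub_mul, Finset.sum_sub_distrib]
  ring

end MAID

/-! ### Gains do not see irrelevant mechanisms, up to a positive factor -/

namespace MAID

variable {M : MAID}

/-- The decision `D` and its parents. -/
def family (D : M.Decision) : Set M.Var := {u | u = D.1 ∨ M.Edge u D.1}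

theorem sReachable_of_linked {V : M.Var} {D : M.Decision} {u : M.Var} (hu : u ∈ affected D)
    (h : ActivelyLinked M.IndepMechEdge {w | ∃ u, w = Sum.inl u ∧ (u = D.1 ∨ M.Edge u D.1)}
      (.inr V) (.inl u)) : M.SReachable V D :=
  h.dConnected ⟨u, rfl, hu.1, hu.2⟩

/-- If the mechanisms of the variables in `bad` are not s-reachable from `D`, then they influence
the gain of all decisions in a context by the same factor as the probability of the context. -/
theorem partialMean_mul_partialMean {π π' : M.Profile ℝ} {D : M.Decision} (bad : Set M.Var)
    (hbad : ∀ v ∈ bad, ¬ M.SReachable v D)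
    (hπ : ∀ v ∉ bad, M.condProb π v = M.condProb π' v) (c : M.Ctx D.1) (d : Fin (M.card D.1)) :
    gain π D c d * partialMean π' D c d 1 = gain π' D c d * partialMean π D c d 1 := by
  classical
  set E := M.IndepMechEdge with hE
  set Zs : Set (M.Var ⊕ M.Var) := {w | ∃ u, w = Sum.inl u ∧ (u = D.1 ∨ M.Edge u D.1)} with hZs
  have memZ : ∀ {u : M.Var}, Sum.inl u ∈ Zs ↔ u ∈ family D := by
    intro u; simp [hZs, family]
  have hinr : ∀ u : M.Var, (Sum.inr u : M.Var ⊕ M.Var) ∉ Zs := by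
    intro u; simp [hZs]
  let Us : Set (M.Var ⊕ M.Var) := Sum.inl '' affected D
  -- The ancestral set of the family of `D` and the affected utilities. Everything outside is
  -- marginalised out, so each remaining family lies in this set and any two of its members are
  -- moral neighbours.
  let An : Set M.Var := {v | (∃ z ∈ family D, Relation.ReflTransGen M.Edge v z) ∨
    ∃ u ∈ affected D, Relation.ReflTransGen M.Edge v u}
  have hAn : ∀ u v, M.Edge u v → v ∈ An → u ∈ An := by
    rintro u v e (⟨z, hz, h⟩ | ⟨z, hz, h⟩)
    · exact .inl ⟨z, hz, .head e h⟩
    · exact .inr ⟨z, hz, .head e h⟩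
  have hAnE : ∀ v ∈ An, (∃ d ∈ Zs, Relation.ReflTransGen E (.inl v) d) ∨
      ∃ u ∈ Us, Relation.ReflTransGen E (.inl v) u := by
    rintro v (⟨z, hz, h⟩ | ⟨z, hz, h⟩)
    · exact .inl ⟨.inl z, memZ.2 hz, reflTransGen_indepMechEdge h⟩
    · exact .inr ⟨.inl z, ⟨z, hz, rfl⟩, reflTransGen_indepMechEdge h⟩
  have hno : ∀ V ∈ bad, ∀ u ∈ Us, ¬ ActivelyLinked E Zs (.inr V) u := by
    rintro V hV _ ⟨u, hu, rfl⟩ h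
    exact hbad V hV (sReachable_of_linked hu h)
  -- The variables, outside the family of `D`, to which a bad mechanism is actively linked. By
  -- hypothesis no affected utility is among them.
  let X : Set M.Var := {w | w ∉ family D ∧ ∃ V ∈ bad, ActivelyLinked E Zs (.inr V) (.inl w)}
  have hXU : ∀ u ∈ affected D, u ∉ X := fun u hu ⟨_, V, hV, h⟩ => hno V hV _ ⟨u, hu, rfl⟩ h
  have hXZ : ∀ u ∈ family D, u ∉ X := fun u hu h => h.1 hu
  let fam : M.Var → M.Var → Prop := fun w v => w = v ∨ M.Edge w v
  have famE : ∀ {w v}, fam w v → (Sum.inl w : M.Var ⊕ M.Var) = .inl v ∨ E (.inl w) (.inl v) := by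
    rintro w v (rfl | h)
    · exact .inl rfl
    · exact .inr h
  have spread : ∀ v ∈ An, ∀ w ∈ X, fam w v → ∀ w', fam w' v → w' ∉ family D → w' ∈ X := by
    rintro v hv w ⟨hw, V, hV, hl⟩ hwv w' hw' hZ
    exact ⟨hZ, V, hV, hl.spread indepMechEdge_asymm (hno V hV) (famE hwv) (famE hw')
      (fun h => hZ (memZ.1 h)) (hAnE v hv)⟩
  -- The trail may start at the mechanism itself, which is a parent of its variable and never
  -- observed; so the unobserved members of the family of a bad variable lie in `X`.
  have spread' : ∀ v ∈ An, v ∈ bad → ∀ w', fam w' v → w' ∉ family D → w' ∈ X := by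
    rintro v hv hvb w' hw' hZ
    exact ⟨hZ, v, hvb, (ActivelyLinked.refl (hinr v)).spread indepMechEdge_asymm (hno v hvb)
      (.inr (show E (.inr v) (.inl v) from rfl)) (famE hw') (fun h => hZ (memZ.1 h)) (hAnE v hv)⟩
  have hDAn : D.1 ∈ An := .inl ⟨D.1, .inl rfl, .refl⟩
  have hpaAn : ∀ u, M.Edge u D.1 → u ∈ An := fun u hu => hAn u _ hu hDAn
  -- The factors that may change or involve `X`. By `spread` and `spread'` their families lie in `X`
  -- and the observed variables. The remaining factors avoid `X` and are the same for `π` and `π'`.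
  let A₁ : Finset M.Var := Finset.univ.filter fun v => v ∈ An ∧ (v ∈ bad ∨ ∃ w ∈ X, fam w v)
  let φ : M.Profile ℝ → M.Outcome → M.Var → ℝ := fun σ a v =>
    if v ∈ An then M.condProb (always σ D d) v (M.ctx v a) (a v) else (M.card v : ℝ)⁻¹
  let A : M.Profile ℝ → M.Outcome → ℝ := fun σ a => ∏ v ∈ A₁, φ σ a v
  let B : (M.Outcome → ℝ) → M.Profile ℝ → M.Outcome → ℝ := fun f σ a =>
    f a * ∏ v ∈ Finset.univ.filter (· ∉ A₁), φ σ a v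
  -- On `S` the family of `D` is frozen, so the `A` part depends on the coordinates in `X` only and
  -- the `B` part on the others only.
  let S : Finset M.Outcome := Finset.univ.filter fun a => M.ctx D.1 a = c ∧ a D.1 = d
  have memS : ∀ {a}, a ∈ S ↔ M.ctx D.1 a = c ∧ a D.1 = d := by intro a; simp [S]
  have agreeZ : ∀ a ∈ S, ∀ b ∈ S, ∀ v ∈ family D, a v = b v := by
    rintro a ha b hb v (rfl | ⟨j, rfl⟩)
    · rw [(memS.1 ha).2, (memS.1 hb).2]
    · exact congrFun ((memS.1 ha).1.trans (memS.1 hb).1.symm) j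
  let mix : M.Outcome → M.Outcome → M.Outcome := fun a b v => if v ∈ X then a v else b v
  have mixX : ∀ a b v, v ∈ X → mix a b v = a v := fun a b v h => if_pos h
  have mixN : ∀ a b v, v ∉ X → mix a b v = b v := fun a b v h => if_neg h
  have mixXZ : ∀ a ∈ S, ∀ b ∈ S, ∀ v, v ∈ X ∨ v ∈ family D → mix a b v = a v := by
    rintro a ha b hb v (h | h)
    · exact mixX a b v h
    · rw [mixN a b v (hXZ v h)]; exact agreeZ b hb a ha v h
  have hS : ∀ a ∈ S, ∀ b ∈ S, mix a b ∈ S := by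
    intro a ha b hb
    refine memS.2 ⟨?_, ?_⟩
    · rw [← (memS.1 hb).1]
      exact ctx_congr fun u hu => mixN a b u (hXZ u (.inr hu))
    · rw [← (memS.1 hb).2]; exact mixN a b _ (hXZ _ (.inl rfl))
  have hA : ∀ σ, ∀ a ∈ S, ∀ b ∈ S, A σ (mix a b) = A σ a := by
    intro σ a ha b hb
    refine Finset.prod_congr rfl fun v hv => ?_
    obtain ⟨hvA, hv⟩ := (Finset.mem_filter.1 hv).2
    have hfam : ∀ w, fam w v → mix a b w = a w := by
      intro w hw
      refine mixXZ a ha b hb w ?_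
      by_cases hZ : w ∈ family D
      · exact .inr hZ
      · rcases hv with hv | ⟨w', hw', hf⟩
        · exact .inl (spread' v hvA hv w hw hZ)
        · exact .inl (spread v hvA w' hw' hf w hw hZ)
    simp only [φ, if_pos hvA]
    rw [ctx_congr (a := mix a b) (b := a) fun u hu => hfam u (.inr hu), hfam v (.inl rfl)]
  have hB : ∀ f : M.Outcome → ℝ, (∀ a b, f (mix a b) = f b) → ∀ σ, ∀ a ∈ S, ∀ b ∈ S,
      B f σ (mix a b) = B f σ b := by
    intro f hf σ a ha b hb
    simp only [B]
    rw [hf]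
    congr 1
    refine Finset.prod_congr rfl fun v hv => ?_
    simp only [φ]
    split
    · rename_i hvA
      have hfam : ∀ w, fam w v → mix a b w = b w := fun w hw => mixN a b w fun hX =>
        (Finset.mem_filter.1 hv).2 (Finset.mem_filter.2
          ⟨Finset.mem_univ _, hvA, .inr ⟨w, hX, hw⟩⟩)
      rw [ctx_congr (a := mix a b) (b := b) fun u hu => hfam u (.inr hu), hfam v (.inl rfl)]
    · rfl
  have hBB : ∀ f a, B f π a = B f π' a := by
    intro f a
    simp only [B]
    congr 1
    refine Finset.prod_congr rfl fun v hv => ?_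
    simp only [φ]
    split
    · rename_i hvA
      by_cases h : v = D.1
      · subst h
        rw [condProb_always, condProb_always]
      · rw [condProb_always_of_ne _ _ _ h, condProb_always_of_ne _ _ _ h, hπ v fun hb =>
          (Finset.mem_filter.1 hv).2 (Finset.mem_filter.2 ⟨Finset.mem_univ _, hvA, .inl hb⟩)]
    · rfl
  have key : ∀ (σ : M.Profile ℝ) (f : M.Outcome → ℝ), (∀ a b, (∀ v ∈ An, a v = b v) → f a = f b) →
      partialMean σ D c d f = ∑ a ∈ S, A σ a * B f σ a := by
    intro σ f hf
    rw [partialMean, sum_mul_jointProb _ An hAn, Finset.sum_filter]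
    · refine Finset.sum_congr rfl fun a _ => ?_
      by_cases h1 : M.ctx D.1 a = c
      · by_cases h2 : a D.1 = d
        · rw [if_pos h1, if_pos ⟨h1, h2⟩]
          simp only [A, B]
          rw [mul_left_comm]
          congr 1
          rw [← Finset.prod_filter_mul_prod_filter_not Finset.univ (· ∈ A₁)]
          congr 1
          refine Finset.prod_congr (by ext; simp) fun v _ => rfl
        · rw [if_pos h1, if_neg fun h : _ ∧ _ => h2 h.2, Finset.prod_eq_zero (Finset.mem_univ D.1),
            mul_zero]
          rw [if_pos hDAn, condProb_always, if_neg h2]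
      · rw [if_neg h1, if_neg fun h : _ ∧ _ => h1 h.1, zero_mul]
    · intro a b h
      rw [hf a b h, ctx_congr fun u hu => h u (hpaAn u hu)]
  have hU : ∀ a b : M.Outcome, (∀ v ∈ affected D, a v = b v) →
      affectedUtility D a = affectedUtility D b := by
    intro a b h
    refine Finset.sum_congr rfl fun v _ => ?_
    split
    · rename_i hv; rw [h v hv]
    · rfl
  have k1 := fun σ => key σ (affectedUtility D) fun a b h =>
    hU a b fun v hv => h v (.inr ⟨v, hv, .refl⟩)
  have k2 := fun σ => key σ 1 fun a b _ => rfl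
  rw [gain, gain, k1, k1, k2, k2]
  have hBU := hB (affectedUtility D) fun a b => hU _ _ fun v hv => mixN a b v (hXU v hv)
  have hB1 := hB 1 fun a b => rfl
  -- The affected utility belongs to the `B` part, so the change of profile acts on the gain and on
  -- the probability of the context through the same `A` part.
  have := sum_mul_sum_exchange X S (A π) (A π') (B (affectedUtility D) π) (B 1 π) hS (hA π) (hA π')
    (hBU π) (hB1 π)
  simp only [hBB] at this ⊢
  exact this

/-- The probability of a context of `D` does not depend on the decision rule at `D`. -/
theorem partialMean_one_eq (π : M.Profile ℝ) (D : M.Decision) (c : M.Ctx D.1)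
    (d d' : Fin (M.card D.1)) : partialMean π D c d 1 = partialMean π D c d' 1 := by
  classical
  have hT : ∀ u v, M.Edge u v → v ∈ {v | Relation.TransGen M.Edge v D.1} →
      u ∈ {v | Relation.TransGen M.Edge v D.1} := fun u v e h => .head e h
  have hf : ∀ a b : M.Outcome, (∀ v ∈ {v | Relation.TransGen M.Edge v D.1}, a v = b v) →
      (if M.ctx D.1 a = c then (1 : M.Outcome → ℝ) a else 0) =
        if M.ctx D.1 b = c then (1 : M.Outcome → ℝ) b else 0 := by
    intro a b h
    rw [ctx_congr fun u hu => h u (.single hu)]; rfl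
  rw [partialMean, partialMean, sum_mul_jointProb _ _ hT _ hf, sum_mul_jointProb _ _ hT _ hf]
  refine Finset.sum_congr rfl fun a _ => ?_
  congr 1
  refine Finset.prod_congr rfl fun v _ => ?_
  split
  · rename_i hv
    have : v ≠ D.1 := fun h => M.acyclic v (by
      have h' : Relation.TransGen M.Edge v D.1 := hv
      rw [← h] at h'; exact h')
    rw [condProb_always_of_ne _ _ _ this, condProb_always_of_ne _ _ _ this]
  · rfl

theorem partialMean_one_nonneg (π : M.Profile ℝ) (D : M.Decision) (c : M.Ctx D.1)
    (d : Fin (M.card D.1)) : 0 ≤ partialMean π D c d 1 :=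
  Finset.sum_nonneg fun a _ => mul_nonneg (by split <;> simp) (jointProb_nonneg _ _)

theorem gain_eq_zero {π : M.Profile ℝ} {D : M.Decision} {c : M.Ctx D.1} {d : Fin (M.card D.1)}
    (h : partialMean π D c d 1 = 0) : gain π D c d = 0 := by
  refine Finset.sum_eq_zero fun a _ => ?_
  have := (Finset.sum_eq_zero_iff_of_nonneg fun a _ =>
    mul_nonneg (by split <;> simp) (jointProb_nonneg _ _)).1 h a (Finset.mem_univ a)
  by_cases hc : M.ctx D.1 a = c
  · rw [if_pos hc] at this ⊢
    simp only [Pi.one_apply, one_mul] at this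
    rw [this, mul_zero]
  · rw [if_neg hc, zero_mul]

/-- Profiles with the same supports. -/
def SameSupport (π π' : M.Profile ℝ) : Prop :=
  ∀ D c x, (π D c).1 x = 0 ↔ (π' D c).1 x = 0

theorem SameSupport.symm {π π' : M.Profile ℝ} (h : SameSupport π π') : SameSupport π' π :=
  fun D c x => (h D c x).symm

theorem SameSupport.condProb_eq_zero {π π' : M.Profile ℝ} (h : SameSupport π π') (v : M.Var)
    (c : M.Ctx v) (x : Fin (M.card v)) (h0 : M.condProb π v c x = 0) : M.condProb π' v c x = 0 := by
  by_cases hv : (M.owner v).isSome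
  · have e := fun σ : M.Profile ℝ => condProb_of_decision σ ⟨v, hv⟩ c x
    rw [e] at h0 ⊢
    exact (h ⟨v, hv⟩ c x).1 h0
  · rwa [condProb_congr (π' := π) v fun h => absurd h hv]

theorem SameSupport.always {π π' : M.Profile ℝ} (h : SameSupport π π') (D : M.Decision)
    (d : Fin (M.card D.1)) : SameSupport (always π D d) (always π' D d) := by
  intro D' c x
  by_cases hD : D' = D
  · subst hD; simp [MAID.always]
  · simp [MAID.always, Function.update_of_ne hD, h D' c x]

theorem SameSupport.partialMean_eq_zero {π π' : M.Profile ℝ} (h : SameSupport π π') {D : M.Decision}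
    {c : M.Ctx D.1} {d : Fin (M.card D.1)} (h0 : partialMean π D c d 1 = 0) :
    partialMean π' D c d 1 = 0 := by
  refine Finset.sum_eq_zero fun a _ => ?_
  have := (Finset.sum_eq_zero_iff_of_nonneg fun a _ =>
    mul_nonneg (by split <;> simp) (jointProb_nonneg _ _)).1 h0 a (Finset.mem_univ a)
  rcases mul_eq_zero.1 this with h1 | h1
  · rw [h1, zero_mul]
  · obtain ⟨v, hv, h2⟩ := Finset.prod_eq_zero_iff.1 h1
    rw [jointProb, Finset.prod_eq_zero hv ((h.always D d).condProb_eq_zero _ _ _ h2), mul_zero]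

/-- Between profiles of equal support that agree on the decisions whose mechanism is s-reachable
from `D`, the gains at `D` in a context differ by a positive factor. -/
theorem exists_gain_eq_mul {π π' : M.Profile ℝ} (hs : SameSupport π π') {D : M.Decision}
    (h : ∀ D', D' ≠ D → M.SReachable D'.1 D → π D' = π' D') (c : M.Ctx D.1) :
    ∃ t : ℝ, 0 < t ∧ ∀ d, gain π' D c d = t * gain π D c d := by
  classical
  -- In a context of probability zero all gains vanish and any positive factor does. Otherwise the
  -- factor is the quotient of the probabilities of the context, which do not depend on the choice
  -- `d`.
  by_cases h0 : ∀ d, partialMean π D c d 1 = 0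
  · exact ⟨1, one_pos, fun d => by
      rw [gain_eq_zero (h0 d), gain_eq_zero (hs.partialMean_eq_zero (h0 d)), mul_zero]⟩
  · push Not at h0
    obtain ⟨e, he⟩ := h0
    have hpos : ∀ d, 0 < partialMean π D c d 1 := fun d =>
      (partialMean_one_nonneg _ _ _ _).lt_of_ne (by rw [partialMean_one_eq π D c d e]; exact he.symm)
    have hpos' : ∀ d, 0 < partialMean π' D c d 1 := fun d =>
      (partialMean_one_nonneg _ _ _ _).lt_of_ne fun h =>
        (hpos d).ne' (hs.symm.partialMean_eq_zero h.symm)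
    refine ⟨partialMean π' D c e 1 / partialMean π D c e 1, div_pos (hpos' e) (hpos e), fun d => ?_⟩
    -- The two given rules at `D` may differ, although `D` is not counted as bad. They may be made
    -- equal, since `always` overwrites the rule at `D` anyway.
    let π'' : M.Profile ℝ := Function.update π' D (π D)
    let bad : Set M.Var := {v | v ≠ D.1 ∧ ¬ M.SReachable v D}
    have hg : ∀ f, partialMean π'' D c d f = partialMean π' D c d f := fun f => by
      simp [partialMean, always, π'']
    have := partialMean_mul_partialMean (π := π) (π' := π'') (D := D) bad
      (fun v hv => hv.2) (fun v hv => condProb_congr v fun hv' => ?_) c d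
    · rw [gain, gain, hg, hg, ← gain, ← gain] at this
      rw [partialMean_one_eq π' D c e d, partialMean_one_eq π D c e d]
      have := (hpos d).ne'
      field_simp
      linarith
    · by_cases hvD : v = D.1
      · have : (⟨v, hv'⟩ : M.Decision) = D := Subtype.ext hvD
        rw [this]; simp [π'']
      · have : (⟨v, hv'⟩ : M.Decision) ≠ D := fun h => hvD (congrArg Subtype.val h)
        simp only [π'', Function.update_of_ne this]
        refine h _ this ?_
        by_contra hr
        exact hv ⟨hvD, hr⟩

end MAID

/-! ### Bounds and common denominators -/

theorem abs_prod_sub_prod_le {ι : Type} (s : Finset ι) (f g : ι → ℝ) {ε : ℝ}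
    (hf : ∀ i ∈ s, 0 ≤ f i ∧ f i ≤ 1) (hg : ∀ i ∈ s, 0 ≤ g i ∧ g i ≤ 1)
    (h : ∀ i ∈ s, |f i - g i| ≤ ε) : |∏ i ∈ s, f i - ∏ i ∈ s, g i| ≤ s.card * ε := by
  classical
  induction s using Finset.induction_on with
  | empty => simp
  | insert a s ha ih =>
    rw [Finset.prod_insert ha, Finset.prod_insert ha, Finset.card_insert_of_notMem ha]
    have h1 := ih (fun i hi => hf i (Finset.mem_insert_of_mem hi))
      (fun i hi => hg i (Finset.mem_insert_of_mem hi)) fun i hi => h i (Finset.mem_insert_of_mem hi)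
    have h2 := h a (Finset.mem_insert_self a s)
    have hfa := hf a (Finset.mem_insert_self a s)
    have h3 : 0 ≤ ∏ i ∈ s, g i := Finset.prod_nonneg fun i hi => (hg i (Finset.mem_insert_of_mem hi)).1
    have h4 : ∏ i ∈ s, g i ≤ 1 := Finset.prod_le_one
      (fun i hi => (hg i (Finset.mem_insert_of_mem hi)).1) fun i hi => (hg i (Finset.mem_insert_of_mem hi)).2
    have e : f a * ∏ i ∈ s, f i - g a * ∏ i ∈ s, g i =
        f a * (∏ i ∈ s, f i - ∏ i ∈ s, g i) + (f a - g a) * ∏ i ∈ s, g i := by ring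
    rw [e]
    refine (abs_add_le _ _).trans ?_
    rw [abs_mul, abs_mul, abs_of_nonneg hfa.1, abs_of_nonneg h3]
    have h5 := mul_le_of_le_one_left (abs_nonneg (∏ i ∈ s, f i - ∏ i ∈ s, g i)) hfa.2
    have h6 := mul_le_of_le_one_right (abs_nonneg (f a - g a)) h4
    push_cast
    linarith

namespace TreeData

theorem sum_size_le {n : ℕ} (F : Fin n → TreeData) :
    ∑ i, (F i).size ≤ (ofList ((List.finRange n).map F)).size := by
  rw [size_ofList, List.map_map, Fin.sum_univ_def]
  refine (List.sum_le_sum fun i _ => ?_).trans (Nat.le_succ _)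
  exact Nat.le_succ _

theorem lt_two_pow_size_ofNat (n : ℕ) : n < 2 ^ (ofNat n).size := by
  refine (Nat.lt_size_self n).trans_le (Nat.pow_le_pow_right (by norm_num) ?_)
  rw [← Nat.size_eq_bits_len]
  simpa [ofNat] using length_le_size_ofList (n.bits.map ofBool)

theorem den_le (q : ℚ) : q.den ≤ 2 ^ (ofRat q).size := by
  refine (lt_two_pow_size_ofNat _).le.trans (Nat.pow_le_pow_right (by norm_num) ?_)
  simp only [ofRat, size]; omega

theorem natAbs_num_le (q : ℚ) : q.num.natAbs ≤ 2 ^ (ofRat q).size := by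
  refine (lt_two_pow_size_ofNat _).le.trans (Nat.pow_le_pow_right (by norm_num) ?_)
  simp only [ofRat, ofInt, size]; omega

theorem abs_le_two_pow (q : ℚ) : |q| ≤ 2 ^ (ofRat q).size := by
  have h1 : |q| ≤ |(q.num : ℚ)| := by
    conv_lhs => rw [← Rat.num_div_den q]
    rw [abs_div]
    refine div_le_self (abs_nonneg _) ?_
    rw [abs_of_nonneg (by positivity)]
    exact_mod_cast q.pos
  refine h1.trans ?_
  have := natAbs_num_le q
  rw [← Int.cast_abs, Int.abs_eq_natAbs]
  exact_mod_cast this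

end TreeData

namespace MAID

variable {M : MAID}

theorem sum_size_le_codeTable (v : M.Var) (g : M.Ctx v → TreeData) :
    ∑ c, (g c).size ≤ (M.codeTable v g).size := by
  rw [← Equiv.sum_comp finPiFinEquiv.symm]
  exact sum_size_le fun m => g (finPiFinEquiv.symm m)

theorem sum_size_codeVar_le (M : MAID) : ∑ v, (M.codeVar v).size ≤ M.code.size := by
  refine (sum_size_le M.codeVar).trans ?_
  rw [code_eq]; simp only [size]; omega

theorem numVars_le_size (M : MAID) : M.numVars ≤ M.code.size := by
  have h : ∑ v : M.Var, 1 ≤ ∑ v, (M.codeVar v).size := Finset.sum_le_sum fun v _ => size_pos _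
  simp only [Finset.sum_const, Finset.card_univ, Fintype.card_fin, smul_eq_mul, mul_one] at h
  exact h.trans M.sum_size_codeVar_le

theorem size_codeMech_le (v : M.Var) : (M.codeMech v).size ≤ (M.codeVar v).size := by
  simp only [codeVar, ofList, size]; omega

/-- A common denominator of the numbers specified at `v`. -/
def den (M : MAID) (v : M.Var) : ℕ :=
  match M.mech v with
  | .chance cpd => ∏ c, ∏ x, ((cpd c).1 x).den
  | .decision _ => 1
  | .utility _ _ val => ∏ x, (val x).den

/-- The product of all denominators, crude as it is, has logarithm at most the sum of the code sizes
of the entries, and all entries are listed in the code. -/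
theorem den_le_two_pow (v : M.Var) : M.den v ≤ 2 ^ (M.codeMech v).size := by
  unfold den codeMech
  cases M.mech v with
  | chance cpd =>
    calc _ ≤ ∏ c, ∏ x, 2 ^ (ofRat ((cpd c).1 x)).size :=
          Finset.prod_le_prod' fun c _ => Finset.prod_le_prod' fun x _ => den_le _
      _ = 2 ^ ∑ c, ∑ x, (ofRat ((cpd c).1 x)).size := by
          simp only [Finset.prod_pow_eq_pow_sum]
      _ ≤ _ := by
          refine Nat.pow_le_pow_right (by norm_num) ?_
          have h1 := sum_size_le_codeTable v fun c => codeDist (cpd c)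
          have h2 : ∑ c, ∑ x, (ofRat ((cpd c).1 x)).size ≤ ∑ c, (codeDist (cpd c)).size :=
            Finset.sum_le_sum fun c _ => sum_size_le _
          refine h2.trans (h1.trans ?_)
          simp only [size]; omega
  | decision i => exact Nat.one_le_two_pow
  | utility i f val =>
    calc _ ≤ ∏ x, 2 ^ (ofRat (val x)).size := Finset.prod_le_prod' fun x _ => den_le _
      _ = 2 ^ ∑ x, (ofRat (val x)).size := by simp only [Finset.prod_pow_eq_pow_sum]
      _ ≤ _ := by
          refine Nat.pow_le_pow_right (by norm_num) ?_
          have h1 := sum_size_le fun x => ofRat (val x)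
          simp only [size, ofList]; omega

theorem den_pos (v : M.Var) : 0 < M.den v := by
  unfold den
  cases M.mech v with
  | chance cpd => exact Finset.prod_pos fun c _ => Finset.prod_pos fun x _ => Rat.den_pos _
  | decision i => exact one_pos
  | utility i f val => exact Finset.prod_pos fun x _ => Rat.den_pos _

theorem prod_den_le (M : MAID) : ∏ v, M.den v ≤ 2 ^ M.code.size := by
  calc _ ≤ ∏ v, 2 ^ (M.codeVar v).size := Finset.prod_le_prod' fun v _ =>
        (den_le_two_pow v).trans (Nat.pow_le_pow_right (by norm_num) (size_codeMech_le v))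
    _ = 2 ^ ∑ v, (M.codeVar v).size := by simp only [Finset.prod_pow_eq_pow_sum]
    _ ≤ _ := Nat.pow_le_pow_right (by norm_num) M.sum_size_codeVar_le

theorem card_outcome_le (M : MAID) : Fintype.card M.Outcome ≤ 2 ^ M.code.size := by
  rw [Fintype.card_pi]
  calc _ ≤ ∏ v, 2 ^ (M.codeVar v).size := Finset.prod_le_prod' fun v _ => by
        rw [Fintype.card_fin]
        refine Nat.lt_two_pow_self.le.trans (Nat.pow_le_pow_right (by norm_num) ?_)
        simp [codeVar, ofList, size, size_ofIndex]; omega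
    _ = 2 ^ ∑ v, (M.codeVar v).size := by simp only [Finset.prod_pow_eq_pow_sum]
    _ ≤ _ := Nat.pow_le_pow_right (by norm_num) M.sum_size_codeVar_le

theorem abs_utilityValue_le (i : Fin M.numAgents) (v : M.Var) (x : Fin (M.card v)) :
    |M.utilityValue i v x| ≤ 2 ^ M.code.size := by
  cases h : M.mech v with
  | utility j f val =>
    have e : M.utilityValue i v x = if j = i then ((val x : ℚ) : ℝ) else 0 := by
      unfold utilityValue; rw [h]
    rw [e]
    split
    · have h1 : |((val x : ℚ) : ℝ)| ≤ 2 ^ (ofRat (val x)).size := by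
        exact_mod_cast abs_le_two_pow (val x)
      refine h1.trans (pow_le_pow_right₀ (by norm_num) ?_)
      refine le_trans ?_ ((size_codeMech_le v).trans (M.size_codeVar_le v))
      have h2 := Finset.single_le_sum (f := fun x => (ofRat (val x)).size) (fun _ _ => Nat.zero_le _)
        (Finset.mem_univ x)
      have h3 := sum_size_le fun x => ofRat (val x)
      unfold codeMech
      rw [h]
      simp only [size, ofList] at h2 h3 ⊢
      omega
    · simp
  | _ =>
    have e : M.utilityValue i v x = 0 := by unfold utilityValue; rw [h]
    rw [e]; simp

theorem abs_affectedUtility_le (D : M.Decision) (a : M.Outcome) :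
    |affectedUtility D a| ≤ 2 ^ (2 * M.code.size) := by
  have h : |affectedUtility D a| ≤ ∑ v : M.Var, (2 : ℝ) ^ M.code.size := by
    refine (Finset.abs_sum_le_sum_abs _ _).trans (Finset.sum_le_sum fun v _ => ?_)
    split
    · exact abs_utilityValue_le _ _ _
    · simp
  refine h.trans ?_
  rw [Finset.sum_const, Finset.card_univ, Fintype.card_fin, nsmul_eq_mul, two_mul, pow_add]
  refine mul_le_mul_of_nonneg_right ?_ (by positivity)
  exact_mod_cast M.numVars_le_size.trans Nat.lt_two_pow_self.le

/-- The integers, as a subring of the reals. -/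
abbrev integers : Subring ℝ := (Int.castRingHom ℝ).range

theorem natCast_mem_integers (n : ℕ) : (n : ℝ) ∈ integers := ⟨n, by simp⟩

theorem ratCast_mul_mem_integers {q : ℚ} {n : ℕ} (h : q.den ∣ n) : ((q : ℚ) : ℝ) * n ∈ integers := by
  obtain ⟨m, rfl⟩ := h
  refine ⟨q.num * m, ?_⟩
  have h1 : q * q.den = q.num := Rat.mul_den_eq_num q
  have h2 : ((q : ℚ) : ℝ) * q.den = q.num := by exact_mod_cast h1
  push_cast
  rw [← mul_assoc, h2]; simp

theorem condProb_mul_mem_integers {π : M.Profile ℝ} {E : ℕ}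
    (hπ : ∀ D c x, (π D c).1 x * 2 ^ E ∈ integers) (v : M.Var) (c : M.Ctx v) (x : Fin (M.card v)) :
    M.condProb π v c x * (M.den v * 2 ^ E) ∈ integers := by
  have h2 : (2 : ℝ) ^ E ∈ integers := by exact_mod_cast natCast_mem_integers (2 ^ E)
  cases h : M.mech v with
  | chance cpd =>
    rw [condProb_of_chance π h, ← mul_assoc]
    refine mul_mem (ratCast_mul_mem_integers ?_) h2
    unfold den
    rw [h]
    exact (Finset.dvd_prod_of_mem (fun x => ((cpd c).1 x).den) (Finset.mem_univ x)).trans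
      (Finset.dvd_prod_of_mem (fun c => ∏ x, ((cpd c).1 x).den) (Finset.mem_univ c))
  | decision i =>
    have hv : (M.owner v).isSome := by simp [owner, h]
    rw [condProb_of_decision π ⟨v, hv⟩, mul_left_comm]
    exact mul_mem (natCast_mem_integers _) (hπ _ _ _)
  | utility i f val =>
    rw [condProb_of_utility π h]
    refine mul_mem ?_ (mul_mem (natCast_mem_integers _) h2)
    split
    · exact one_mem _
    · exact zero_mem _

theorem jointProb_mul_mem_integers {π : M.Profile ℝ} {E : ℕ}
    (hπ : ∀ D c x, (π D c).1 x * 2 ^ E ∈ integers) (a : M.Outcome) :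
    M.jointProb π a * ((∏ v, M.den v : ℕ) * 2 ^ (E * M.numVars)) ∈ integers := by
  have : M.jointProb π a * ((∏ v, M.den v : ℕ) * 2 ^ (E * M.numVars)) =
      ∏ v, M.condProb π v (M.ctx v a) (a v) * (M.den v * 2 ^ E) := by
    rw [Finset.prod_mul_distrib, Finset.prod_mul_distrib, Finset.prod_const, Finset.card_univ,
      Fintype.card_fin, pow_mul, Nat.cast_prod]
    rfl
  rw [this]
  exact prod_mem fun v _ => condProb_mul_mem_integers hπ v _ _

theorem utilityValue_mul_mem_integers (i : Fin M.numAgents) (v : M.Var) (x : Fin (M.card v)) :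
    M.utilityValue i v x * (∏ v, M.den v : ℕ) ∈ integers := by
  cases h : M.mech v with
  | utility j f val =>
    have e : M.utilityValue i v x = if j = i then ((val x : ℚ) : ℝ) else 0 := by
      unfold utilityValue; rw [h]
    rw [e]
    split
    · refine ratCast_mul_mem_integers (Dvd.dvd.trans ?_
        (Finset.dvd_prod_of_mem M.den (Finset.mem_univ v)))
      unfold den
      rw [h]
      exact Finset.dvd_prod_of_mem (fun x => (val x).den) (Finset.mem_univ x)
    · rw [zero_mul]; exact zero_mem _
  | _ =>
    have e : M.utilityValue i v x = 0 := by unfold utilityValue; rw [h]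
    rw [e, zero_mul]; exact zero_mem _

/-- A common denominator for expected utilities, if all decision rules have denominator `2ᴱ`. -/
def denEU (M : MAID) (E : ℕ) : ℕ := (∏ v, M.den v) * ((∏ v, M.den v) * 2 ^ (E * M.numVars))

theorem denEU_pos (M : MAID) (E : ℕ) : 0 < M.denEU E := by
  have h : 0 < ∏ v, M.den v := Finset.prod_pos fun v _ => den_pos v
  unfold denEU
  positivity

theorem denEU_le (M : MAID) (E : ℕ) : M.denEU E ≤ 2 ^ (2 * M.code.size + E * M.code.size) := by
  calc M.denEU E ≤ 2 ^ M.code.size * (2 ^ M.code.size * 2 ^ (E * M.code.size)) :=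
        Nat.mul_le_mul M.prod_den_le (Nat.mul_le_mul M.prod_den_le
          (Nat.pow_le_pow_right (by norm_num) (Nat.mul_le_mul_left _ M.numVars_le_size)))
    _ = _ := by rw [← pow_add, ← pow_add]; congr 1; ring

/-- In `denEU` one product of the `den v` clears the utility values; the other, together with the
power of two, clears the joint probability. -/
theorem EU_mul_mem_integers {π : M.Profile ℝ} {E : ℕ}
    (hπ : ∀ D c x, (π D c).1 x * 2 ^ E ∈ integers) (i : Fin M.numAgents) :
    M.EU i π * M.denEU E ∈ integers := by
  rw [EU_eq_sum, Finset.sum_mul]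
  refine sum_mem fun v _ => ?_
  rw [Finset.sum_mul]
  refine sum_mem fun a _ => ?_
  have := mul_mem (utilityValue_mul_mem_integers i v (a v)) (jointProb_mul_mem_integers hπ a)
  convert this using 1
  rw [denEU]; push_cast; ring

theorem gain_mul_mem_integers {π : M.Profile ℝ} {E : ℕ}
    (hπ : ∀ D c x, (π D c).1 x * 2 ^ E ∈ integers) (D : M.Decision) (c : M.Ctx D.1)
    (d : Fin (M.card D.1)) : gain π D c d * M.denEU E ∈ integers := by
  have hπ' : ∀ D' c x, (always π D d D' c).1 x * 2 ^ E ∈ integers := by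
    intro D' c x
    by_cases h : D' = D
    · subst h
      rw [always, Function.update_self, pointDist]
      refine mul_mem ?_ (by exact_mod_cast natCast_mem_integers (2 ^ E))
      simp only [Pi.single_apply]
      split
      · exact one_mem _
      · exact zero_mem _
    · rw [always, Function.update_of_ne h]; exact hπ D' c x
  rw [gain, partialMean, Finset.sum_mul]
  refine sum_mem fun a _ => ?_
  have h1 : (if M.ctx D.1 a = c then affectedUtility D a else 0) * (∏ v, M.den v : ℕ) ∈
      integers := by
    split
    · rw [affectedUtility, Finset.sum_mul]
      refine sum_mem fun v _ => ?_
      split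
      · exact utilityValue_mul_mem_integers _ _ _
      · rw [zero_mul]; exact zero_mem _
    · rw [zero_mul]; exact zero_mem _
  have := mul_mem h1 (jointProb_mul_mem_integers hπ' a)
  convert this using 1
  rw [denEU]; push_cast; ring

/-- Numbers with a common denominator that are close to each other are equal. -/
theorem le_of_sub_lt {x y : ℝ} {n : ℕ} (hn : 0 < n) (hx : x * n ∈ integers) (hy : y * n ∈ integers)
    {B : ℕ} (hB : n ≤ B) (h : x - y < 1 / B) : x ≤ y := by
  obtain ⟨a, ha⟩ := hx
  obtain ⟨b, hb⟩ := hy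
  simp only [eq_intCast] at ha hb
  have hn' : (0 : ℝ) < n := by exact_mod_cast hn
  have hB' : (n : ℝ) ≤ B := by exact_mod_cast hB
  by_contra hlt
  push Not at hlt
  have h1 : (b : ℝ) < a := by rw [ha, hb]; exact mul_lt_mul_of_pos_right hlt hn'
  have h2 : (b : ℝ) + 1 ≤ a := by exact_mod_cast h1
  have h3 : (x - y) * n < 1 := by
    calc (x - y) * n < 1 / B * n := mul_lt_mul_of_pos_right h hn'
      _ ≤ 1 / B * B := mul_le_mul_of_nonneg_left hB' (by positivity)
      _ = 1 := by rw [one_div, inv_mul_cancel₀]; linarith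
  rw [sub_mul, ← ha, ← hb] at h3
  linarith

theorem jointProb_le_one (π : M.Profile ℝ) (a : M.Outcome) : M.jointProb π a ≤ 1 :=
  Finset.prod_le_one (fun v _ => condProb_nonneg π v _ _) fun v _ => condProb_le_one π v _ _

theorem abs_EU_le (π : M.Profile ℝ) (i : Fin M.numAgents) :
    |M.EU i π| ≤ 2 ^ (3 * M.code.size) := by
  have h : |M.EU i π| ≤ ∑ v : M.Var, ∑ a : M.Outcome, (2 : ℝ) ^ M.code.size := by
    rw [EU_eq_sum]
    refine (Finset.abs_sum_le_sum_abs _ _).trans (Finset.sum_le_sum fun v _ => ?_)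
    refine (Finset.abs_sum_le_sum_abs _ _).trans (Finset.sum_le_sum fun a _ => ?_)
    rw [abs_mul, abs_of_nonneg (jointProb_nonneg π a)]
    exact (mul_le_of_le_one_right (abs_nonneg _) (jointProb_le_one π a)).trans
      (abs_utilityValue_le _ _ _)
  refine h.trans ?_
  simp only [Finset.sum_const, Finset.card_univ, nsmul_eq_mul, Fintype.card_fin]
  have h1 : (M.numVars : ℝ) ≤ 2 ^ M.code.size := by
    exact_mod_cast M.numVars_le_size.trans Nat.lt_two_pow_self.le
  have h2 : (Fintype.card M.Outcome : ℝ) ≤ 2 ^ M.code.size := by exact_mod_cast M.card_outcome_le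
  calc _ ≤ (2 : ℝ) ^ M.code.size * (2 ^ M.code.size * 2 ^ M.code.size) := by gcongr
    _ = _ := by ring

theorem abs_condProb_sub_le {π π' : M.Profile ℝ} {ε : ℝ} (hε : 0 ≤ ε)
    (h : ∀ D c x, |(π D c).1 x - (π' D c).1 x| ≤ ε) (v : M.Var) (c : M.Ctx v)
    (x : Fin (M.card v)) : |M.condProb π v c x - M.condProb π' v c x| ≤ ε := by
  by_cases hv : (M.owner v).isSome
  · have e := fun σ : M.Profile ℝ => condProb_of_decision σ ⟨v, hv⟩ c x
    rw [e, e]; exact h ⟨v, hv⟩ c x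
  · rw [condProb_congr (π := π) (π' := π') v fun h => absurd h hv]; simpa using hε

/-- With `L` the code size, the exponent `4 L` is made up of `L` for the number of outcomes, `2 L`
for the size of the utility, and `L` for the number of factors of the joint probability. -/
theorem abs_gain_sub_le {π π' : M.Profile ℝ} {ε : ℝ} (hε : 0 ≤ ε)
    (h : ∀ D c x, |(π D c).1 x - (π' D c).1 x| ≤ ε) (D : M.Decision) (c : M.Ctx D.1)
    (d : Fin (M.card D.1)) : |gain π D c d - gain π' D c d| ≤ 2 ^ (4 * M.code.size) * ε := by
  have h' : ∀ D' c x, |(always π D d D' c).1 x - (always π' D d D' c).1 x| ≤ ε := by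
    intro D' c x
    by_cases hD : D' = D
    · subst hD; simpa [always] using hε
    · simpa [always, Function.update_of_ne hD] using h D' c x
  have h1 : ∀ a, |M.jointProb (always π D d) a - M.jointProb (always π' D d) a| ≤
      2 ^ M.code.size * ε := by
    intro a
    refine (abs_prod_sub_prod_le _ _ _
      (fun v _ => ⟨condProb_nonneg _ v _ _, condProb_le_one _ v _ _⟩)
      (fun v _ => ⟨condProb_nonneg _ v _ _, condProb_le_one _ v _ _⟩)
      fun v _ => abs_condProb_sub_le hε h' v _ _).trans ?_
    refine mul_le_mul_of_nonneg_right ?_ hε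
    rw [Finset.card_univ, Fintype.card_fin]
    exact_mod_cast M.numVars_le_size.trans Nat.lt_two_pow_self.le
  have h2 : |gain π D c d - gain π' D c d| ≤
      ∑ a : M.Outcome, (2 : ℝ) ^ (2 * M.code.size) * (2 ^ M.code.size * ε) := by
    rw [gain, gain, partialMean, partialMean, ← Finset.sum_sub_distrib]
    refine (Finset.abs_sum_le_sum_abs _ _).trans (Finset.sum_le_sum fun a _ => ?_)
    rw [← mul_sub, abs_mul]
    refine mul_le_mul ?_ (h1 a) (abs_nonneg _) (by positivity)
    split
    · exact abs_affectedUtility_le D a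
    · simp
  refine h2.trans ?_
  rw [Finset.sum_const, Finset.card_univ, nsmul_eq_mul]
  have h3 : (Fintype.card M.Outcome : ℝ) ≤ 2 ^ M.code.size := by exact_mod_cast M.card_outcome_le
  calc _ ≤ (2 : ℝ) ^ M.code.size * (2 ^ (2 * M.code.size) * (2 ^ M.code.size * ε)) := by gcongr
    _ = _ := by ring

end MAID

/-! ### The response dynamics and its stationary profiles -/

namespace MAID

variable {M : MAID}

section firstMax

open Classical in
/-- The points where `g` is maximal. -/
noncomputable def maxima {n : ℕ} (g : Fin n → ℝ) : List (Fin n) :=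
  (List.finRange n).filter fun d => decide (∀ d', g d' ≤ g d)

theorem mem_maxima {n : ℕ} {g : Fin n → ℝ} {d : Fin n} : d ∈ maxima g ↔ ∀ d', g d' ≤ g d := by
  simp [maxima]

theorem maxima_ne_nil {n : ℕ} (hn : 2 ≤ n) (g : Fin n → ℝ) : maxima g ≠ [] := by
  have : Nonempty (Fin n) := ⟨⟨0, by omega⟩⟩
  obtain ⟨d, hd⟩ := Finite.exists_max g
  exact List.ne_nil_of_mem (mem_maxima.2 hd)

/-- The first point where `g` is maximal. -/
noncomputable def firstMax {n : ℕ} (hn : 2 ≤ n) (g : Fin n → ℝ) : Fin n :=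
  (maxima g).head (maxima_ne_nil hn g)

theorem le_firstMax {n : ℕ} (hn : 2 ≤ n) (g : Fin n → ℝ) (d : Fin n) : g d ≤ g (firstMax hn g) :=
  mem_maxima.1 (List.head_mem (maxima_ne_nil hn g)) d

theorem maxima_congr {n : ℕ} {g g' : Fin n → ℝ} (h : ∀ d d', g d' ≤ g d ↔ g' d' ≤ g' d) :
    maxima g = maxima g' := by
  simp [maxima, h]

/-- The tie-break is fixed, so the response depends only on the order of the gains, which a positive
factor preserves. An arbitrary choice among the maxima could keep the dynamics from settling. -/
theorem firstMax_congr {n : ℕ} (hn : 2 ≤ n) {g g' : Fin n → ℝ}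
    (h : ∀ d d', g d' ≤ g d ↔ g' d' ≤ g' d) : firstMax hn g = firstMax hn g' := by
  simp [firstMax, maxima_congr h]

end firstMax

/-- Everybody responds optimally to the trembling version of the given profile. -/
noncomputable def respond (M : MAID) (K : ℕ) (s : M.PureProfile) : M.PureProfile :=
  fun D c => firstMax (M.two_le_card D.1) (gain (M.realProfile (M.trembling K s)) D c)

/-- The mechanism of `D'` is s-reachable from the decision rule of `D`. -/
def Relevant (M : MAID) (D' D : M.Decision) : Prop := D' ≠ D ∧ M.SReachable D'.1 D

theorem trembling_pos (K : ℕ) (s : M.PureProfile) (D : M.Decision) (c : M.Ctx D.1)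
    (x : Fin (M.card D.1)) : 0 < (M.realProfile (M.trembling K s) D c).1 x := by
  have : (0 : ℝ) < (((tremble K (M.two_le_card D.1) (s D c)).1 x : ℚ) : ℝ) := by
    exact_mod_cast tremble_pos K (M.two_le_card D.1) (s D c) x
  exact this

/-- Any two trembling profiles have full support, so `exists_gain_eq_mul` applies: what happens at
irrelevant decisions rescales the gains in each context and leaves their order alone. -/
theorem respond_congr (K : ℕ) {s s' : M.PureProfile} {D : M.Decision}
    (h : ∀ D', M.Relevant D' D → s D' = s' D') : M.respond K s D = M.respond K s' D := by
  funext c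
  obtain ⟨t, ht, e⟩ := exists_gain_eq_mul (π := M.realProfile (M.trembling K s))
    (π' := M.realProfile (M.trembling K s')) (D := D)
    (fun D c x => by simp [(trembling_pos K _ D c x).ne'])
    (fun D' h1 h2 => by
      funext c
      simp only [realProfile, trembling, h D' ⟨h1, h2⟩]) c
  refine firstMax_congr _ fun d d' => ?_
  rw [e, e, mul_le_mul_iff_right₀ ht]

theorem wellFounded_relevant (hM : M.SufficientInformation) : WellFounded M.Relevant := by
  have : Std.Irrefl (Relation.TransGen M.Relevant) := ⟨hM⟩
  exact Subrelation.wf (r := Relation.TransGen M.Relevant) (fun h => .single h)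
    (Finite.wellFounded_of_trans_of_irrefl _)

/-- The response dynamics stops after as many rounds as there are variables. -/
theorem respond_iterate_numVars (hM : M.SufficientInformation) (K : ℕ) (s : M.PureProfile) :
    M.respond K ((M.respond K)^[M.numVars] s) = (M.respond K)^[M.numVars] s := by
  classical
  -- `T` consists of decisions that have settled by time `t`. A minimal unsettled decision sees only
  -- settled relevant ones and settles in the next round, so `T` grows until it is everything.
  have key : ∀ t, ∃ T : Finset M.Decision,
      (∀ D ∈ T, ∀ t' ≥ t, (M.respond K)^[t'] s D = (M.respond K)^[t] s D) ∧
      (t ≤ T.card ∨ T = Finset.univ) := by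
    intro t
    induction t with
    | zero => exact ⟨∅, by simp, .inl (Nat.zero_le _)⟩
    | succ t ih =>
      obtain ⟨T, hT, hc⟩ := ih
      have hT' : ∀ D ∈ T, ∀ t' ≥ t + 1, (M.respond K)^[t'] s D = (M.respond K)^[t + 1] s D :=
        fun D hD t' ht' => by rw [hT D hD t' (by omega), hT D hD (t + 1) (by omega)]
      by_cases hu : T = Finset.univ
      · exact ⟨T, hT', .inr hu⟩
      · obtain ⟨D, hD, hmin⟩ := (wellFounded_relevant hM).has_min {D | D ∉ T} (by
          by_contra h
          exact hu (Finset.eq_univ_iff_forall.2 (by simpa [Set.eq_empty_iff_forall_notMem,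
            Set.not_nonempty_iff_eq_empty] using h)))
        refine ⟨insert D T, ?_, .inl ?_⟩
        · intro D' hD' t' ht'
          rcases Finset.mem_insert.1 hD' with rfl | hD'
          · obtain ⟨u, rfl⟩ : ∃ u, t' = u + 1 := ⟨t' - 1, by omega⟩
            rw [Function.iterate_succ_apply', Function.iterate_succ_apply']
            exact respond_congr K fun D'' h => hT D'' (by
              by_contra h'; exact hmin D'' h' h) u (by omega)
          · exact hT' D' hD' t' ht'
        · rw [Finset.card_insert_of_notMem hD]
          rcases hc with hc | hc
          · omega
          · exact absurd hc hu
  obtain ⟨T, hT, hc⟩ := key M.numVars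
  have hu : T = Finset.univ := by
    rcases hc with hc | hc
    · refine Finset.eq_univ_of_card _ (le_antisymm (Finset.card_le_univ _) (le_trans ?_ hc))
      simpa using Fintype.card_subtype_le fun v : M.Var => ((M.owner v).isSome : Prop)
    · exact hc
  rw [← Function.iterate_succ_apply' (M.respond K)]
  funext D
  exact hT D (hu ▸ Finset.mem_univ D) _ (Nat.le_succ _)

/-- The choice `s` is optimal at `D` whatever is done at the decisions that are not relevant. -/
def Dominates (s : M.PureProfile) (D : M.Decision) : Prop :=
  ∀ π : M.Profile ℝ, (∀ D', M.Relevant D' D → π D' = s.toProfile D') →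
    ∀ c d, gain π D c d ≤ gain π D c (s D c)

/-- The deviation is undone one decision at a time, always at a decision whose relevant decisions
already follow `s`. By dominance no such step hurts the deviating agent; at decisions of the other
agents nothing changes. -/
theorem isNash_of_dominates (hM : M.SufficientInformation) {s : M.PureProfile}
    (h : ∀ D, Dominates s D) : M.IsNash s.toProfile := by
  classical
  intro i p
  set ρ := M.join p (M.others s.toProfile i) with hρ
  let mixed : Finset M.Decision → M.Profile ℝ := fun T D => if D ∈ T then s.toProfile D else ρ D
  suffices H : ∀ n (T : Finset M.Decision), Tᶜ.card = n → M.EU i (mixed T) ≤ M.EU i s.toProfile by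
    have := H _ ∅ rfl
    simpa [mixed] using this
  intro n
  induction n with
  | zero =>
    intro T hT
    have : T = Finset.univ := by
      rw [← compl_compl T, Finset.card_eq_zero.1 hT]; simp
    simp [mixed, this]
  | succ n ih =>
    intro T hT
    obtain ⟨D₀, hD₀⟩ : Tᶜ.Nonempty := Finset.card_pos.1 (by omega)
    obtain ⟨D, hD, hmin⟩ := (wellFounded_relevant hM).has_min {D | D ∉ T}
      ⟨D₀, by simpa using hD₀⟩
    have hD' : D ∉ T := hD
    refine le_trans ?_ (ih (insert D T) (by
      rw [Finset.card_compl] at hT ⊢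
      rw [Finset.card_insert_of_notMem hD']
      omega))
    have e1 : mixed (insert D T) = Function.update (mixed T) D (s.toProfile D) := by
      funext D'
      by_cases h1 : D' = D
      · subst h1; simp [mixed]
      · simp [mixed, h1]
    have e2 : mixed T = Function.update (mixed T) D (ρ D) := by
      rw [eq_comm, Function.update_eq_self_iff]; simp [mixed, hD']
    by_cases hi : M.owner D.1 = some i
    · have hi' : i = M.agent D := Option.some.inj (hi.symm.trans (M.owner_agent D))
      have h1 := EU_update_sub (mixed T) D (ρ D) (s.toProfile D)
      rw [← e1, ← e2, ← hi'] at h1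
      have h2 : ∑ c, ∑ d, ((ρ D c).1 d - (s.toProfile D c).1 d) * gain (mixed T) D c d ≤ 0 := by
        refine Finset.sum_nonpos fun c _ => ?_
        have hd := h D (mixed T) (fun D' hr => by
          have : D' ∈ T := by by_contra h'; exact hmin D' h' hr
          simp [mixed, this]) c
        have h3 : ∑ d, (ρ D c).1 d * gain (mixed T) D c d ≤
            ∑ d, (ρ D c).1 d * gain (mixed T) D c (s D c) :=
          Finset.sum_le_sum fun d _ => mul_le_mul_of_nonneg_left (hd d) ((ρ D c).2.1 d)
        have h4 : ∑ d, (s.toProfile D c).1 d * gain (mixed T) D c d = gain (mixed T) D c (s D c) := by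
          simp [PureProfile.toProfile, Pi.single_apply]
        have h5 : ∑ d, (ρ D c).1 d = 1 := (ρ D c).2.2
        rw [← Finset.sum_mul, h5, one_mul] at h3
        simp only [sub_mul, Finset.sum_sub_distrib, h4]
        linarith
      linarith
    · have : ρ D = s.toProfile D := by
        simp only [hρ, join, dif_neg hi, others]
      rw [e1, ← this, ← e2]

/-- A mixture of two distributions. -/
def mixDist {n : ℕ} (δ : Set.Icc (0 : ℝ) 1) (p q : stdSimplex ℝ (Fin n)) : stdSimplex ℝ (Fin n) :=
  ⟨fun x => (1 - δ.1) * p.1 x + δ.1 * q.1 x, fun x =>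
    add_nonneg (mul_nonneg (by linarith [δ.2.2]) (p.2.1 x)) (mul_nonneg δ.2.1 (q.2.1 x)), by
    rw [Finset.sum_add_distrib, ← Finset.mul_sum, ← Finset.mul_sum]
    have h1 : ∑ x, p.1 x = 1 := p.2.2
    have h2 : ∑ x, q.1 x = 1 := q.2.2
    rw [h1, h2]; ring⟩

theorem tendsto_gain {π : ℕ → M.Profile ℝ} {σ : M.Profile ℝ}
    (h : ∀ D c x, Tendsto (fun n => (π n D c).1 x) atTop (𝓝 ((σ D c).1 x))) (D : M.Decision)
    (c : M.Ctx D.1) (d : Fin (M.card D.1)) :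
    Tendsto (fun n => gain (π n) D c d) atTop (𝓝 (gain σ D c d)) := by
  refine tendsto_finsetSum _ fun a _ => Tendsto.const_mul _ (tendsto_finsetProd _ fun v _ => ?_)
  by_cases hv : (M.owner v).isSome
  · have e := fun τ : M.Profile ℝ => condProb_of_decision τ ⟨v, hv⟩ (M.ctx v a) (a v)
    simp only [e]
    by_cases hD : (⟨v, hv⟩ : M.Decision) = D
    · subst hD; simp [always]
    · simpa [always, Function.update_of_ne hD] using h ⟨v, hv⟩ (M.ctx v a) (a v)
  · have e : ∀ τ, M.condProb τ v = M.condProb σ v := fun τ => condProb_congr v fun h => absurd h hv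
    simp only [e]
    exact tendsto_const_nhds

/-- How small the trembles have to be. -/
def trembleExp (M : MAID) : ℕ := M.code.size * M.code.size + 6 * M.code.size + 2

theorem abs_tremble_sub_le (K : ℕ) {n : ℕ} (hn : 2 ≤ n) (d x : Fin n) :
    |(((tremble K hn d).1 x : ℚ) : ℝ) - (Pi.single d (1 : ℝ) : Fin n → ℝ) x| ≤ (1 / 2) ^ K := by
  have h1 : (0 : ℝ) < (1 / 2) ^ K := by positivity
  have h2 : (0 : ℝ) ≤ (1 / 2) ^ (K + tailExp n x) := by positivity
  have h3 : (1 / 2 : ℝ) ^ (K + tailExp n x) ≤ (1 / 2) ^ K :=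
    pow_le_pow_of_le_one (by norm_num) (by norm_num) (Nat.le_add_right _ _)
  simp only [tremble, Pi.single_apply]
  rw [abs_le]
  split <;> push_cast <;> constructor <;> linarith

theorem two_pow_mul_tremble_mem_integers {K : ℕ} {n : ℕ} (hn : 2 ≤ n) (d x : Fin n) {E : ℕ}
    (hE : K + n ≤ E) : (((tremble K hn d).1 x : ℚ) : ℝ) * 2 ^ E ∈ integers := by
  obtain ⟨z, hz⟩ := two_pow_mul_tremble K hn d x hE
  exact ⟨z, by simp only [eq_intCast]; exact_mod_cast hz.symm⟩

/-- Optimality is carried from the trembling profile to an arbitrary `π` in four moves. The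
irrelevant rules are replaced by coarse ones of full support (`πK`), which rescales gains. The
relevant rules are made pure (`π₀`), which changes gains by less than the possible gap. The
irrelevant rules are replaced by mixtures of those of `π` with full support (`π'`), which rescales
again. Finally the mixtures tend to `π`, and gains are continuous. Supports may change only in the
second and the last move. -/
theorem dominates_of_respond_eq {s : M.PureProfile} (hs : M.respond M.trembleExp s = s)
    (D : M.Decision) : Dominates s D := by
  classical
  set K := M.trembleExp with hK
  set L := M.code.size with hL
  -- With `K = 0` these rules still have full support, while their denominators divide `2ᴸ`. With
  -- the fine trembles the common denominator would grow with `K`, and the choice of `K` would be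
  -- circular.
  let ν : M.Profile ℝ := M.realProfile (M.trembling 0 s)
  let πK : M.Profile ℝ := fun D' =>
    if M.Relevant D' D then M.realProfile (M.trembling K s) D' else ν D'
  let π₀ : M.Profile ℝ := fun D' => if M.Relevant D' D then s.toProfile D' else ν D'
  intro π hπ c d
  have hopt : gain (M.realProfile (M.trembling K s)) D c d ≤
      gain (M.realProfile (M.trembling K s)) D c (s D c) := by
    have e : s D c = firstMax (M.two_le_card D.1) (gain (M.realProfile (M.trembling K s)) D c) := by
      conv_lhs => rw [← hs]
      rfl
    rw [e]; exact le_firstMax _ _ _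
  have hK' : gain πK D c d ≤ gain πK D c (s D c) := by
    obtain ⟨t, ht, e⟩ := exists_gain_eq_mul (π := M.realProfile (M.trembling K s)) (π' := πK)
      (D := D) (fun D' c x => by
        have h1 := (trembling_pos K s D' c x).ne'
        have h2 := (trembling_pos 0 s D' c x).ne'
        simp only [πK]
        split <;> simp [h1, h2, ν]) (fun D' h1 h2 => (if_pos ⟨h1, h2⟩ : πK D' = _).symm) c
    rw [e, e]
    exact mul_le_mul_of_nonneg_left hopt ht.le
  have h₀ : gain π₀ D c d ≤ gain π₀ D c (s D c) := by
    have hint : ∀ D' c x, (π₀ D' c).1 x * 2 ^ L ∈ integers := by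
      intro D' c x
      simp only [π₀]
      split
      · refine mul_mem ?_ (by exact_mod_cast natCast_mem_integers (2 ^ L))
        simp only [PureProfile.toProfile, Pi.single_apply]
        split
        · exact one_mem _
        · exact zero_mem _
      · exact two_pow_mul_tremble_mem_integers (M.two_le_card D'.1) _ _
          (by simpa using M.card_le_size D'.1)
    have hclose : ∀ D' c x, |(πK D' c).1 x - (π₀ D' c).1 x| ≤ (1 / 2) ^ K := by
      intro D' c x
      simp only [π₀, πK]
      split
      · exact abs_tremble_sub_le K (M.two_le_card D'.1) (s D' c) x
      · simp
    have hc := fun d => abs_le.1 (abs_gain_sub_le (by positivity) hclose D c d)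
    refine le_of_sub_lt (M.denEU_pos L) (gain_mul_mem_integers hint D c d)
      (gain_mul_mem_integers hint D c (s D c)) (M.denEU_le L) ?_
    have h1 := hc d
    have h2 := hc (s D c)
    -- This fixes `trembleExp`: `4 L` pays for the sensitivity of the gain, `2 L + L²` for the
    -- common denominator at `π₀`, and the extra 2 for the two gains compared, with strict
    -- inequality.
    have h3 : 2 * (2 ^ (4 * L) * (1 / 2 : ℝ) ^ K) < 1 / (2 ^ (2 * L + L * L) : ℕ) := by
      have e : (1 / 2 : ℝ) ^ K = 1 / (2 ^ (4 * L) * 2 ^ (2 * L + L * L) * 4) := by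
        rw [one_div_pow]
        congr 1
        rw [hK, trembleExp, ← hL]
        ring
      rw [e]
      push_cast
      have h4 : (0 : ℝ) < 2 ^ (4 * L) := by positivity
      have h5 : (0 : ℝ) < 2 ^ (2 * L + L * L) := by positivity
      rw [mul_one_div, ← mul_div_assoc, div_lt_div_iff₀ (by positivity) h5]
      nlinarith [mul_pos h4 h5]
    linarith [h1.1, h1.2, h2.1, h2.2]
  let δ : ℕ → Set.Icc (0 : ℝ) 1 := fun n => ⟨1 / ((n : ℝ) + 1), by positivity, by
    rw [div_le_one (by positivity)]; linarith [(Nat.cast_nonneg n : (0 : ℝ) ≤ n)]⟩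
  -- The same supports as `π₀`: pure at relevant decisions, full elsewhere, because the weight of
  -- `ν` is positive.
  let π' : ℕ → M.Profile ℝ := fun n D' =>
    if M.Relevant D' D then s.toProfile D' else fun c => mixDist (δ n) (π D' c) (ν D' c)
  have hn : ∀ n, gain (π' n) D c d ≤ gain (π' n) D c (s D c) := by
    intro n
    obtain ⟨t, ht, e⟩ := exists_gain_eq_mul (π := π₀) (π' := π' n)
      (D := D) (fun D' c x => by
        simp only [π₀, π']
        split
        · rfl
        · have h1 := trembling_pos 0 s D' c x
          have h2 : 0 < (mixDist (δ n) (π D' c) (ν D' c)).1 x := by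
            refine add_pos_of_nonneg_of_pos (mul_nonneg (by linarith [(δ n).2.2]) ((π D' c).2.1 x))
              (mul_pos ?_ h1)
            simp only [δ]; positivity
          simp [h2.ne', h1.ne', ν])
        (fun D' h1 h2 => by
          have hr : M.Relevant D' D := ⟨h1, h2⟩
          simp only [π₀, π', if_pos hr]) c
    rw [e, e]
    exact mul_le_mul_of_nonneg_left h₀ ht.le
  have hδ : Tendsto (fun n => (δ n).1) atTop (𝓝 0) := tendsto_one_div_add_atTop_nhds_zero_nat
  have hlim : ∀ D' c x, Tendsto (fun n => (π' n D' c).1 x) atTop (𝓝 ((π D' c).1 x)) := by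
    intro D' c x
    by_cases hr : M.Relevant D' D
    · simp only [π', if_pos hr, hπ D' hr]
      exact tendsto_const_nhds
    · simp only [π', if_neg hr, mixDist]
      have := ((tendsto_const_nhds (x := (1 : ℝ))).sub hδ).mul_const ((π D' c).1 x) |>.add
        (hδ.mul_const ((ν D' c).1 x))
      simpa using this
  exact le_of_tendsto_of_tendsto' (tendsto_gain hlim D c d) (tendsto_gain hlim D c (s D c)) hn

/-- The response dynamics leads to a Nash equilibrium. -/
theorem isNash_iterate_respond (hM : M.SufficientInformation) (s : M.PureProfile) :
    M.IsNash ((M.respond M.trembleExp)^[M.numVars] s).toProfile :=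
  isNash_of_dominates hM fun D => dominates_of_respond_eq (respond_iterate_numVars hM _ s) D

end MAID

/-! ### A simultaneous binary search for maximisers -/

section bisect

variable {α : Type} (pass : List Bool → α → Bool) (T : ℕ)

/-- The binary expansion of the next number to be tried when the leading digits are known. -/
def bisectTrial (l : List Bool) : List Bool :=
  List.replicate (T - 1 - l.length) false ++ true :: l

/-- One step of a simultaneous binary search: keep the candidates that pass the test, if any. -/
def bisectStep (s : List Bool × List α) : List Bool × List α :=
  if s.2.filter (pass (bisectTrial T s.1)) = [] then (false :: s.1, s.2)
  else (true :: s.1, s.2.filter (pass (bisectTrial T s.1)))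

theorem bisectStep_iterate_length (S : List α) (j : ℕ) :
    ((bisectStep pass T)^[j] ([], S)).1.length = j := by
  induction j with
  | zero => rfl
  | succ j ih =>
    rw [Function.iterate_succ_apply', bisectStep]
    split <;> simp [ih]

theorem bisectStep_iterate_sublist (S : List α) (j : ℕ) :
    ((bisectStep pass T)^[j] ([], S)).2.Sublist S := by
  induction j with
  | zero => exact List.Sublist.refl _
  | succ j ih =>
    rw [Function.iterate_succ_apply', bisectStep]
    split
    · exact ih
    · exact List.filter_sublist.trans ih

variable {pass T}

/-- The search finds the leading digits of the largest value among all candidates and discards those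
that fall behind, so exact values are never compared with each other. When all digits are known, the
survivors are the candidates whose value is one more than the number found. -/
theorem bisect_eq_filter {S : List α} {H : α → ℕ}
    (hpass : ∀ b : List Bool, b.length = T → ∀ a, pass b a = true ↔ ofBits b < H a)
    (hS : S ≠ []) (hH : ∀ a ∈ S, 0 < H a ∧ H a ≤ 2 ^ T) :
    ((bisectStep pass T)^[T] ([], S)).2 = S.filter fun a => decide (∀ a' ∈ S, H a' ≤ H a) := by
  -- With `r` digits still to come and `p` the number formed by the leading digits, the survivors
  -- are the candidates above `p 2ʳ`, at least one exists, and no candidate exceeds `(p + 1) 2ʳ`.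
  have key : ∀ j r, j + r = T → ∀ s, (bisectStep pass T)^[j] ([], S) = s →
      s.2 = S.filter (fun a => decide (ofBits s.1 * 2 ^ r < H a)) ∧ s.2 ≠ [] ∧
      ∀ a ∈ S, H a ≤ (ofBits s.1 + 1) * 2 ^ r := by
    intro j
    induction j with
    | zero =>
      rintro r rfl _ rfl
      refine ⟨?_, hS, fun a ha => by simpa using (hH a ha).2⟩
      exact (List.filter_eq_self.2 fun a ha => by simpa using (hH a ha).1).symm
    | succ j ih =>
      intro r hr s hs
      obtain ⟨h1, h2, h3⟩ := ih (r + 1) (by omega) _ rfl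
      have hlen := bisectStep_iterate_length pass T S j
      rw [Function.iterate_succ_apply'] at hs
      generalize (bisectStep pass T)^[j] ([], S) = u at h1 h2 h3 hs hlen
      have hb : (bisectTrial T u.1).length = T := by simp [bisectTrial]; omega
      have hv : ofBits (bisectTrial T u.1) = (2 * ofBits u.1 + 1) * 2 ^ r := by
        rw [bisectTrial, ofBits_append, ofBits_replicate_false, ofBits_cons, List.length_replicate,
          show T - 1 - u.1.length = r by omega]
        simp; ring
      have hf : u.2.filter (pass (bisectTrial T u.1)) =
          S.filter fun a => decide ((2 * ofBits u.1 + 1) * 2 ^ r < H a) := by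
        rw [h1, List.filter_filter]
        refine List.filter_congr fun a _ => ?_
        rw [Bool.eq_iff_iff, Bool.and_eq_true, hpass _ hb, hv, decide_eq_true_iff,
          decide_eq_true_iff, pow_succ]
        constructor
        · exact fun h => h.1
        · exact fun h => ⟨h, by nlinarith [Nat.zero_le (2 ^ r)]⟩
      rw [bisectStep] at hs
      split at hs
      · rename_i hnil
        subst hs
        refine ⟨?_, h2, ?_⟩
        · rw [h1]
          refine List.filter_congr fun a _ => ?_
          simp [pow_succ]; ring_nf
        · intro a ha
          rw [hf, List.filter_eq_nil_iff] at hnil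
          have := hnil a ha
          simpa using this
      · rename_i hnil
        subst hs
        refine ⟨?_, hnil, ?_⟩
        · simpa using hf
        · intro a ha
          refine (h3 a ha).trans (le_of_eq ?_)
          simp [pow_succ]; ring
  obtain ⟨h1, h2, h3⟩ := key T 0 (by omega) _ rfl
  generalize (bisectStep pass T)^[T] ([], S) = u at h1 h2 h3
  simp only [pow_zero, mul_one] at h1 h3
  rw [h1]
  refine List.filter_congr fun a ha => decide_eq_decide.2 ⟨fun h a' ha' => ?_, fun h => ?_⟩
  · have := h3 a' ha'; omega
  · rw [h1] at h2
    obtain ⟨a', ha'⟩ := List.exists_mem_of_ne_nil _ h2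
    obtain ⟨h4, h5⟩ := List.mem_filter.1 ha'
    exact (of_decide_eq_true h5).trans_le (h a' h4)

end bisect

namespace TreeData

/-- The odd number `2 Y + 1 - 2ᵀ`, where `Y` has the `T` binary digits `b`. -/
def offsetNum (b : List Bool) : ℤ :=
  if b.reverse.headD false = true then (ofBits (true :: b.reverse.tail.reverse) : ℤ)
  else -(ofBits (true :: b.reverse.tail.reverse.map not) : ℤ)

/-- The top digit is the sign: if it is one, dropping it subtracts the offset; if it is zero, the
absolute value has the complementary digits. Appending a lowest digit one keeps the number odd, so
no subtraction of binary numbers is needed and the threshold is in lowest terms. -/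
theorem offsetNum_eq {b : List Bool} (hb : b ≠ []) :
    offsetNum b = 2 * ofBits b + 1 - 2 ^ b.length := by
  obtain ⟨l, t, rfl⟩ : ∃ l t, b = l ++ [t] := ⟨_, _, (List.dropLast_append_getLast hb).symm⟩
  have h := ofBits_map_not l
  have h' : ((ofBits (l.map not) : ℕ) : ℤ) + ofBits l + 1 = 2 ^ l.length := by exact_mod_cast h
  rw [ofBits_append]
  cases t
  · simp [offsetNum, pow_succ]; linarith
  · simp [offsetNum, pow_succ]; ring

theorem odd_natAbs_offsetNum (b : List Bool) : Odd (offsetNum b).natAbs := by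
  unfold offsetNum
  split
  · rw [Int.natAbs_natCast, ofBits_cons]; exact ⟨_, rfl⟩
  · rw [Int.natAbs_neg, Int.natAbs_natCast, ofBits_cons]; exact ⟨_, rfl⟩

/-- The threshold with the binary digits `b`, in units of `2⁻ᴷ`. -/
def threshold (K : ℕ) (b : List Bool) : ℚ := (offsetNum b : ℚ) / ((2 ^ K : ℕ) : ℚ)

theorem ofRat_threshold (K : ℕ) (b : List Bool) :
    ofRat (threshold K b) = cons (ofInt (offsetNum b)) (ofNat (2 ^ K)) :=
  ofRat_div (by positivity)
    (Nat.Coprime.pow_right _ (Nat.coprime_two_right.2 (odd_natAbs_offsetNum b)))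

theorem ofInt_natCast (n : ℕ) : ofInt n = cons (ofBool false) (ofNat n) := by
  rw [ofInt, decide_eq_false (by simp)]; rfl

theorem ofInt_neg_natCast {n : ℕ} (hn : 0 < n) : ofInt (-(n : ℤ)) = cons (ofBool true) (ofNat n) := by
  rw [ofInt, decide_eq_true (by simpa using hn)]; simp

end TreeData

namespace PolyTime

variable {ι : Type} {c : ι → TreeData}

theorem threshold {K : ι → ℕ} {b : ι → List Bool} (hK : PolyTime c fun x => ofIndex (K x))
    (hb : PolyTime c fun x => ofList ((b x).map ofBool)) :
    PolyTime c fun x => ofRat (TreeData.threshold (K x) (b x)) := by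
  have hr : PolyTime c fun x => ofList ((b x).reverse.map ofBool) :=
    hb.reverse.congr fun x => by rw [List.map_reverse]
  have hh : PolyTime c fun x => ofBool ((b x).reverse.headD false) :=
    hr.left.congr fun x => by cases (b x).reverse <;> rfl
  have ht : PolyTime c fun x => ofList ((b x).reverse.tail.reverse.map ofBool) :=
    (hr.right.congr (g := fun x => ofList ((b x).reverse.tail.map ofBool))
      fun x => by cases (b x).reverse <;> rfl).reverse.congr fun x => by
        rw [← List.map_reverse]
  have hn : PolyTime c fun x => ofList (((b x).reverse.tail.reverse.map Bool.not).map ofBool) :=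
    (map (α := fun _ => Bool) (ca := fun _ a => ofBool a) (F := fun _ a => ofBool (!a)) ht
      (not (b := fun p : Σ _ : ι, Bool => p.2) id.right)).congr fun x => by rw [List.map_map]; rfl
  have h1 := (ofBits (l := fun x => true :: (b x).reverse.tail.reverse) ((const (ofBool true)).cons ht))
  have h2 := (ofBits (l := fun x => true :: (b x).reverse.tail.reverse.map Bool.not)
    ((const (ofBool true)).cons hn))
  have h3 : PolyTime c fun x => ofInt (offsetNum (b x)) := by
    refine of_bool hh ((((const (ofBool false)).cons h1).restrict _).congr fun x => ?_)
      ((((const (ofBool true)).cons h2).restrict _).congr fun x => ?_)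
    · rw [offsetNum, if_pos x.2, ofInt_natCast]
    · rw [offsetNum, if_neg (by rw [x.2]; exact Bool.false_ne_true), ofInt_neg_natCast (by simp)]
  exact (h3.cons hK.twoPow).congr fun x => (ofRat_threshold _ _).symm

end PolyTime

/-! ### Optimal choices from expected utilities -/

namespace MAID

variable {M : MAID}

/-- The pure profile in which one decision is changed. -/
def choose (s : M.PureProfile) (D : M.Decision) (c : M.Ctx D.1) (d : Fin (M.card D.1)) :
    M.PureProfile := Function.update s D (Function.update (s D) c d)

/-- The expected utility that decides about the choice of `d`. -/
noncomputable def choiceEU (K : ℕ) (s : M.PureProfile) (D : M.Decision) (c : M.Ctx D.1)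
    (d : Fin (M.card D.1)) : ℝ := M.EU (M.agent D) (M.realProfile (M.trembling K (choose s D c d)))

/-- The two rules differ only in the context `c`, where a weight `1 - 2⁻ᴷ` moves from `d'` to `d`;
the tremble does not depend on the intended choice and cancels. -/
theorem choiceEU_sub (K : ℕ) (s : M.PureProfile) (D : M.Decision) (c : M.Ctx D.1)
    (d d' : Fin (M.card D.1)) : choiceEU K s D c d - choiceEU K s D c d' =
      (1 - (1 / 2) ^ K) * (gain (M.realProfile (M.trembling K s)) D c d -
        gain (M.realProfile (M.trembling K s)) D c d') := by
  set π := M.realProfile (M.trembling K s) with hπ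
  let r : Fin (M.card D.1) → M.Rule ℝ D := fun d c' =>
    realDist (tremble K (M.two_le_card D.1) (Function.update (s D) c d c'))
  have e : ∀ d, M.realProfile (M.trembling K (choose s D c d)) = Function.update π D (r d) := by
    intro d
    funext D'
    by_cases h : D' = D
    · subst h
      rw [Function.update_self]
      funext c'
      simp [realProfile, trembling, choose, r]
    · rw [Function.update_of_ne h]
      funext c'
      simp [realProfile, trembling, choose, Function.update_of_ne h, hπ]
  rw [choiceEU, choiceEU, e, e, EU_update_sub, Finset.sum_eq_single c]
  · have h : ∀ x, (r d c).1 x - (r d' c).1 x = (1 - (1 / 2) ^ K) *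
        ((if x = d then 1 else 0) - if x = d' then 1 else 0) := by
      intro x
      simp only [r, realDist, tremble, Function.update_self]
      split <;> split <;> push_cast <;> ring
    have h' : ∀ x, ((r d c).1 x - (r d' c).1 x) * gain π D c x = (1 - (1 / 2) ^ K) *
        ((if x = d then gain π D c x else 0) - if x = d' then gain π D c x else 0) := by
      intro x
      rw [h]
      split <;> split <;> ring
    rw [Finset.sum_congr rfl fun x _ => h' x, ← Finset.mul_sum, Finset.sum_sub_distrib]
    simp
  · intro c' _ hc
    refine Finset.sum_eq_zero fun x _ => ?_
    simp [r, Function.update_of_ne hc]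
  · simp

theorem maxima_choiceEU {K : ℕ} (hK : 0 < K) (s : M.PureProfile) (D : M.Decision) (c : M.Ctx D.1) :
    maxima (choiceEU K s D c) = maxima (gain (M.realProfile (M.trembling K s)) D c) := by
  have h : (1 / 2 : ℝ) ^ K < 1 := pow_lt_one₀ (by norm_num) (by norm_num) hK.ne'
  refine maxima_congr fun d d' => ?_
  rw [← sub_nonneg, choiceEU_sub, mul_nonneg_iff_of_pos_left (by linarith), sub_nonneg]

/-- The thresholds are multiples of `2⁻ᴿ`, where `R` is this number. -/
def resolution (M : MAID) : ℕ :=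
  2 * M.code.size + (M.trembleExp + M.code.size) * M.code.size + 2

/-- The number of steps of the binary search. -/
def searchLength (M : MAID) : ℕ := 3 * M.code.size + M.resolution + 2

open Classical in
/-- The binary search finds the optimal choices. -/
theorem bisect_choiceEU (s : M.PureProfile) (D : M.Decision) (c : M.Ctx D.1) :
    ((bisectStep (fun b d => decide (((threshold M.resolution b : ℚ) : ℝ) <
      choiceEU M.trembleExp s D c d)) M.searchLength)^[M.searchLength]
        ([], List.finRange (M.card D.1))).2 = maxima (choiceEU M.trembleExp s D c) := by
  set K := M.trembleExp
  set L := M.code.size with hL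
  set R := M.resolution with hR
  set T := M.searchLength with hT
  set ev := choiceEU K s D c
  have hint : ∀ d, ev d * M.denEU (K + L) ∈ integers := fun d => EU_mul_mem_integers
    (fun D' c' x => two_pow_mul_tremble_mem_integers (M.two_le_card D'.1) _ _
      (Nat.add_le_add_left (M.card_le_size D'.1) K)) _
  have hgap : ∀ d d', ev d < ev d' → 1 / ((2 ^ (2 * L + (K + L) * L) : ℕ) : ℝ) ≤ ev d' - ev d := by
    intro d d' h
    by_contra hlt
    exact absurd (le_of_sub_lt (M.denEU_pos (K + L)) (hint d') (hint d) (M.denEU_le (K + L))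
      (not_le.1 hlt)) (not_le.2 h)
  have hbd : ∀ d, |ev d| ≤ 2 ^ (3 * L) := fun d => abs_EU_le _ _
  -- The threshold with digits `Y` lies below `ev d` exactly if `Y < y d`, that is, if `Y` is below
  -- the ceiling of `y d`.
  let y : Fin (M.card D.1) → ℝ := fun d => (ev d * 2 ^ R + 2 ^ T - 1) / 2
  -- In units of `2⁻ᴿ` the expected utilities have absolute value at most a quarter of `2ᵀ`, which
  -- puts the ceilings between 1 and `2ᵀ`.
  have h2T : (2 : ℝ) ^ T = 4 * (2 ^ (3 * L) * 2 ^ R) := by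
    rw [hT, searchLength, ← hL, ← hR]; ring
  have h2R : (2 : ℝ) ^ R = ((2 ^ (2 * L + (K + L) * L) : ℕ) : ℝ) * 4 := by
    rw [hR, resolution]; push_cast; ring
  have hRpos : (1 : ℝ) ≤ 2 ^ R := one_le_pow₀ (by norm_num)
  have hLpos : (1 : ℝ) ≤ 2 ^ (3 * L) := one_le_pow₀ (by norm_num)
  have hbd' : ∀ d, |ev d * 2 ^ R| ≤ 2 ^ (3 * L) * 2 ^ R := fun d => by
    rw [abs_mul, abs_of_nonneg (by positivity : (0 : ℝ) ≤ 2 ^ R)]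
    exact mul_le_mul_of_nonneg_right (hbd d) (by positivity)
  have hLR : (1 : ℝ) ≤ 2 ^ (3 * L) * 2 ^ R := one_le_mul_of_one_le_of_one_le hLpos hRpos
  rw [bisect_eq_filter (H := fun d => ⌈y d⌉₊)]
  · refine List.filter_congr fun d _ => decide_eq_decide.2 ⟨fun h d' => ?_, fun h d' _ => ?_⟩
    · by_contra hlt
      push Not at hlt
      have h1 := hgap d d' hlt
      -- Distinct expected utilities differ by at least four units of `2⁻ᴿ`, hence distinct `y` by
      -- at least 2, and rounding up cannot merge them.
      have h2 : y d + 2 ≤ y d' := by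
        have h3 : (0 : ℝ) < ((2 ^ (2 * L + (K + L) * L) : ℕ) : ℝ) := by positivity
        rw [div_le_iff₀ h3] at h1
        simp only [y]
        rw [h2R]
        linarith
      have h4 : (⌈y d'⌉₊ : ℝ) ≤ ⌈y d⌉₊ := by exact_mod_cast h d' (List.mem_finRange d')
      have h5 := Nat.le_ceil (y d')
      have h6 : 0 ≤ y d := by
        have := abs_le.1 (hbd' d)
        simp only [y]; rw [h2T]; linarith [this.1]
      have h7 := Nat.ceil_lt_add_one h6
      linarith
    · refine Nat.ceil_mono ?_
      have := mul_le_mul_of_nonneg_right (h d') (by positivity : (0 : ℝ) ≤ 2 ^ R)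
      simp only [y]
      linarith
  · intro b hb d
    have hb0 : b ≠ [] := by
      rintro rfl
      rw [hT, searchLength] at hb
      simp at hb
    rw [decide_eq_true_iff, Nat.lt_ceil, threshold, offsetNum_eq hb0, hb]
    push_cast
    rw [div_lt_iff₀ (by positivity)]
    simp only [y]
    rw [lt_div_iff₀ (by norm_num)]
    constructor <;> intro h <;> linarith
  · have := M.two_le_card D.1
    intro h
    have h' := congrArg List.length h
    simp at h'
    omega
  · intro d _
    have := abs_le.1 (hbd' d)
    refine ⟨Nat.ceil_pos.2 ?_, Nat.ceil_le.2 ?_⟩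
    · simp only [y]; rw [h2T]; linarith [this.1]
    · push_cast
      simp only [y]; rw [h2T]; linarith [this.2]

end MAID

theorem TreeData.size_bits_le (b : List Bool) : (ofList (b.map ofBool)).size ≤ 4 * b.length + 1 := by
  induction b with
  | nil => simp [ofList, TreeData.size]
  | cons a b ih =>
    have : (ofBool a).size ≤ 3 := by cases a <;> simp [ofBool, TreeData.size]
    simp only [List.map_cons, ofList, TreeData.size, List.length_cons]
    omega

/-! ### One round of the dynamics in polynomial time -/

namespace PolyTime

variable {ι : Type} {c : ι → TreeData}

theorem bisect {α : ι → Type} {ca : (x : ι) → α x → TreeData} {S : (x : ι) → List (α x)}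
    {pass : (x : ι) → List Bool → α x → Bool} {T : ι → ℕ} (hT : PolyTime c fun x => ofIndex (T x))
    (hS : PolyTime c fun x => ofList ((S x).map (ca x)))
    (hpass : PolyTime (fun p : Σ x, List Bool × α x =>
      .cons (c p.1) (.cons (ofList (p.2.1.map ofBool)) (ca p.1 p.2.2)))
      fun p => ofBool (pass p.1 p.2.1 p.2.2)) :
    PolyTime c fun x =>
      ofList (((bisectStep (pass x) (T x))^[T x] ([], S x)).2.map (ca x)) := by
  refine (iterate (σ := fun x => List Bool × List (α x))
    (cs := fun x s => .cons (ofList (s.1.map ofBool)) (ofList (s.2.map (ca x))))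
    (s₀ := fun x => ([], S x)) (step := fun x => bisectStep (pass x) (T x))
    (B := fun x => 4 * T x + 1 + (ofList ((S x).map (ca x))).size + 1) hT (nil.cons hS) ?_ ?_ ?_).right
  · have hd := id (c := fun p : Σ x, List Bool × List (α x) =>
      .cons (c p.1) (.cons (ofList (p.2.1.map ofBool)) (ofList (p.2.2.map (ca p.1)))))
    have hlen : PolyTime _ fun p : Σ x, List Bool × List (α x) => ofIndex p.2.1.length :=
      (length hd.right.left).congr fun p => by rw [List.length_map]
    have htrial := appendBits (l := fun p : Σ x, List Bool × List (α x) =>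
        List.replicate (T p.1 - 1 - p.2.1.length) false) (m := fun p => true :: p.2.1)
      (((hT.comp (g := Sigma.fst) hd.left).sub (const (ofIndex 1))).sub hlen).replicateFalse
      ((const (ofBool true)).cons hd.right.left)
    have hq := id (c := fun q : Σ p : (Σ x, List Bool × List (α x)), α p.1 =>
      .cons (.cons (c q.1.1) (.cons (ofList (q.1.2.1.map ofBool))
        (ofList (q.1.2.2.map (ca q.1.1))))) (ca q.1.1 q.2))
    have hf := filter (α := fun p : Σ x, List Bool × List (α x) => α p.1)
      (ca := fun p a => ca p.1 a) (l := fun p => p.2.2)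
      (p := fun p => pass p.1 (bisectTrial (T p.1) p.2.1)) hd.right.right
      (hpass.comp (g := fun q : Σ p : (Σ x, List Bool × List (α x)), α p.1 =>
        ⟨q.1.1, bisectTrial (T q.1.1) q.1.2.1, q.2⟩)
        (hq.left.left.cons ((htrial.comp (g := Sigma.fst) hq.left).cons hq.right)))
    refine of_cases hf ((((const (ofBool true)).cons hd.right.left).cons hf).restrict _ |>.congr
      fun p => ?_) ((((const (ofBool false)).cons hd.right.left).cons hd.right.right).restrict _
      |>.congr fun p => ?_)
    · have h := p.2
      rw [Ne, ofList_eq_nil, List.map_eq_nil_iff] at h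
      rw [bisectStep, if_neg h]
      rfl
    · have h := p.2
      rw [ofList_eq_nil, List.map_eq_nil_iff] at h
      rw [bisectStep, if_pos h]
      rfl
  · have h : PolyBounded c T := hT.bounded.mono fun x => by rw [size_ofIndex]; omega
    exact ((((PolyBounded.const 4).mul h).add (.const 1)).add hS.bounded).add (.const 1)
  · intro x j hj
    have h1 := size_bits_le ((bisectStep (pass x) (T x))^[j] ([], S x)).1
    rw [bisectStep_iterate_length] at h1
    have h2 := List.Sublist.sum_le_sum
      ((bisectStep_iterate_sublist (pass x) (T x) (S x) j).map fun a => (ca x a).size + 1) (by simp)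
    simp only [TreeData.size]
    rw [size_ofList (List.map _ (S x)), size_ofList (List.map (ca x) _)]
    simp only [List.map_map, Function.comp_def] at h1 h2 ⊢
    omega

open MAID

section

variable {M : ι → MAID} (hM : PolyTime c fun x => (M x).code)

include hM

theorem trembleExp : PolyTime c fun x => ofIndex (M x).trembleExp :=
  ((hM.sizeIndex.mul hM.sizeIndex).add ((const (ofIndex 6)).mul hM.sizeIndex)).add
    (const (ofIndex 2))

theorem resolution : PolyTime c fun x => ofIndex (M x).resolution :=
  (((const (ofIndex 2)).mul hM.sizeIndex).add
    ((hM.trembleExp.add hM.sizeIndex).mul hM.sizeIndex)).add (const (ofIndex 2))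

theorem searchLength : PolyTime c fun x => ofIndex (M x).searchLength :=
  (((const (ofIndex 3)).mul hM.sizeIndex).add hM.resolution).add (const (ofIndex 2))

theorem codeTrembling {k : ℕ} (hk : ∀ x, (M x).DecisionIndegLE k) {s : (x : ι) → (M x).PureProfile}
    {K : ι → ℕ} (hs : PolyTime (fun p : Σ x, Σ D : (M x).Decision, (M x).Ctx D.1 =>
      .cons (c p.1) (.cons (ofIndex p.2.1.1) (ofIndex ((M p.1).ctxIndex _ p.2.2))))
      fun p => ofIndex (s p.1 p.2.1 p.2.2))
    (hK : PolyTime c fun x => ofIndex (K x)) :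
    PolyTime c fun x => ((M x).fixAll ((M x).trembling (K x) (s x))).code := by
  have hd := id (c := fun p : Σ x, Σ D : (M x).Decision, (M x).Ctx D.1 =>
      .cons (c p.1) (.cons (ofIndex p.2.1.1) (ofIndex ((M p.1).ctxIndex _ p.2.2))))
  exact hM.codeFixAll hk (codeDist_tremble
    (card (M := fun p : Σ x, Σ D : (M x).Decision, (M x).Ctx D.1 => M p.1)
      (v := fun p => p.2.1.1) (hM.comp (g := Sigma.fst) hd.left) hd.right.left) hs
    (hK.comp (g := Sigma.fst) hd.left))

omit hM in
theorem lookupChoose {s : (x : ι) → (M x).PureProfile} {D : (x : ι) → (M x).Decision}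
    {a : (x : ι) → (M x).Ctx (D x).1} {d : (x : ι) → Fin ((M x).card (D x).1)}
    (hs : PolyTime c fun x => (M x).codePure (s x))
    (hD : PolyTime c fun x => ofIndex (D x).1)
    (ha : PolyTime c fun x => ofIndex ((M x).ctxIndex _ (a x)))
    (hd : PolyTime c fun x => ofIndex (d x)) :
    PolyTime (fun p : Σ x, Σ D : (M x).Decision, (M x).Ctx D.1 =>
      .cons (c p.1) (.cons (ofIndex p.2.1.1) (ofIndex ((M p.1).ctxIndex _ p.2.2))))
      fun p => ofIndex (choose (s p.1) (D p.1) (a p.1) (d p.1) p.2.1 p.2.2) := by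
  have hb := id (c := fun p : Σ x, Σ D : (M x).Decision, (M x).Ctx D.1 =>
      .cons (c p.1) (.cons (ofIndex p.2.1.1) (ofIndex ((M p.1).ctxIndex _ p.2.2))))
  have hif := (hb.right.left.indexEq (hD.comp (g := Sigma.fst) hb.left)).and
    (hb.right.right.indexEq (ha.comp (g := Sigma.fst) hb.left))
  refine of_bool hif (((hd.comp (g := Sigma.fst) hb.left).restrict _).congr ?_)
    (((lookupPure (M := fun p : Σ x, Σ D : (M x).Decision, (M x).Ctx D.1 => M p.1)
      (D := fun p => p.2.1) (a := fun p => p.2.2)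
      (hs.comp (g := Sigma.fst) hb.left) hb.right.left hb.right.right).restrict _).congr ?_)
  · rintro ⟨⟨x, D', a'⟩, h⟩
    simp only [Bool.and_eq_true, decide_eq_true_eq] at h
    obtain ⟨h1, h2⟩ := h
    obtain rfl : D' = D x := Subtype.ext (Fin.ext h1)
    obtain rfl : a' = a x := finPiFinEquiv.injective (Fin.ext h2)
    simp [choose]
  · rintro ⟨⟨x, D', a'⟩, h⟩
    simp only [← Bool.decide_and, decide_eq_false_iff_not, not_and] at h
    by_cases h1 : D' = D x
    · subst h1
      have : a' ≠ a x := by rintro rfl; exact h rfl rfl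
      simp [choose, Function.update_of_ne this]
    · simp [choose, Function.update_of_ne h1]

end

/-- It suffices to compute a single entry of the new profile. The search tests one choice against
one threshold by asking Is-Best-Response about the trembling profile with this entry changed; the
survivors keep the order of the domain, so their head is the first maximum. -/
theorem codePure_respond {C : Set MAID} {k : ℕ}
    (hC : ∀ M ∈ C, ∀ (D : M.Decision) (r : M.Rule ℚ D), M.fix D r ∈ C)
    (hBR : IsBestResponseInPolyTime {M | M ∈ C ∧ M.SufficientInformation ∧ M.DecisionIndegLE k})
    {M : ι → MAID} (hM : PolyTime c fun x => (M x).code) (hMC : ∀ x, M x ∈ C)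
    (hk : ∀ x, (M x).DecisionIndegLE k) {s : (x : ι) → (M x).PureProfile}
    (hs : PolyTime c fun x => (M x).codePure (s x)) :
    PolyTime c fun x => (M x).codePure ((M x).respond (M x).trembleExp (s x)) := by
  classical
  refine hM.codePure hk ?_
  let κ := Σ x, Σ D : (M x).Decision, (M x).Ctx D.1
  have hb := id (c := fun p : κ =>
      .cons (c p.1) (.cons (ofIndex p.2.1.1) (ofIndex ((M p.1).ctxIndex _ p.2.2))))
  have hM' := hM.comp (g := fun p : κ => p.1) hb.left
  refine (bisect (α := fun p : κ => Fin ((M p.1).card p.2.1.1)) (ca := fun p d => ofIndex (d : ℕ))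
    (S := fun p => List.finRange _) (pass := fun p b d => decide
      (((TreeData.threshold (M p.1).resolution b : ℚ) : ℝ) <
        choiceEU (M p.1).trembleExp (s p.1) p.2.1 p.2.2 d)) hM'.searchLength
    (range (hM'.card hb.right.left)) ?_).left.congr fun p => ?_
  · let κ' := Σ p : κ, List Bool × Fin ((M p.1).card p.2.1.1)
    have hd := id (c := fun q : κ' => .cons (.cons (c q.1.1) (.cons (ofIndex q.1.2.1.1)
      (ofIndex ((M q.1.1).ctxIndex _ q.1.2.2)))) (.cons (ofList (q.2.1.map ofBool)) (ofIndex q.2.2)))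
    have hM'' := hM'.comp (g := fun q : κ' => q.1) hd.left
    refine ltEU hC hBR (M := fun q : κ' => M q.1.1) hM'' (fun q => hMC _)
      (hM''.codeTrembling (fun q => hk _) (lookupChoose (M := fun q : κ' => M q.1.1)
        (hs.comp (g := fun q : κ' => q.1.1) hd.left.left) hd.left.right.left hd.left.right.right
        hd.right.right) hM''.trembleExp)
      (hM''.codeAgent hd.left.right.left) (threshold hM''.resolution hd.right.left)
  · have h := (bisect_choiceEU (s p.1) p.2.1 p.2.2).trans
      (maxima_choiceEU (M := M p.1) (by rw [MAID.trembleExp]; omega) (s p.1) p.2.1 p.2.2)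
    have h' : firstMax ((M p.1).two_le_card p.2.1.1) (gain ((M p.1).realProfile
        ((M p.1).trembling (M p.1).trembleExp (s p.1))) p.2.1 p.2.2) ∈ (maxima (gain ((M p.1).realProfile
        ((M p.1).trembling (M p.1).trembleExp (s p.1))) p.2.1 p.2.2)).head? := by
      rw [firstMax, List.head?_eq_some_head (maxima_ne_nil ((M p.1).two_le_card _) _)]; rfl
    rw [respond]
    generalize firstMax _ _ = m at h' ⊢
    have hl : ∀ l : List (Fin ((M p.1).card p.2.1.1)), m ∈ l.head? →
        (ofList (l.map fun d : Fin _ => ofIndex (d : ℕ))).left = ofIndex m := by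
      rintro (_ | ⟨a, l⟩) hm
      · simp at hm
      · simp only [List.head?_cons, Option.mem_def, Option.some.injEq] at hm
        rw [← hm]; rfl
    rw [← h] at h'
    exact hl _ h'

end PolyTime

/-! ### Iterating the rounds -/

namespace MAID

/-- The bound is the same for all pure profiles of `M`. It keeps the state polynomial over all
rounds, which polynomial time of a single round would not ensure. -/
theorem size_codePure_le (M : MAID) {k : ℕ} (hk : M.DecisionIndegLE k) (s : M.PureProfile) :
    (M.codePure s).size ≤ M.code.size * (M.code.size ^ k * (2 * M.code.size + 2) + 2) + 1 := by
  set L := M.code.size with hL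
  have hn : M.numVars ≤ L := by
    have := length_le_size_ofList ((List.finRange M.numVars).map M.codeVar)
    rw [List.length_map, List.length_finRange] at this
    rw [hL, code_eq, TreeData.size]; omega
  rw [codePure, size_ofList]
  refine Nat.succ_le_succ ((List.sum_le_card_nsmul _ (L ^ k * (2 * L + 2) + 2) ?_).trans ?_)
  · intro m hm
    obtain ⟨t, ht, rfl⟩ := List.mem_map.1 hm
    obtain ⟨v, _, rfl⟩ := List.mem_map.1 ht
    split
    · rename_i h
      rw [codeTable_eq, size_ofList]
      have h1 : ∏ j, M.card (M.pa v j) ≤ L ^ k :=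
        (Finset.prod_le_pow_card _ _ L fun j _ => M.card_le_size _).trans (by
          rw [Finset.card_univ, Fintype.card_fin]
          exact Nat.pow_le_pow_right (size_pos _) (hk ⟨v, h⟩))
      refine Nat.succ_le_succ (Nat.succ_le_succ ((List.sum_le_card_nsmul _ (2 * L + 2) ?_).trans ?_))
      · intro m hm
        obtain ⟨t, ht, rfl⟩ := List.mem_map.1 hm
        obtain ⟨a, _, rfl⟩ := List.mem_map.1 ht
        rw [size_ofIndex]
        have : (s ⟨v, h⟩ a : ℕ) < M.card v := (s ⟨v, h⟩ a).2
        have := M.card_le_size v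
        omega
      · simp only [List.length_map, List.length_finRange, smul_eq_mul]
        exact Nat.mul_le_mul_right _ h1
    · simp only [TreeData.size]; omega
  · simp only [List.length_map, List.length_finRange, smul_eq_mul]
    exact Nat.mul_le_mul_right _ hn

end MAID

theorem proposition10 (C : Set MAID)
    (hC : ∀ M ∈ C, ∀ (D : M.Decision) (r : M.Rule ℚ D), M.fix D r ∈ C) (k : ℕ)
    (hBR : MAID.IsBestResponseInPolyTime
      {M | M ∈ C ∧ M.SufficientInformation ∧ M.DecisionIndegLE k}) :
    MAID.PureNashInPolyTime
      {M | M ∈ C ∧ M.SufficientInformation ∧ M.DecisionIndegLE k} := by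
  let ι := {M : MAID // M ∈ C ∧ M.SufficientInformation ∧ M.DecisionIndegLE k}
  -- Any starting profile would do; each domain has an element 0.
  let s₀ : (M : ι) → M.1.PureProfile := fun M D _ => ⟨0, by have := M.1.two_le_card D.1; omega⟩
  have hM := PolyTime.id (c := fun M : ι => M.1.code)
  have main : PolyTime (fun M : ι => M.1.code) fun M =>
      M.1.codePure ((M.1.respond M.1.trembleExp)^[M.1.numVars] (s₀ M)) := by
    refine PolyTime.iterate (σ := fun M : ι => M.1.PureProfile) (cs := fun M s => M.1.codePure s)
      (step := fun M => M.1.respond M.1.trembleExp) hM.numVars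
      (hM.codePure (fun M => M.2.2.2) (PolyTime.const (.ofIndex 0))) ?_
      ((PolyBounded.size.mul (((PolyBounded.size.pow k).mul (((PolyBounded.const 2).mul
        PolyBounded.size).add (.const 2))).add (.const 2))).add (.const 1))
      fun M j _ => M.1.size_codePure_le M.2.2.2 _
    exact PolyTime.codePure_respond hC hBR PolyTime.id.left (fun p => p.1.2.1)
      (fun p => p.1.2.2.2) PolyTime.id.right
  obtain ⟨P, t, hP, p, hp⟩ := main
  -- Sufficient information is needed only here, for the correctness of the answer; the running time
  -- rests on the oracle and on the in-degree bound.
  exact ⟨P, p, fun M hM => ⟨_, t ⟨M, hM⟩, M.isNash_iterate_respond hM.2.1 (s₀ ⟨M, hM⟩),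
    hP ⟨M, hM⟩, hp ⟨M, hM⟩⟩⟩
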